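/- Let $\mathbf k$ be a field of characteristic zero. Let $\underline{\mathcal P}$ be a quadratic non-$\Sigma$ operad in $\mathbf k$-vector spaces (concentrated in degree $0$), that is, $\underline{\mathcal P}$ is generated by the finite-dimensional space $\underline{\mathcal P}(2)$ with all relations generated by those of arity three; in particular, $\underline{\mathcal P}$ may be any quadratic Koszul non-$\Sigma$ operad. Let $\mathcal P$ be its symmetrization, $\mathcal P(n)=\underline{\mathcal P}(n)\otimes\mathbf k[\Sigma_n]$, and let $\underline{\mathcal P}^!\subset\mathcal P^!$ be the quadratic duals of $\underline{\mathcal P}$ and $\mathcal P$. For a $\mathcal P$-algebra $A$ with structure map $\alpha:\mathcal P\to\mathcal End_A$ let $$C^m_{\mathcal P}(A;A)=\big[\mathrm{Lin}((\downarrow A)^{\otimes (m+1)},\downarrow A)\otimes\mathcal P^!(m+1)\big]^{\Sigma_{m+1}},\qquad m\ge 0,$$ be the operadic cochain complex, with differential $d_{\mathcal P}$ given by the bracket with $(\alpha\otimes\mathrm{id})(\chi)$, where $\chi\in(\mathcal P\otimes\mathcal P^!)(2)$ is the canonical element, corresponding to the identity of $\mathcal P(2)$. For $m\ge 0$ let $\mathcal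 B^m_{\underline{\mathcal P}}(0)$ be the space of order-preserving natural constants of degree $m$: the span of the families $U_{(T,\varphi)}=\big(\mathrm{Aver}(T_A\otimes\varphi)\in C^m_{\mathcal P}(A;A)\big)_A$ indexed by all $\mathcal P$-algebras $A$, where $T$ is a planar rooted tree with $m+1$ input legs in the planar order and with vertices of arity at least two decorated by elements of $\underline{\mathcal P}$, $T_A\in \mathrm{Lin}(A^{\otimes(m+1)},A)$ is its composite in $\mathcal End_A$, and $\varphi\in\underline{\mathcal P}^!(m+1)\subset\mathcal P^!(m+1)$. Let $\delta_{\underline{\mathcal P}}$ be the differential induced by $d_{\mathcal P}$. Let $(\underline{\mathcal P}\otimes\underline{\mathcal P}^!)_*$ be the graded Lie algebra with $\underline{\mathcal P}(m)\otimes\underline{\mathcal P}^!(m)$ in degree $m-1$ and with bracket $$[f,g]=f\circ g-(-1)^{(m-1)(n-1)}g\circ f,\qquad f\circ g=\sum_{1\le i\le m}(-1)^{(n-1)(i-1)}f\circ_i g,$$ for $f$ of arity $m$ and $g$ of arity $n$, and let $\delta_{\underline\chi}(t)=[t,\underline\chi]$, where $\underline\chi\in(\underline{\mathcal P}\otimes\underline{\mathcal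 P}^!)(2)\cong\underline{\mathcal P}(2)\otimes\underline{\mathcal P}(2)^{\#}$ is the non-$\Sigma$ canonical element, corresponding to the identity of $\underline{\mathcal P}(2)$. Then $\delta_{\underline{\mathcal P}}$ maps $\mathcal B^m_{\underline{\mathcal P}}(0)$ to $\mathcal B^{m+1}_{\underline{\mathcal P}}(0)$, one has $\delta_{\underline{\mathcal P}}^2=0$ and $\delta_{\underline\chi}^2=0$, the degree $-1$ component of $(\underline{\mathcal P}\otimes\underline{\mathcal P}^!)_*$ vanishes, and there is an isomorphism of cochain complexes $$(\mathcal B^*_{\underline{\mathcal P}}(0),\delta_{\underline{\mathcal P}})\cong\big((\underline{\mathcal P}\otimes\underline{\mathcal P}^!)_*,\delta_{\underline\chi}\big).$$ -/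

import Mathlib

open scoped TensorProduct

universe u

noncomputable section

/-! ### Operads -/

/-- The operations underlying a non-symmetric operad in `k`-vector spaces (in degree zero): arity
components, a unit, and partial compositions `p ∘ᵢ q` for `p` of arity `m` and `q` of arity `n`.
Inputs are numbered from `0`; the arity `l = m + n - 1` of the composite is given by
`l + 1 = m + n`. -/
structure OperadData (k : Type u) [Field k] where
  obj : ℕ → Type u
  [grp : ∀ n, AddCommGroup (obj n)]
  [mod : ∀ n, Module k (obj n)]
  one : obj 1
  comp : ∀ {m n l : ℕ}, l + 1 = m + n → Fin m → (obj m →ₗ[k] obj n →ₗ[k] obj l)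

attribute [instance] OperadData.grp OperadData.mod

/-- A non-symmetric operad in `k`-vector spaces: unit axioms, and the sequential and parallel
associativity axioms of the partial compositions. -/
structure NSOperad (k : Type u) [Field k] extends OperadData k where
  one_comp : ∀ {n : ℕ} (h : n + 1 = 1 + n) (q : obj n), comp h 0 one q = q
  comp_one : ∀ {m : ℕ} (h : m + 1 = m + 1) (i : Fin m) (p : obj m), comp h i p one = p
  assoc_seq : ∀ {m n r s t w : ℕ} (h₁ : s + 1 = m + n) (h₂ : w + 1 = s + r) (h₃ : t + 1 = n + r)
    (h₄ : w + 1 = m + t) (i : Fin m) (j : Fin n) (ij : Fin s) (_ : (ij : ℕ) = i + j)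
    (p : obj m) (q : obj n) (x : obj r),
    comp h₂ ij (comp h₁ i p q) x = comp h₄ i p (comp h₃ j q x)
  assoc_par : ∀ {m n r s t w : ℕ} (h₁ : s + 1 = m + n) (h₂ : w + 1 = s + r) (h₃ : t + 1 = m + r)
    (h₄ : w + 1 = t + n) (i j : Fin m) (_ : i < j) (j' : Fin s) (_ : (j' : ℕ) + 1 = j + n)
    (i' : Fin t) (_ : (i' : ℕ) = i) (p : obj m) (q : obj n) (x : obj r),
    comp h₂ j' (comp h₁ i p q) x = comp h₄ i' (comp h₃ j p x) q

/-- The operations underlying a symmetric operad: in addition, a right action of the symmetric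
group on each arity component; `act σ p` is `p · σ`. -/
structure SymOperadData (k : Type u) [Field k] extends OperadData k where
  act : ∀ {n : ℕ}, Equiv.Perm (Fin n) → (obj n →ₗ[k] obj n)
  act_one : ∀ {n : ℕ} (p : obj n), act 1 p = p
  act_mul : ∀ {n : ℕ} (σ τ : Equiv.Perm (Fin n)) (p : obj n), act (σ * τ) p = act τ (act σ p)

variable {k : Type u} [Field k]

/-- The numbering of the inputs of `p ∘ᵢ q`: the inputs `x ≠ i` of `p` and all the inputs of `q`. -/
def inputFun {m n l : ℕ} (h : l + 1 = m + n) (i : Fin m) : {x : Fin m // x ≠ i} ⊕ Fin n → Fin l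
  | Sum.inl x => if hx : (x.1 : ℕ) < i then ⟨x.1, by omega⟩
      else ⟨x.1 + n - 1, by
        have h1 := x.2
        have h2 : (x.1 : ℕ) ≠ i := fun e => h1 (Fin.ext e)
        omega⟩
  | Sum.inr y => ⟨i + y, by omega⟩

theorem inputFun_bijective {m n l : ℕ} (h : l + 1 = m + n) (i : Fin m) :
    Function.Bijective (inputFun h i) := by
  rw [Fintype.bijective_iff_injective_and_card]
  constructor
  · rintro (⟨x, hx⟩ | x) (⟨y, hy⟩ | y) hxy
    · have h1 : (x : ℕ) ≠ i := fun e => hx (Fin.ext e)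
      have h2 : (y : ℕ) ≠ i := fun e => hy (Fin.ext e)
      simp only [inputFun] at hxy
      have : (x : ℕ) = y := by
        split_ifs at hxy <;> simp only [Fin.mk.injEq] at hxy <;> omega
      simp [Fin.ext this]
    · have h1 : (x : ℕ) ≠ i := fun e => hx (Fin.ext e)
      simp only [inputFun] at hxy
      split_ifs at hxy <;> simp only [Fin.mk.injEq] at hxy <;> omega
    · have h1 : (y : ℕ) ≠ i := fun e => hy (Fin.ext e)
      simp only [inputFun] at hxy
      split_ifs at hxy <;> simp only [Fin.mk.injEq] at hxy <;> omega
    · simp only [inputFun, Fin.mk.injEq] at hxy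
      have : (x : ℕ) = y := by omega
      simp [Fin.ext this]
  · have hm := i.pos
    simp [Fintype.card_subtype_compl]
    omega

def inputEquiv {m n l : ℕ} (h : l + 1 = m + n) (i : Fin m) :
    {x : Fin m // x ≠ i} ⊕ Fin n ≃ Fin l :=
  Equiv.ofBijective _ (inputFun_bijective h i)

/-- The arity-wise tensor product of two operads. -/
def OperadData.tensor (P Q : OperadData k) : OperadData k where
  obj n := P.obj n ⊗[k] Q.obj n
  one := P.one ⊗ₜ Q.one
  comp h i := TensorProduct.map₂ (P.comp h i) (Q.comp h i)

def SymOperadData.tensor (P Q : SymOperadData k) : SymOperadData k where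
  toOperadData := P.toOperadData.tensor Q.toOperadData
  act σ := TensorProduct.map (P.act σ) (Q.act σ)
  act_one {n} p := by
    have h1 : P.act (1 : Equiv.Perm (Fin n)) = LinearMap.id := LinearMap.ext P.act_one
    have h2 : Q.act (1 : Equiv.Perm (Fin n)) = LinearMap.id := LinearMap.ext Q.act_one
    rw [h1, h2, TensorProduct.map_id]
    rfl
  act_mul σ τ p := by
    have h1 : P.act (σ * τ) = P.act τ ∘ₗ P.act σ := LinearMap.ext (P.act_mul σ τ)
    have h2 : Q.act (σ * τ) = Q.act τ ∘ₗ Q.act σ := LinearMap.ext (Q.act_mul σ τ)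
    rw [h1, h2, TensorProduct.map_comp]
    rfl

/-! ### Symmetrization -/

/-- The permutation `σ ∘ᵢ τ` with `(p · σ) ∘ᵢ (q · τ) = (p ∘_{σ i} q) · (σ ∘ᵢ τ)`. -/
def permComp {m n l : ℕ} (h : l + 1 = m + n) (i : Fin m) (σ : Equiv.Perm (Fin m))
    (τ : Equiv.Perm (Fin n)) : Equiv.Perm (Fin l) :=
  (inputEquiv h i).symm.trans
    ((Equiv.sumCongr
        (σ.subtypeEquiv (p := (· ≠ i)) (q := (· ≠ σ i)) fun _ => (σ.injective.ne_iff).symm)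
        τ).trans (inputEquiv h (σ i)))

/-- The symmetrization of a non-symmetric operad, with `n`-th component
`P(n) ⊗ k[Σₙ]` (the free right `Σₙ`-module on `P(n)`); `single σ p` is `p · σ`. -/
def OperadData.symmetrization (P : OperadData k) : SymOperadData k where
  obj n := Equiv.Perm (Fin n) →₀ P.obj n
  one := Finsupp.single 1 P.one
  comp {m n l} h i := Finsupp.lsum k fun σ : Equiv.Perm (Fin m) =>
    (Finsupp.lsum k fun τ : Equiv.Perm (Fin n) =>
      ((P.comp h (σ i)).compr₂ (Finsupp.lsingle (permComp h i σ τ))).flip).flip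
  act {n} τ := Finsupp.lmapDomain (P.obj n) k fun σ => σ * τ
  act_one p := by
    simp only [Finsupp.lmapDomain_apply, mul_one]
    exact Finsupp.mapDomain_id
  act_mul σ τ p := by
    simp only [Finsupp.lmapDomain_apply, ← Finsupp.mapDomain_comp, ← mul_assoc]
    rfl

instance (P : OperadData k) (n : ℕ) [Module.Finite k (P.obj n)] :
    Module.Finite k (P.symmetrization.obj n) :=
  inferInstanceAs (Module.Finite k (Equiv.Perm (Fin n) →₀ P.obj n))

/-! ### Endomorphism operads and algebras -/

section Endo

variable (A : Type u) [AddCommGroup A] [Module k A]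

/-- The arguments of `f` in `f ∘ᵢ g`. -/
def endArgs {m n l : ℕ} (h : l + 1 = m + n) (i : Fin m)
    (g : MultilinearMap k (fun _ : Fin n => A) A) (a : Fin l → A) (x : Fin m) : A :=
  if hx : x = i then g fun y => a (inputEquiv h i (Sum.inr y))
  else a (inputEquiv h i (Sum.inl ⟨x, hx⟩))

variable {A}

theorem endArgs_eq_update {m n l : ℕ} (h : l + 1 = m + n) (i : Fin m)
    (g g' : MultilinearMap k (fun _ : Fin n => A) A) (a : Fin l → A) :
    endArgs A h i g' a = Function.update (endArgs A h i g a) i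
      (g' fun y => a (inputEquiv h i (Sum.inr y))) := by
  funext x
  by_cases hx : x = i
  · subst hx
    simp [endArgs]
  · simp [endArgs, hx]

theorem endArgs_update_inl {m n l : ℕ} (h : l + 1 = m + n) (i : Fin m)
    (g : MultilinearMap k (fun _ : Fin n => A) A) (a : Fin l → A) (x : {x : Fin m // x ≠ i})
    (b : A) :
    endArgs A h i g (Function.update a (inputEquiv h i (Sum.inl x)) b) =
      Function.update (endArgs A h i g a) x.1 b := by
  funext z
  by_cases hz : z = i
  · subst hz
    have : z ≠ x.1 := fun e => x.2 e.symm
    simp [endArgs, Function.update_of_ne this]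
  · by_cases hzx : z = x.1
    · subst hzx
      simp [endArgs, hz]
    · have h2 : (⟨z, hz⟩ : {x : Fin m // x ≠ i}) ≠ x := fun e => hzx (congrArg Subtype.val e)
      simp [endArgs, hz, hzx, h2]

theorem endArgs_update_inr {m n l : ℕ} (h : l + 1 = m + n) (i : Fin m)
    (g : MultilinearMap k (fun _ : Fin n => A) A) (a : Fin l → A) (y : Fin n) (b : A) :
    endArgs A h i g (Function.update a (inputEquiv h i (Sum.inr y)) b) =
      Function.update (endArgs A h i g a) i
        (g (Function.update (fun y => a (inputEquiv h i (Sum.inr y))) y b)) := by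
  funext z
  by_cases hz : z = i
  · subst hz
    simp only [endArgs, dif_pos, Function.update_self]
    congr 1
    funext w
    by_cases hw : w = y
    · subst hw
      simp
    · simp [hw]
  · simp [endArgs, hz]

/-- `(f ∘ᵢ g)(a₁, …) = f(a₁, …, g(aᵢ, …), …)`. -/
def endCompFun {m n l : ℕ} (h : l + 1 = m + n) (i : Fin m)
    (f : MultilinearMap k (fun _ : Fin m => A) A) (g : MultilinearMap k (fun _ : Fin n => A) A) :
    MultilinearMap k (fun _ : Fin l => A) A :=
  MultilinearMap.mk' (fun a => f (endArgs A h i g a))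
    (by
      intro a z b c
      obtain ⟨w, rfl⟩ := (inputEquiv h i).surjective z
      rcases w with x | y
      · simp only [endArgs_update_inl, MultilinearMap.map_update_add]
      · simp only [endArgs_update_inr, MultilinearMap.map_update_add])
    (by
      intro a z r b
      obtain ⟨w, rfl⟩ := (inputEquiv h i).surjective z
      rcases w with x | y
      · simp only [endArgs_update_inl, MultilinearMap.map_update_smul]
      · simp only [endArgs_update_inr, MultilinearMap.map_update_smul])

variable (k A)

/-- The endomorphism operad of `A`, with `n`-th component `Lin(A^{⊗n}, A)` and the right action
`(f · σ)(a₁, …, aₙ) = f(a_{σ⁻¹(1)}, …, a_{σ⁻¹(n)})`. -/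
def endOperad : SymOperadData k where
  obj n := MultilinearMap k (fun _ : Fin n => A) A
  one := MultilinearMap.ofSubsingleton k A A (0 : Fin 1) LinearMap.id
  comp h i := LinearMap.mk₂ k (endCompFun h i)
    (fun _ _ _ => rfl) (fun _ _ _ => rfl)
    (fun f g g' => by
      ext a
      change f _ = f _ + f _
      rw [endArgs_eq_update h i g (g + g'), endArgs_eq_update h i g g',
        add_apply, MultilinearMap.map_update_add, ← endArgs_eq_update])
    (fun c f g => by
      ext a
      change f _ = c • f _
      rw [endArgs_eq_update h i g (c • g), smul_apply,
        MultilinearMap.map_update_smul, ← endArgs_eq_update])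
  act σ :=
    { toFun := fun f => f.domDomCongr σ⁻¹
      map_add' := fun _ _ => rfl
      map_smul' := fun _ _ => rfl }
  act_one f := rfl
  act_mul σ τ f := by
    ext a
    change f _ = f _
    rfl

end Endo

/-- An algebra over a symmetric operad `P`: a vector space with a morphism of operads from `P` to
its endomorphism operad. -/
structure OperadAlgebra (P : SymOperadData k) where
  carrier : Type u
  [grp : AddCommGroup carrier]
  [mod : Module k carrier]
  α : ∀ n, P.obj n →ₗ[k] (endOperad k carrier).obj n
  α_one : α 1 P.one = (endOperad k carrier).one
  α_comp : ∀ {m n l : ℕ} (h : l + 1 = m + n) (i : Fin m) (p : P.obj m) (q : P.obj n),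
    α l (P.comp h i p q) = (endOperad k carrier).comp h i (α m p) (α n q)
  α_act : ∀ {n : ℕ} (σ : Equiv.Perm (Fin n)) (p : P.obj n),
    α n (P.act σ p) = (endOperad k carrier).act σ (α n p)

attribute [instance] OperadAlgebra.grp OperadAlgebra.mod

/-! ### Ideals and quotients -/

def OperadData.IsIdeal (P : OperadData k) (J : ∀ n, Submodule k (P.obj n)) : Prop :=
  ∀ {m n l : ℕ} (h : l + 1 = m + n) (i : Fin m) (p : P.obj m) (q : P.obj n),
    p ∈ J m ∨ q ∈ J n → P.comp h i p q ∈ J l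

def SymOperadData.IsIdeal (P : SymOperadData k) (J : ∀ n, Submodule k (P.obj n)) : Prop :=
  P.toOperadData.IsIdeal J ∧
    ∀ {n : ℕ} (σ : Equiv.Perm (Fin n)) (p : P.obj n), p ∈ J n → P.act σ p ∈ J n

/-- The operadic ideal generated by `G`. -/
def OperadData.ideal (P : OperadData k) (G : ∀ n, Set (P.obj n)) (n : ℕ) :
    Submodule k (P.obj n) :=
  ⨅ (J : ∀ n, Submodule k (P.obj n)) (_ : P.IsIdeal J ∧ ∀ m, G m ⊆ J m), J n

/-- The symmetric operadic ideal generated by `G`. -/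
def SymOperadData.ideal (P : SymOperadData k) (G : ∀ n, Set (P.obj n)) (n : ℕ) :
    Submodule k (P.obj n) :=
  ⨅ (J : ∀ n, Submodule k (P.obj n)) (_ : P.IsIdeal J ∧ ∀ m, G m ⊆ J m), J n

theorem OperadData.ideal_isIdeal (P : OperadData k) (G : ∀ n, Set (P.obj n)) :
    P.IsIdeal (P.ideal G) := by
  intro m n l h i p q hpq
  simp only [OperadData.ideal, Submodule.mem_iInf] at hpq ⊢
  exact fun J hJ => hJ.1 h i p q (hpq.imp (fun a => a J hJ) (fun a => a J hJ))

theorem SymOperadData.ideal_isIdeal (P : SymOperadData k) (G : ∀ n, Set (P.obj n)) :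
    P.IsIdeal (P.ideal G) := by
  constructor
  · intro m n l h i p q hpq
    simp only [SymOperadData.ideal, Submodule.mem_iInf] at hpq ⊢
    exact fun J hJ => hJ.1.1 h i p q (hpq.imp (fun a => a J hJ) (fun a => a J hJ))
  · intro n σ p hp
    simp only [SymOperadData.ideal, Submodule.mem_iInf] at hp ⊢
    exact fun J hJ => hJ.1.2 σ p (hp J hJ)

theorem SymOperadData.subset_ideal (P : SymOperadData k) (G : ∀ n, Set (P.obj n)) (n : ℕ) :
    G n ⊆ P.ideal G n := by
  intro x hx
  simp only [SymOperadData.ideal, SetLike.mem_coe, Submodule.mem_iInf]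
  exact fun J hJ => hJ.2 n hx

theorem OperadData.subset_ideal (P : OperadData k) (G : ∀ n, Set (P.obj n)) (n : ℕ) :
    G n ⊆ P.ideal G n := by
  intro x hx
  simp only [OperadData.ideal, SetLike.mem_coe, Submodule.mem_iInf]
  exact fun J hJ => hJ.2 n hx

def OperadData.quotient (P : OperadData k) (J : ∀ n, Submodule k (P.obj n)) (hJ : P.IsIdeal J) :
    OperadData k where
  obj n := P.obj n ⧸ J n
  one := (J 1).mkQ P.one
  comp {m n l} h i := ((P.comp h i).compr₂ (J l).mkQ).liftQ₂ (J m) (J n)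
    (fun p hp => LinearMap.ext fun q => by
      simpa using hJ h i p q (Or.inl hp))
    (fun q hq => LinearMap.ext fun p => by
      simpa using hJ h i p q (Or.inr hq))

def SymOperadData.quotient (P : SymOperadData k) (J : ∀ n, Submodule k (P.obj n))
    (hJ : P.IsIdeal J) : SymOperadData k where
  toOperadData := P.toOperadData.quotient J hJ.1
  act {n} σ := (J n).mapQ (J n) (P.act σ) fun p hp => hJ.2 σ p hp
  act_one {n} p := by
    obtain ⟨p, rfl⟩ := (J n).mkQ_surjective p
    exact congrArg (J n).mkQ (P.act_one p)
  act_mul {n} σ τ p := by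
    obtain ⟨p, rfl⟩ := (J n).mkQ_surjective p
    exact congrArg (J n).mkQ (P.act_mul σ τ p)

/-! ### Free operads on binary operations, quadratic operads -/

/-- Planar binary trees with vertices decorated by `S`. -/
inductive BinTree (S : Type u) : Type u
  | leaf : BinTree S
  | node : S → BinTree S → BinTree S → BinTree S

namespace BinTree

variable {S : Type u}

/-- The number of leaves. -/
def leaves : BinTree S → ℕ
  | leaf => 1
  | node _ a b => a.leaves + b.leaves

/-- Grafting of the root of `s` to the `i`-th leaf of a tree. -/
def graft : BinTree S → ℕ → BinTree S → BinTree S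
  | leaf, _, s => s
  | node c a b, i, s =>
    if i < a.leaves then node c (a.graft i s) b else node c a (b.graft (i - a.leaves) s)

theorem leaves_graft (t s : BinTree S) (i : ℕ) (hi : i < t.leaves) :
    (t.graft i s).leaves + 1 = t.leaves + s.leaves := by
  induction t generalizing i with
  | leaf => simp [graft, leaves, add_comm]
  | node c a b iha ihb =>
    simp only [leaves] at hi
    by_cases h : i < a.leaves
    · have := iha i h
      simp only [graft, if_pos h, leaves]
      omega
    · have := ihb (i - a.leaves) (by omega)
      simp only [graft, if_neg h, leaves]
      omega

/-- Replacing the decorations along `f`. -/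
def map {S' : Type u} (f : S → S') : BinTree S → BinTree S'
  | leaf => leaf
  | node c a b => node (f c) (a.map f) (b.map f)

theorem leaves_map {S' : Type u} (f : S → S') (t : BinTree S) : (t.map f).leaves = t.leaves := by
  induction t with
  | leaf => rfl
  | node c a b iha ihb => simp [map, leaves, iha, ihb]

/-- The corolla with two leaves. -/
def corolla (c : S) : {t : BinTree S // t.leaves = 2} := ⟨node c leaf leaf, rfl⟩

end BinTree

variable (k) in
/-- The free non-symmetric operad on a set `S` of binary operations. -/
def freeNS (S : Type u) : OperadData k where
  obj n := {t : BinTree S // t.leaves = n} →₀ k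
  one := Finsupp.single ⟨BinTree.leaf, rfl⟩ 1
  comp {m n l} h i :=
    Finsupp.linearCombination k fun t : {t : BinTree S // t.leaves = m} =>
      Finsupp.linearCombination k fun s : {t : BinTree S // t.leaves = n} =>
        Finsupp.single (⟨t.1.graft i s.1, by
          have h1 := t.2
          have h2 := s.2
          have := t.1.leaves_graft s.1 i (by omega)
          omega⟩ : {t : BinTree S // t.leaves = l}) (1 : k)

variable (k) in
/-- The map of free operads induced by a map of sets of binary operations. -/
def freeNSMap {S S' : Type u} (f : S → S') (n : ℕ) : (freeNS k S).obj n →ₗ[k] (freeNS k S').obj n :=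
  Finsupp.lmapDomain k k fun t : {t : BinTree S // t.leaves = n} =>
    (⟨t.1.map f, (t.1.leaves_map f).trans t.2⟩ : {t : BinTree S' // t.leaves = n})

variable (k) in
/-- The generator of the free operad given by `c ∈ S`. -/
def freeNSGen {S : Type u} (c : S) : (freeNS k S).obj 2 :=
  Finsupp.single (BinTree.corolla c) 1

/-- The composite in `P` of the elements of `P(2)` that decorate a tree:
the value of a tree with root `c` and branches `a`, `b` is `c(a, b) = (c ∘₂ b) ∘₁ a`. -/
def OperadData.evalTree (P : OperadData k) : (t : BinTree (P.obj 2)) → P.obj t.leaves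
  | BinTree.leaf => P.one
  | BinTree.node c a b =>
    P.comp (m := 1 + b.leaves) (n := a.leaves) (by simp only [BinTree.leaves]; omega)
      ⟨0, by omega⟩
      (P.comp (m := 2) (n := b.leaves) (l := 1 + b.leaves) (by omega) 1 c (P.evalTree b))
      (P.evalTree a)

/-- The canonical map from the free operad on `P(2)` to `P`. -/
def OperadData.eval (P : OperadData k) (n : ℕ) : (freeNS k (P.obj 2)).obj n →ₗ[k] P.obj n :=
  Finsupp.linearCombination k fun t : {t : BinTree (P.obj 2) // t.leaves = n} =>
    t.2 ▸ P.evalTree t.1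

/-- `P` is (binary) quadratic: it is generated by `P(2)`, and all relations follow from those
of arity three, that is, from the kernel of the canonical map in arity three. (The set-theoretic
generators also need the kernel in arity two, which just says that `P(2)` is a vector space.) -/
def OperadData.IsQuadratic (P : OperadData k) : Prop :=
  ∀ n, Function.Surjective (P.eval n) ∧
    LinearMap.ker (P.eval n) ≤
      (freeNS k (P.obj 2)).ideal (fun m => {x | (m = 2 ∨ m = 3) ∧ P.eval m x = 0}) n

/-! ### Quadratic duals -/

section NSDual

variable (P : OperadData k)

/-- The quadratic relations of a non-symmetric operad: the pairs `(x₁, x₂)` of elements of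
`P(2) ⊗ P(2)` with `∘₁(x₁) + ∘₂(x₂) = 0` in `P(3)`. Such pairs form the arity three
component of the free operad on the vector space `P(2)`. -/
def OperadData.nsRelations : Submodule k (Fin 2 → P.obj 2 ⊗[k] P.obj 2) :=
  LinearMap.ker (∑ j : Fin 2,
    TensorProduct.lift (P.comp (m := 2) (n := 2) (l := 3) rfl j) ∘ₗ LinearMap.proj j)

/-- The relations of the non-symmetric quadratic dual among the generators `P(2)^#`: in arity
two, the generators depend linearly on the elements of `P(2)^#`; in arity three, the annihilator
of the relations of `P` under the pairing that is `+` the evaluation on the summand of `∘₁` and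
`-` the evaluation on the summand of `∘₂`. -/
inductive OperadData.NSDualRel :
    ∀ n, (freeNS k (Module.Dual k (P.obj 2))).obj n → Prop
  | add (f g : Module.Dual k (P.obj 2)) :
      NSDualRel 2 (freeNSGen k (f + g) - freeNSGen k f - freeNSGen k g)
  | smul (c : k) (f : Module.Dual k (P.obj 2)) :
      NSDualRel 2 (freeNSGen k (c • f) - c • freeNSGen k f)
  | quadratic (w : Fin 2 × Module.Dual k (P.obj 2) × Module.Dual k (P.obj 2) →₀ k)
      (hw : ∀ x ∈ P.nsRelations, (w.sum fun z c =>
        c * (-1) ^ (z.1 : ℕ) * TensorProduct.dualDistrib k _ _ (z.2.1 ⊗ₜ z.2.2) (x z.1)) = 0) :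
      NSDualRel 3 (w.sum fun z c =>
        c • (freeNS k (Module.Dual k (P.obj 2))).comp (m := 2) (n := 2) (l := 3) rfl z.1
          (freeNSGen k z.2.1) (freeNSGen k z.2.2))

/-- The quadratic dual of a non-symmetric operad. -/
def OperadData.nsDual : OperadData k :=
  (freeNS k (Module.Dual k (P.obj 2))).quotient _
    ((freeNS k (Module.Dual k (P.obj 2))).ideal_isIdeal fun n => {x | P.NSDualRel n x})

/-- The generators of the quadratic dual. -/
def OperadData.nsDualGen : Module.Dual k (P.obj 2) →ₗ[k] P.nsDual.obj 2 where
  toFun f := Submodule.mkQ _ (freeNSGen k f)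
  map_add' f g := by
    refine (Submodule.Quotient.eq _).2 ?_
    rw [← sub_sub]
    exact OperadData.subset_ideal _ _ _ (OperadData.NSDualRel.add f g)
  map_smul' c f := by
    exact (Submodule.Quotient.eq _).2 (OperadData.subset_ideal _ _ _ (OperadData.NSDualRel.smul c f))

/-- The non-symmetric canonical element: the image of the identity of `P(2)` in
`P(2) ⊗ P(2)^# ≅ (P ⊗ P^!)(2)`. -/
def OperadData.nsCanonical [Module.Finite k (P.obj 2)] : (P.tensor P.nsDual).obj 2 :=
  TensorProduct.map LinearMap.id P.nsDualGen (coevaluation k (P.obj 2) 1)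

end NSDual

section SymDual

variable (P : SymOperadData k)

/-- The quadratic relations of a symmetric operad: the triples of elements of `P(2) ⊗ P(2)` with
`∑ⱼ ∘₁(xⱼ) · cʲ = 0` in `P(3)`, where `c` is a cyclic permutation. Triples form (for generators
`P(2)` with its `Σ₂`-action) the arity three component
`(P(2) ⊗ P(2)) ⊕ (P(2) ⊗ P(2)) c ⊕ (P(2) ⊗ P(2)) c²` of the free symmetric operad. -/
def SymOperadData.relations : Submodule k (Fin 3 → P.obj 2 ⊗[k] P.obj 2) :=
  LinearMap.ker (∑ j : Fin 3,
    P.act (finRotate 3 ^ (j : ℕ)) ∘ₗ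
      TensorProduct.lift (P.comp (m := 2) (n := 2) (l := 3) rfl 0) ∘ₗ LinearMap.proj j)

/-- The right action of the transposition on `P(2)^∨ = P(2)^# ⊗ sgn₂`. -/
def SymOperadData.dualSwap (f : Module.Dual k (P.obj 2)) : Module.Dual k (P.obj 2) :=
  -(f ∘ₗ P.act (Equiv.swap 0 1))

variable (k) in
/-- The free operad on a set `S` of binary operations without symmetry. -/
def freeSym (S : Type u) : SymOperadData k := (freeNS k S).symmetrization

variable (k) in
def freeSymGen {S : Type u} (c : S) : (freeSym k S).obj 2 := Finsupp.single 1 (freeNSGen k c)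

/-- The relations of the quadratic dual among the generators `P(2)^∨ = P(2)^# ⊗ sgn₂`: in arity
two, the generators depend linearly and `Σ₂`-equivariantly on the elements of `P(2)^∨`; in arity
three, the annihilator of the relations of `P`. -/
inductive SymOperadData.DualRel :
    ∀ n, (freeSym k (Module.Dual k (P.obj 2))).obj n → Prop
  | add (f g : Module.Dual k (P.obj 2)) :
      DualRel 2 (freeSymGen k (f + g) - freeSymGen k f - freeSymGen k g)
  | smul (c : k) (f : Module.Dual k (P.obj 2)) :
      DualRel 2 (freeSymGen k (c • f) - c • freeSymGen k f)
  | swap (f : Module.Dual k (P.obj 2)) :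
      DualRel 2 (freeSymGen k (P.dualSwap f) -
        (freeSym k (Module.Dual k (P.obj 2))).act (Equiv.swap 0 1) (freeSymGen k f))
  | quadratic (w : Fin 3 × Module.Dual k (P.obj 2) × Module.Dual k (P.obj 2) →₀ k)
      (hw : ∀ x ∈ P.relations, (w.sum fun z c =>
        c * TensorProduct.dualDistrib k _ _ (z.2.1 ⊗ₜ z.2.2) (x z.1)) = 0) :
      DualRel 3 (w.sum fun z c =>
        c • (freeSym k (Module.Dual k (P.obj 2))).act (finRotate 3 ^ (z.1 : ℕ))
          ((freeSym k (Module.Dual k (P.obj 2))).comp (m := 2) (n := 2) (l := 3) rfl 0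
            (freeSymGen k z.2.1) (freeSymGen k z.2.2)))

/-- The defining ideal of the quadratic dual. -/
def SymOperadData.dualIdeal (n : ℕ) : Submodule k ((freeSym k (Module.Dual k (P.obj 2))).obj n) :=
  (freeSym k (Module.Dual k (P.obj 2))).ideal (fun n => {x | P.DualRel n x}) n

/-- The quadratic dual of a symmetric operad. -/
def SymOperadData.dual : SymOperadData k :=
  (freeSym k (Module.Dual k (P.obj 2))).quotient P.dualIdeal
    ((freeSym k (Module.Dual k (P.obj 2))).ideal_isIdeal _)

/-- The generators of the quadratic dual. -/
def SymOperadData.dualGen : Module.Dual k (P.obj 2) →ₗ[k] P.dual.obj 2 where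
  toFun f := Submodule.mkQ _ (freeSymGen k f)
  map_add' f g := by
    refine (Submodule.Quotient.eq _).2 ?_
    rw [← sub_sub]
    exact SymOperadData.subset_ideal _ _ _ (SymOperadData.DualRel.add f g)
  map_smul' c f := by
    exact (Submodule.Quotient.eq _).2 (SymOperadData.subset_ideal _ _ _ (SymOperadData.DualRel.smul c f))

/-- The canonical element: the image of the identity of `P(2)` in
`P(2) ⊗ P(2)^# ≅ (P ⊗ P^!)(2)`. -/
def SymOperadData.canonical [Module.Finite k (P.obj 2)] : (P.tensor P.dual).obj 2 :=
  TensorProduct.map LinearMap.id P.dualGen (coevaluation k (P.obj 2) 1)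

end SymDual

/-- For `P` the symmetrization of `Q`, the canonical inclusion `Q(2)^# → P(2)^#`: a functional is
extended by zero from `Q(2)` to `P(2) = Q(2) ⊕ Q(2) · (12)`. -/
def OperadData.dualIncl (Q : OperadData k) (f : Module.Dual k (Q.obj 2)) :
    Module.Dual k (Q.symmetrization.obj 2) :=
  f ∘ₗ Finsupp.lapply (1 : Equiv.Perm (Fin 2))

/-- For `P` the symmetrization of `Q`, the subspace `Q^!(n)` of `P^!(n)`: the image of the free
non-symmetric operad on `Q(2)^#` under the canonical map. -/
def OperadData.nsDualInSym (Q : OperadData k) (n : ℕ) :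
    Submodule k (Q.symmetrization.dual.obj n) :=
  LinearMap.range
    ((Q.symmetrization.dualIdeal n).mkQ ∘ₗ
      (Finsupp.lsingle (1 : Equiv.Perm (Fin n)) ∘ₗ freeNSMap k Q.dualIncl n :
        _ →ₗ[k] (freeSym k (Module.Dual k (Q.symmetrization.obj 2))).obj n))

/-! ### The graded Lie algebra of a non-symmetric operad

The element of arity `m` has degree `m - 1`. -/

section NSLie

variable (T : OperadData k)

/-- `f ∘ g = ∑ᵢ (-1)^{(n-1)(i-1)} f ∘ᵢ g`, the sum over `1 ≤ i ≤ m` (here `i` starts from `0`, and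
`n + 1` has the parity of `n - 1`). -/
def OperadData.circ {m n l : ℕ} (h : l + 1 = m + n) : T.obj m →ₗ[k] T.obj n →ₗ[k] T.obj l :=
  ∑ i : Fin m, (-1 : k) ^ ((n + 1) * (i : ℕ)) • T.comp h i

/-- `[f, g] = f ∘ g - (-1)^{(m-1)(n-1)} g ∘ f`. -/
def OperadData.bracket {m n l : ℕ} (h : l + 1 = m + n) : T.obj m →ₗ[k] T.obj n →ₗ[k] T.obj l :=
  T.circ h - (-1 : k) ^ ((m + 1) * (n + 1)) • (T.circ (h.trans (add_comm m n))).flip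

/-- `δ_ω(t) = [t, ω]`, from degree `m` (arity `m + 1`) to degree `m + 1`. -/
def OperadData.delta (ω : T.obj 2) (m : ℕ) : T.obj (m + 1) →ₗ[k] T.obj (m + 2) :=
  (T.bracket (m := m + 1) (n := 2) (l := m + 2) rfl).flip ω

end NSLie

/-! ### Invariants of the operadic suspension, and the operadic cochain complex -/

section SymLie

variable (T : SymOperadData k)

/-- The right action of `σ` on the operadic suspension, `T(n) ⊗ sgnₙ` up to the degree shift. -/
def SymOperadData.sAct {n : ℕ} (σ : Equiv.Perm (Fin n)) : T.obj n →ₗ[k] T.obj n :=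
  (((Equiv.Perm.sign σ : ℤˣ) : ℤ) : k) • T.act σ

/-- The space `(T(n) ⊗ sgnₙ)^{Σₙ}`. -/
def SymOperadData.sInv (n : ℕ) : Submodule k (T.obj n) :=
  ⨅ σ : Equiv.Perm (Fin n), LinearMap.eqLocus (T.sAct σ) LinearMap.id

/-- Summation over the action of `Σₙ` on the suspension. -/
def SymOperadData.sSum (n : ℕ) : T.obj n →ₗ[k] T.obj n :=
  ∑ σ : Equiv.Perm (Fin n), T.sAct σ

theorem SymOperadData.sSum_mem (n : ℕ) (x : T.obj n) : T.sSum n x ∈ T.sInv n := by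
  simp only [SymOperadData.sInv, Submodule.mem_iInf, LinearMap.mem_eqLocus, LinearMap.id_apply]
  intro τ
  simp only [SymOperadData.sSum, LinearMap.sum_apply, map_sum]
  refine Fintype.sum_equiv (Equiv.mulRight τ) _ _ fun σ => ?_
  simp only [SymOperadData.sAct, LinearMap.smul_apply, map_smul, Equiv.coe_mulRight, T.act_mul,
    smul_smul, Equiv.Perm.sign_mul, Units.val_mul, Int.cast_mul]

/-- The averaging map onto the invariants. -/
def SymOperadData.aver (n : ℕ) : T.obj n →ₗ[k] T.sInv n :=
  ((n.factorial : k)⁻¹ • T.sSum n).codRestrict (T.sInv n) fun x =>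
    (T.sInv n).smul_mem _ (T.sSum_mem n x)

/-- The pre-Lie product `f ⋆ g = ∑ (f ∘₁ g) · σ` on invariants of the suspension, the sum over the
shuffles `σ` of `n` and `m - 1` inputs. As `f ∘₁ g` is invariant under `Σₙ × Σ_{m-1}`, it is
written as a sum over the whole symmetric group divided by `n! (m - 1)!`. -/
def SymOperadData.star {m n l : ℕ} (h : l + 1 = m + n) (hm : 0 < m) :
    T.obj m →ₗ[k] T.obj n →ₗ[k] T.obj l :=
  ((n.factorial : k) * ((m - 1).factorial : k))⁻¹ • (T.comp h ⟨0, hm⟩).compr₂ (T.sSum l)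

theorem SymOperadData.star_mem {m n l : ℕ} (h : l + 1 = m + n) (hm : 0 < m) (f : T.obj m)
    (g : T.obj n) : T.star h hm f g ∈ T.sInv l :=
  (T.sInv l).smul_mem _ (T.sSum_mem l _)

/-- `[t, χ] = t ⋆ χ - (-1)^m χ ⋆ t` for `t` of degree `m` (arity `m + 1`) and `χ` of arity two. -/
def SymOperadData.symDelta (χ : T.obj 2) (m : ℕ) : T.sInv (m + 1) →ₗ[k] T.sInv (m + 2) :=
  (((T.star (m := m + 1) (n := 2) (l := m + 2) rfl (Nat.succ_pos m)).flip χ -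
    (-1 : k) ^ m • T.star (m := 2) (n := m + 1) (l := m + 2) (by omega) two_pos χ) ∘ₗ
      (T.sInv (m + 1)).subtype).codRestrict (T.sInv (m + 2)) fun t =>
    (T.sInv (m + 2)).sub_mem (T.star_mem _ _ _ _)
      ((T.sInv (m + 2)).smul_mem _ (T.star_mem _ _ _ _))

end SymLie

section Cochains

/-- The operad `End_A ⊗ P^!`. -/
def OperadAlgebra.coeffs {P : SymOperadData k} (A : OperadAlgebra P) : SymOperadData k :=
  (endOperad k A.carrier).tensor P.dual

/-- The cochains `C^m_P(A; A) = [Lin((↓A)^{⊗(m+1)}, ↓A) ⊗ P^!(m+1)]^{Σ_{m+1}}`. As `A` is in degree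
zero, the desuspension of `A` amounts to the twist of the action by the signum. -/
abbrev OperadAlgebra.cochains {P : SymOperadData k} (A : OperadAlgebra P) (m : ℕ) : Type u :=
  A.coeffs.sInv (m + 1)

/-- The image of the canonical element under `P → End_A`. -/
def OperadAlgebra.canonical {P : SymOperadData k} (A : OperadAlgebra P)
    [Module.Finite k (P.obj 2)] : A.coeffs.obj 2 :=
  TensorProduct.map (A.α 2) LinearMap.id P.canonical

/-- The differential `d_P : C^m_P(A; A) → C^{m+1}_P(A; A)`: the bracket with the structure element
of the algebra. -/
def OperadAlgebra.d {P : SymOperadData k} (A : OperadAlgebra P) [Module.Finite k (P.obj 2)]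
    (m : ℕ) : A.cochains m →ₗ[k] A.cochains (m + 1) :=
  A.coeffs.symDelta A.canonical m

end Cochains

/-! ### Natural constants -/

section Constants

variable (Q : OperadData k)

/-- Planar rooted trees whose vertices are black, of arity at least two, and decorated by `Q`;
the index is the number of input legs, which are numbered in the planar order. A tree is built
from the trivial tree by adding vertices to legs. -/
inductive BlackTree : ℕ → Type u
  | trivial : BlackTree 1
  | graft {m n l : ℕ} (t : BlackTree m) (h : l + 1 = m + n) (i : Fin m) (p : Q.obj n)
      (hn : 2 ≤ n) : BlackTree l

variable {Q}

/-- The composition along a tree in `End_A`, for an algebra `A` over the symmetrization of `Q`. -/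
def BlackTree.value (A : OperadAlgebra Q.symmetrization) :
    {a : ℕ} → BlackTree Q a → (endOperad k A.carrier).obj a
  | _, BlackTree.trivial => (endOperad k A.carrier).one
  | _, BlackTree.graft (n := n) t h i p _ =>
    (endOperad k A.carrier).comp h i (t.value A) (A.α n (Finsupp.single 1 p))

variable (Q)

/-- Families of cochains, one for each algebra over the symmetrization of `Q`. -/
abbrev ConstantFamily (m : ℕ) : Type (u + 1) :=
  ∀ A : OperadAlgebra Q.symmetrization, A.cochains m

variable {Q}

/-- The natural constant `U_{(T, Φ)}` given by a planar tree `T` without white vertices and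
`φ = Φ(1) ∈ P^!(m + 1)`: the average of `T ⊗ φ`. -/
def naturalConstant {m : ℕ} (T : BlackTree Q (m + 1)) (φ : Q.symmetrization.dual.obj (m + 1)) :
    ConstantFamily Q m :=
  fun A => A.coeffs.aver (m + 1) (T.value A ⊗ₜ[k] φ)

variable (Q)

/-- The space of order-preserving natural constants of degree `m`: the span of the natural
constants `U_{(T, Φ)}` with `T` planar, decorated by `Q`, and with `Φ(1)` in `Q^!`. -/
def orderPreservingConstants (m : ℕ) : Submodule k (ConstantFamily Q m) :=
  Submodule.span k {U | ∃ (T : BlackTree Q (m + 1)) (φ : Q.symmetrization.dual.obj (m + 1)),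
    φ ∈ Q.nsDualInSym (m + 1) ∧ U = naturalConstant T φ}

/-- The differential of natural constants induced by `d_P`. -/
def constantDelta [Module.Finite k (Q.obj 2)] (m : ℕ) :
    ConstantFamily Q m →ₗ[k] ConstantFamily Q (m + 1) :=
  LinearMap.pi fun A => A.d m ∘ₗ LinearMap.proj A

end Constants

end

/-!
Write `P` for the symmetrization of `Q`, and `Q^!`, `P^!` for the quadratic duals. The isomorphism
is the inverse of the map `planarConstant` that sends `y ∈ Q(m+1) ⊗ Q^!(m+1)` to the family of
cochains `A ↦ ∑_σ ± (α ⊗ ι)(y) · σ`, where `α` is the structure map of `A` restricted to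
`Q(m+1) · 1 ⊂ P(m+1)`, and `ι : Q^! → P^!` is induced by the extension by zero of functionals
(`OperadData.nsDualToDual`). Four facts carry the proof.

* *The differentials agree.* Summation over the symmetric groups turns the signed sum
  `f ∘ g = ∑ ± f ∘ᵢ g` into the product on the invariants of the suspension
  (`SymOperadData.star_sSum`): a permutation of the inputs of `f` that sends the first one to `i`
  contributes `f ∘ᵢ g`, with the sign of the block permutation that it induces (`sign_permComp`).
  Moreover, the canonical element of `P` is the sum over `Σ₂` of the canonical element of `Q`
  (`OperadData.canonical_symmetrization`). Hence
  `planarConstant` intertwines the two differentials (`constantDelta_planarConstant`).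

* *The target is a complex.* The canonical element satisfies `χ ∘ χ = 0`, because the relations of
  `Q^!` are the annihilator of those of `Q` up to a sign between `∘₁` and `∘₂`
  (`OperadData.nsCanonical_circ`), and the graded pre-Lie identity turns this into `δ² = 0`
  (`NSOperad.delta_delta`).

* *Injectivity.* Both steps evaluate on the generators `x₀, x₁, …` of a free algebra, modelled as a
  direct sum over words (`WordAlgebra`). As the relations of `Q` follow from those of arity at most
  three, the words form an algebra over `P` (`NSOperad.wordOperadAlgebra`), and the coefficient of
  the word `x₀ ⋯ x_m` sees only the summand of `σ = 1` (`NSOperad.genericCoeff_α`). So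
  `planarConstant` is injective as soon as `ι` is. To see the latter, `P^!` acts on the free algebra
  over `Q^!`, by the products of `Q^!` on `Q(2)^#` and minus the opposite products on the other
  summand of `P(2)^#`: a relation of `P^!` splits, for each ordering of the inputs, into relations
  of `Q^!` (`OperadData.nsDual_component_eq`). An element of `Q^!` is recovered from the action of its image
  on the generators (`OperadData.nsDualToDual_injective`).

* *Surjectivity.* The space `Q(m+1)` is spanned by composites of planar trees, the image of `ι` is
  the subspace of `P^!` allowed in the natural constants, and averaging is summation divided by
  `(m+1)!`. So the range of `planarConstant` is the space of order-preserving natural constants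
  (`NSOperad.range_planarConstant`).
-/

noncomputable section

variable {k : Type u} [Field k]

/-! ### Operads of planar binary trees -/

namespace BinTree

variable {S : Type u}

theorem leaves_pos (t : BinTree S) : 0 < t.leaves := by
  induction t with
  | leaf => exact one_pos
  | node c a b iha _ => exact Nat.add_pos_left iha _

theorem graft_leaf (t : BinTree S) (i : ℕ) : t.graft i leaf = t := by
  induction t generalizing i with
  | leaf => rfl
  | node c a b iha ihb => simp only [graft, iha, ihb, ite_self]

theorem graft_graft_seq (t s r : BinTree S) (i j : ℕ) (hi : i < t.leaves) (hj : j < s.leaves) :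
    (t.graft i s).graft (i + j) r = t.graft i (s.graft j r) := by
  induction t generalizing i with
  | leaf =>
    obtain rfl : i = 0 := by simpa [leaves] using hi
    simp [graft]
  | node c a b iha ihb =>
    by_cases h : i < a.leaves
    · have h1 := a.leaves_graft s i h
      have h2 : i + j < (a.graft i s).leaves := by omega
      simp only [graft, if_pos h, if_pos h2, iha i h]
    · have h2 : ¬ i + j < a.leaves := by omega
      have h3 : i - a.leaves < b.leaves := by simp only [leaves] at hi; omega
      have h4 : i + j - a.leaves = i - a.leaves + j := by omega
      simp only [graft, if_neg h, if_neg h2, h4, ihb _ h3]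

theorem graft_graft_par (t s r : BinTree S) (i j j' : ℕ) (hij : i < j) (hj : j < t.leaves)
    (hj' : j' + 1 = j + s.leaves) :
    (t.graft i s).graft j' r = (t.graft j r).graft i s := by
  induction t generalizing i j j' with
  | leaf => simp only [leaves] at hj; omega
  | node c a b iha ihb =>
    have hs := s.leaves_pos
    have hb : i < a.leaves ∨ i - a.leaves < j - a.leaves := by omega
    simp only [leaves] at hj
    by_cases h : i < a.leaves
    · have h1 := a.leaves_graft s i h
      by_cases h2 : j < a.leaves
      · have h3 : j' < (a.graft i s).leaves := by omega
        have h4 := a.leaves_graft r j h2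
        have hr := r.leaves_pos
        have h5 : i < (a.graft j r).leaves := by omega
        simp only [graft, if_pos h, if_pos h2, if_pos h3, if_pos h5, iha i j j' hij h2 hj']
      · have h3 : ¬ j' < (a.graft i s).leaves := by omega
        have h4 : j' - (a.graft i s).leaves = j - a.leaves := by omega
        simp only [graft, if_pos h, if_neg h2, if_neg h3, h4]
    · have h2 : ¬ j < a.leaves := by omega
      have h3 : ¬ j' < a.leaves := by omega
      simp only [graft, if_neg h, if_neg h2, if_neg h3]
      rw [ihb (i - a.leaves) (j - a.leaves) (j' - a.leaves) (by omega) (by omega) (by omega)]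

theorem map_graft {S' : Type u} (f : S → S') (t s : BinTree S) (i : ℕ) :
    (t.graft i s).map f = (t.map f).graft i (s.map f) := by
  induction t generalizing i with
  | leaf => rfl
  | node c a b iha ihb =>
    simp only [graft, map, leaves_map]
    split_ifs <;> simp [map, iha, ihb]

end BinTree

variable (k) in
/-- The basis element of the free operad given by a tree with `n` leaves. -/
def treeElt {S : Type u} (n : ℕ) (t : BinTree S) (h : t.leaves = n) : (freeNS k S).obj n :=
  Finsupp.single (⟨t, h⟩ : {t : BinTree S // t.leaves = n}) (1 : k)

theorem freeNS_comp_treeElt {S : Type u} {m n l : ℕ} (h : l + 1 = m + n) (i : Fin m)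
    (t s : BinTree S) (ht : t.leaves = m) (hs : s.leaves = n) :
    (freeNS k S).comp h i (treeElt k m t ht) (treeElt k n s hs) =
      treeElt k l (t.graft i s) (by
        have := t.leaves_graft s i (by omega)
        omega) := by
  unfold treeElt freeNS
  dsimp only
  rw [Finsupp.linearCombination_single, one_smul, Finsupp.linearCombination_single, one_smul]

theorem freeNS_induction {S : Type u} {n : ℕ} {p : (freeNS k S).obj n → Prop}
    (x : (freeNS k S).obj n) (zero : p 0) (add : ∀ x y, p x → p y → p (x + y))
    (smul : ∀ (c : k) x, p x → p (c • x)) (tree : ∀ t h, p (treeElt k n t h)) : p x := by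
  refine Finsupp.induction_linear x zero add fun t c => ?_
  have h : c • (Finsupp.single t 1 : {t : BinTree S // t.leaves = n} →₀ k) =
      Finsupp.single t c := by
    rw [Finsupp.smul_single, smul_eq_mul, mul_one]
  exact h ▸ smul c _ (tree t.1 t.2)

variable (k) in
/-- The free operad satisfies the axioms of an operad. -/
def freeNSOperad (S : Type u) : NSOperad k where
  toOperadData := freeNS k S
  one_comp {n} h q := by
    induction q using freeNS_induction with
    | zero => simp
    | add x y hx hy => simp only [map_add, hx, hy]
    | smul c x hx => simp only [map_smul, hx]
    | tree t ht => exact freeNS_comp_treeElt h 0 BinTree.leaf t rfl ht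
  comp_one {m} h i p := by
    induction p using freeNS_induction with
    | zero => simp
    | add x y hx hy => simp only [map_add, LinearMap.add_apply, hx, hy]
    | smul c x hx => simp only [map_smul, LinearMap.smul_apply, hx]
    | tree t ht =>
      refine (freeNS_comp_treeElt h i t BinTree.leaf ht rfl).trans ?_
      simp only [BinTree.graft_leaf]
  assoc_seq {m n r s t w} h₁ h₂ h₃ h₄ i j ij hij p q x := by
    induction p using freeNS_induction with
    | zero => simp
    | add x y hx hy => simp only [map_add, LinearMap.add_apply, hx, hy]
    | smul c x hx => simp only [map_smul, LinearMap.smul_apply, hx]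
    | tree a ha =>
    induction q using freeNS_induction with
    | zero => simp
    | add x y hx hy => simp only [map_add, LinearMap.add_apply, hx, hy]
    | smul c x hx => simp only [map_smul, LinearMap.smul_apply, hx]
    | tree b hb =>
    induction x using freeNS_induction with
    | zero => simp
    | add x y hx hy => simp only [map_add, hx, hy]
    | smul c x hx => simp only [map_smul, hx]
    | tree c hc =>
    simp only [freeNS_comp_treeElt, hij]
    congr 1
    exact BinTree.graft_graft_seq a b c i j (by omega) (by omega)
  assoc_par {m n r s t w} h₁ h₂ h₃ h₄ i j hij j' hj' i' hi' p q x := by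
    induction p using freeNS_induction with
    | zero => simp
    | add x y hx hy => simp only [map_add, LinearMap.add_apply, hx, hy]
    | smul c x hx => simp only [map_smul, LinearMap.smul_apply, hx]
    | tree a ha =>
    induction q using freeNS_induction with
    | zero => simp
    | add x y hx hy => simp only [map_add, LinearMap.add_apply, hx, hy]
    | smul c x hx => simp only [map_smul, LinearMap.smul_apply, hx]
    | tree b hb =>
    induction x using freeNS_induction with
    | zero => simp
    | add x y hx hy => simp only [map_add, LinearMap.add_apply, hx, hy]
    | smul c x hx => simp only [map_smul, LinearMap.smul_apply, hx]
    | tree c hc =>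
    simp only [freeNS_comp_treeElt, hi']
    congr 1
    exact BinTree.graft_graft_par a b c i j j' hij (by omega) (by omega)

/-- A quotient of an operad by an ideal is an operad. -/
def NSOperad.quotient (P : NSOperad k) (J : ∀ n, Submodule k (P.obj n))
    (hJ : P.toOperadData.IsIdeal J) : NSOperad k where
  toOperadData := P.toOperadData.quotient J hJ
  one_comp {n} h q := by
    obtain ⟨q, rfl⟩ := (J n).mkQ_surjective q
    exact congrArg (J n).mkQ (P.one_comp h q)
  comp_one {m} h i p := by
    obtain ⟨p, rfl⟩ := (J m).mkQ_surjective p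
    exact congrArg (J m).mkQ (P.comp_one h i p)
  assoc_seq {m n r s t w} h₁ h₂ h₃ h₄ i j ij hij p q x := by
    obtain ⟨p, rfl⟩ := (J m).mkQ_surjective p
    obtain ⟨q, rfl⟩ := (J n).mkQ_surjective q
    obtain ⟨x, rfl⟩ := (J r).mkQ_surjective x
    exact congrArg (J w).mkQ (P.assoc_seq h₁ h₂ h₃ h₄ i j ij hij p q x)
  assoc_par {m n r s t w} h₁ h₂ h₃ h₄ i j hij j' hj' i' hi' p q x := by
    obtain ⟨p, rfl⟩ := (J m).mkQ_surjective p
    obtain ⟨q, rfl⟩ := (J n).mkQ_surjective q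
    obtain ⟨x, rfl⟩ := (J r).mkQ_surjective x
    exact congrArg (J w).mkQ (P.assoc_par h₁ h₂ h₃ h₄ i j hij j' hj' i' hi' p q x)

/-- The quadratic dual of a non-symmetric operad is an operad. -/
def OperadData.nsDualOperad (Q : OperadData k) : NSOperad k :=
  (freeNSOperad k (Module.Dual k (Q.obj 2))).quotient _
    ((freeNS k (Module.Dual k (Q.obj 2))).ideal_isIdeal fun n => {x | Q.NSDualRel n x})

/-- The pure tensor of two operations, as an operation of the tensor product of operads. -/
def OperadData.tmul (P Q : OperadData k) (n : ℕ) :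
    P.obj n →ₗ[k] Q.obj n →ₗ[k] (P.tensor Q).obj n :=
  TensorProduct.mk k (P.obj n) (Q.obj n)

theorem OperadData.tensor_comp_tmul (P Q : OperadData k) {m n l : ℕ} (h : l + 1 = m + n)
    (i : Fin m) (p : P.obj m) (q : Q.obj m) (p' : P.obj n) (q' : Q.obj n) :
    (P.tensor Q).comp h i (P.tmul Q m p q) (P.tmul Q n p' q') =
      P.tmul Q l (P.comp h i p p') (Q.comp h i q q') := rfl

theorem OperadData.tensor_induction {P Q : OperadData k} {n : ℕ} {p : (P.tensor Q).obj n → Prop}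
    (x : (P.tensor Q).obj n) (zero : p 0) (add : ∀ x y, p x → p y → p (x + y))
    (tmul : ∀ a b, p (P.tmul Q n a b)) : p x :=
  TensorProduct.induction_on x zero tmul add

/-- The arity-wise tensor product of operads is an operad. -/
def NSOperad.tensor (P Q : NSOperad k) : NSOperad k where
  toOperadData := P.toOperadData.tensor Q.toOperadData
  one_comp {n} h q := by
    induction q using OperadData.tensor_induction with
    | zero => simp
    | add x y hx hy => simp only [map_add, hx, hy]
    | tmul a b =>
      exact congrArg₂ (fun x y => P.tmul Q.toOperadData _ x y) (P.one_comp h a) (Q.one_comp h b)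
  comp_one {m} h i p := by
    induction p using OperadData.tensor_induction with
    | zero => simp
    | add x y hx hy => simp only [map_add, LinearMap.add_apply, hx, hy]
    | tmul a b =>
      exact congrArg₂ (fun x y => P.tmul Q.toOperadData _ x y) (P.comp_one h i a)
        (Q.comp_one h i b)
  assoc_seq {m n r s t w} h₁ h₂ h₃ h₄ i j ij hij p q x := by
    induction p using OperadData.tensor_induction with
    | zero => simp
    | add x y hx hy => simp only [map_add, LinearMap.add_apply, hx, hy]
    | tmul a a' =>
    induction q using OperadData.tensor_induction with
    | zero => simp
    | add x y hx hy => simp only [map_add, LinearMap.add_apply, hx, hy]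
    | tmul b b' =>
    induction x using OperadData.tensor_induction with
    | zero => simp
    | add x y hx hy => simp only [map_add, hx, hy]
    | tmul c c' =>
    exact congrArg₂ (fun x y => P.tmul Q.toOperadData _ x y)
      (P.assoc_seq h₁ h₂ h₃ h₄ i j ij hij a b c)
      (Q.assoc_seq h₁ h₂ h₃ h₄ i j ij hij a' b' c')
  assoc_par {m n r s t w} h₁ h₂ h₃ h₄ i j hij j' hj' i' hi' p q x := by
    induction p using OperadData.tensor_induction with
    | zero => simp
    | add x y hx hy => simp only [map_add, LinearMap.add_apply, hx, hy]
    | tmul a a' =>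
    induction q using OperadData.tensor_induction with
    | zero => simp
    | add x y hx hy => simp only [map_add, LinearMap.add_apply, hx, hy]
    | tmul b b' =>
    induction x using OperadData.tensor_induction with
    | zero => simp
    | add x y hx hy => simp only [map_add, LinearMap.add_apply, hx, hy]
    | tmul c c' =>
    exact congrArg₂ (fun x y => P.tmul Q.toOperadData _ x y)
      (P.assoc_par h₁ h₂ h₃ h₄ i j hij j' hj' i' hi' a b c)
      (Q.assoc_par h₁ h₂ h₃ h₄ i j hij j' hj' i' hi' a' b' c')

/-! ### Evaluation of trees in an operad -/

/-- The composite `P.evalTree t`, as an element of arity `n = t.leaves`. -/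
def OperadData.evalAt (P : OperadData k) (t : BinTree (P.obj 2)) (n : ℕ) (h : t.leaves = n) :
    P.obj n :=
  h ▸ P.evalTree t

theorem OperadData.eval_treeElt (P : OperadData k) (n : ℕ) (t : BinTree (P.obj 2))
    (h : t.leaves = n) : P.eval n (treeElt k n t h) = P.evalAt t n h := by
  unfold OperadData.eval treeElt
  exact (Finsupp.linearCombination_single k 1 _).trans (one_smul k _)

theorem OperadData.evalAt_leaf (P : OperadData k) (h : BinTree.leaf.leaves = 1) :
    P.evalAt BinTree.leaf 1 h = P.one := rfl

theorem OperadData.evalAt_node (P : OperadData k) (c : P.obj 2) (a b : BinTree (P.obj 2))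
    {na nb r l : ℕ} (ha : a.leaves = na) (hb : b.leaves = nb) (h₁ : r + 1 = 2 + nb)
    (h₂ : l + 1 = r + na) (h : (BinTree.node c a b).leaves = l) (i : Fin r) (hi : (i : ℕ) = 0) :
    P.evalAt (BinTree.node c a b) l h =
      P.comp h₂ i (P.comp h₁ 1 c (P.evalAt b nb hb)) (P.evalAt a na ha) := by
  subst ha hb h
  obtain rfl : r = 1 + b.leaves := by omega
  have hi' : i = ⟨0, by omega⟩ := Fin.ext hi
  rw [hi']
  rfl

/-- Grafting of trees evaluates to partial composition. -/
theorem NSOperad.evalAt_graft (P : NSOperad k) (t s : BinTree (P.obj 2)) {m n l : ℕ}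
    (ht : t.leaves = m) (hs : s.leaves = n) (h : l + 1 = m + n) (i : Fin m)
    (h' : (t.graft i s).leaves = l) :
    P.evalAt (t.graft i s) l h' = P.comp h i (P.evalAt t m ht) (P.evalAt s n hs) := by
  induction t generalizing m l with
  | leaf =>
    obtain rfl : m = 1 := ht.symm
    obtain rfl : l = n := by omega
    obtain rfl : i = 0 := Subsingleton.elim _ _
    exact (P.one_comp h _).symm
  | node c a b iha ihb =>
    have hm : a.leaves + b.leaves = m := ht
    have hb := b.leaves_pos
    have ha := a.leaves_pos
    have hi := i.2
    have hsp := s.leaves_pos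
    rw [P.evalAt_node c a b rfl rfl (r := 1 + b.leaves) (by omega) (by omega) ht ⟨0, by omega⟩ rfl]
    by_cases hia : (i : ℕ) < a.leaves
    · have hg : (a.graft i s).leaves = a.leaves + n - 1 := by
        have := a.leaves_graft s i hia
        omega
      have h0 : ((BinTree.node c a b).graft i s) = BinTree.node c (a.graft i s) b := by
        simp only [BinTree.graft, if_pos hia]
      revert h'
      rw [h0]
      intro h'
      rw [P.evalAt_node c _ b (na := a.leaves + n - 1) (by omega) rfl (r := 1 + b.leaves) (by omega)
        (by omega) h' ⟨0, by omega⟩ rfl, iha rfl (by omega) ⟨i, hia⟩]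
      exact (P.assoc_seq _ _ _ _ ⟨0, by omega⟩ ⟨i, hia⟩ i (by simp) _ _ _).symm
    · have hib : (i : ℕ) - a.leaves < b.leaves := by omega
      have hg : (b.graft (i - a.leaves) s).leaves = b.leaves + n - 1 := by
        have := b.leaves_graft s _ hib
        omega
      have h0 : ((BinTree.node c a b).graft i s) = BinTree.node c a (b.graft (i - a.leaves) s) := by
        simp only [BinTree.graft, if_neg hia]
      revert h'
      rw [h0]
      intro h'
      rw [P.evalAt_node c a _ (nb := b.leaves + n - 1) rfl hg (r := b.leaves + n)
        (by omega) (by omega) h' ⟨0, by omega⟩ rfl, ihb rfl (by omega) ⟨i - a.leaves, hib⟩,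
        ← P.assoc_seq (m := 2) (n := b.leaves) (r := n) (s := 1 + b.leaves)
          (t := b.leaves + n - 1) (w := b.leaves + n) (by omega) (by omega) (by omega) (by omega) 1
          ⟨i - a.leaves, hib⟩ ⟨1 + (i - a.leaves), by omega⟩ (by simp)]
      exact (P.assoc_par (m := 1 + b.leaves) (n := a.leaves) (r := n) (s := m) (t := b.leaves + n)
        (w := l) _ _ _ _ ⟨0, by omega⟩ ⟨1 + (i - a.leaves), by omega⟩ (by simp [Fin.lt_def]) i
        (by simp only []; omega) ⟨0, by omega⟩ rfl _ _ _).symm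

/-- The canonical map from the free operad is compatible with partial compositions. -/
theorem NSOperad.eval_comp (P : NSOperad k) {m n l : ℕ} (h : l + 1 = m + n) (i : Fin m)
    (x : (freeNS k (P.obj 2)).obj m) (y : (freeNS k (P.obj 2)).obj n) :
    P.eval l ((freeNS k (P.obj 2)).comp h i x y) = P.comp h i (P.eval m x) (P.eval n y) := by
  induction x using freeNS_induction with
  | zero => simp
  | add x y hx hy => simp only [map_add, LinearMap.add_apply, hx, hy]
  | smul c x hx => simp only [map_smul, LinearMap.smul_apply, hx]
  | tree a ha =>
  induction y using freeNS_induction with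
  | zero => simp
  | add x y hx hy => simp only [map_add, hx, hy]
  | smul c x hx => simp only [map_smul, hx]
  | tree b hb =>
  rw [freeNS_comp_treeElt, OperadData.eval_treeElt, OperadData.eval_treeElt,
    OperadData.eval_treeElt, P.evalAt_graft a b ha hb h i]

/-- The class of a tree in the quadratic dual is the composite of the classes of its vertices. -/
theorem OperadData.nsDual_evalAt_map (Q : OperadData k)
    (t : BinTree (Module.Dual k (Q.obj 2))) {n : ℕ} (h : t.leaves = n)
    (h' : (t.map Q.nsDualGen).leaves = n) :
    Q.nsDual.evalAt (t.map Q.nsDualGen) n h' = Submodule.mkQ _ (treeElt k n t h) := by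
  induction t generalizing n with
  | leaf => obtain rfl := h; rfl
  | node c a b iha ihb =>
    have hn : a.leaves + b.leaves = n := h
    have hb := b.leaves_pos
    refine (Q.nsDual.evalAt_node (Q.nsDualGen c) (a.map Q.nsDualGen) (b.map Q.nsDualGen)
      (a.leaves_map _) (b.leaves_map _) (r := 1 + b.leaves) (by omega) (by omega) h'
      ⟨0, by omega⟩ rfl).trans ?_
    rw [iha rfl, ihb rfl]
    refine congrArg (Submodule.mkQ _) (?_ : (freeNS k _).comp _ _
      ((freeNS k _).comp _ _ (treeElt k 2 (BinTree.node c BinTree.leaf BinTree.leaf) rfl) _) _ = _)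
    exact (congrArg (fun z => (freeNS k _).comp _ _ z _)
      (freeNS_comp_treeElt _ _ _ _ _ _)).trans (freeNS_comp_treeElt _ _ _ _ _ _)

/-! ### Block permutations and their signs -/

theorem permComp_inl {m n l : ℕ} (h : l + 1 = m + n) (i : Fin m) (σ : Equiv.Perm (Fin m))
    (τ : Equiv.Perm (Fin n)) (x : {x : Fin m // x ≠ i}) {j y : Fin m} (hj : σ i = j)
    (hy : σ x = y) :
    permComp h i σ τ (inputEquiv h i (Sum.inl x)) =
      inputEquiv h j (Sum.inl ⟨y, fun e => x.2 (σ.injective (hy.trans (e.trans hj.symm)))⟩) := by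
  subst hj hy
  simp [permComp]

theorem permComp_inr {m n l : ℕ} (h : l + 1 = m + n) (i : Fin m) (σ : Equiv.Perm (Fin m))
    (τ : Equiv.Perm (Fin n)) (y : Fin n) {j : Fin m} (hj : σ i = j) :
    permComp h i σ τ (inputEquiv h i (Sum.inr y)) = inputEquiv h j (Sum.inr (τ y)) := by
  subst hj
  simp [permComp]

/-- Functions on the inputs of a partial composite agree if they agree on the inputs of
each factor. -/
theorem perm_ext_inputEquiv {m n l : ℕ} (h : l + 1 = m + n) (i : Fin m) {α : Sort*}
    {f g : Fin l → α} (hl : ∀ x, f (inputEquiv h i (Sum.inl x)) = g (inputEquiv h i (Sum.inl x)))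
    (hr : ∀ y, f (inputEquiv h i (Sum.inr y)) = g (inputEquiv h i (Sum.inr y))) : f = g := by
  funext z
  obtain ⟨w, rfl⟩ := (inputEquiv h i).surjective z
  rcases w with x | y
  exacts [hl x, hr y]

theorem permComp_mul {m n l : ℕ} (h : l + 1 = m + n) (i : Fin m) (σ σ' : Equiv.Perm (Fin m))
    (τ τ' : Equiv.Perm (Fin n)) :
    permComp h i (σ * σ') (τ * τ') = permComp h (σ' i) σ τ * permComp h i σ' τ' := by
  refine DFunLike.coe_injective (perm_ext_inputEquiv h i (fun x => ?_) fun y => ?_)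
  · refine (permComp_inl h i _ _ x (j := σ (σ' i)) (y := σ (σ' x)) rfl rfl).trans (Eq.symm ?_)
    rw [Equiv.Perm.mul_apply, permComp_inl h i _ _ x rfl rfl]
    exact permComp_inl h (σ' i) _ _ _ rfl rfl
  · refine (permComp_inr h i _ _ y (j := σ (σ' i)) rfl).trans (Eq.symm ?_)
    rw [Equiv.Perm.mul_apply, permComp_inr h i _ _ y rfl]
    exact permComp_inr h (σ' i) _ _ _ rfl

theorem permComp_one {m n l : ℕ} (h : l + 1 = m + n) (i : Fin m) :
    permComp h i 1 1 = 1 := by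
  refine DFunLike.coe_injective (perm_ext_inputEquiv h i (fun x => ?_) fun y => ?_)
  · exact permComp_inl h i _ _ x rfl rfl
  · exact permComp_inr h i _ _ y rfl

theorem sign_permComp_of_fixed {m n l : ℕ} (h : l + 1 = m + n) (i : Fin m)
    (σ : Equiv.Perm (Fin m)) (τ : Equiv.Perm (Fin n)) (hσ : σ i = i) :
    Equiv.Perm.sign (permComp h i σ τ) = Equiv.Perm.sign σ * Equiv.Perm.sign τ := by
  have hs : ∀ x : Fin m, σ x ≠ i ↔ x ≠ i := fun x => by
    conv_lhs => rw [← hσ]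
    exact σ.injective.ne_iff
  have h1 : permComp h i σ τ = ((inputEquiv h i).symm.trans
      (Equiv.sumCongr (σ.subtypePerm hs) τ)).trans (inputEquiv h i) := by
    refine DFunLike.coe_injective (perm_ext_inputEquiv h i (fun x => ?_) fun y => ?_)
    · rw [permComp_inl h i _ _ x hσ rfl]
      simp
    · rw [permComp_inr h i _ _ y hσ]
      simp
  rw [h1, Equiv.Perm.sign_symm_trans_trans]
  refine (Equiv.Perm.sign_sumCongr _ _).trans ?_
  rw [Equiv.Perm.sign_subtypePerm]
  intro x hx e
  exact hx (e ▸ hσ)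

/-- The `t`-th power of the cycle of `0, …, e` is the shift by `t` modulo `e + 1`. -/
theorem cycleRange_pow_val {l : ℕ} (e : Fin l) (t : ℕ) (ht : t ≤ e + 1) (z : Fin l) :
    (((Fin.cycleRange e ^ t) z : Fin l) : ℕ) =
      if (z : ℕ) ≤ e then (if z + t ≤ e then z + t else z + t - (e + 1)) else z := by
  have : NeZero l := ⟨by have := e.2; omega⟩
  induction t with
  | zero =>
    have : (z : ℕ) = if (z : ℕ) ≤ e then (if (z : ℕ) + 0 ≤ e then (z : ℕ) + 0
        else z + 0 - (e + 1)) else z := by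
      split_ifs <;> omega
    simpa using this
  | succ t ih =>
    rw [pow_succ', Equiv.Perm.mul_apply]
    set y := (Fin.cycleRange e ^ t) z
    have hy := ih (by omega)
    rcases lt_trichotomy y e with hlt | heq | hgt
    · rw [Fin.coe_cycleRange_of_lt hlt, hy]
      rw [Fin.lt_def, hy] at hlt
      split_ifs at hlt ⊢ <;> omega
    · rw [Fin.cycleRange_of_eq heq]
      have : (y : ℕ) = e := by rw [heq]
      rw [hy] at this
      simp only [Fin.val_zero]
      split_ifs at this ⊢ <;> omega
    · rw [Fin.cycleRange_of_gt hgt, hy]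
      rw [Fin.lt_def, hy] at hgt
      split_ifs at hgt ⊢ <;> omega

theorem inputEquiv_inr_val {m n l : ℕ} (h : l + 1 = m + n) (i : Fin m) (y : Fin n) :
    (inputEquiv h i (Sum.inr y) : ℕ) = i + y := rfl

theorem inputEquiv_inl_val {m n l : ℕ} (h : l + 1 = m + n) (i : Fin m) (x : {x : Fin m // x ≠ i}) :
    (inputEquiv h i (Sum.inl x) : ℕ) = if (x.1 : ℕ) < i then (x.1 : ℕ) else x.1 + n - 1 := by
  simp only [inputEquiv, Equiv.ofBijective_apply, inputFun]
  split_ifs <;> rfl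

/-- Moving a block of `n` inputs past `j` inputs has the sign of the `j`-th power of a cycle of
length `n + j`. -/
theorem sign_permComp_cycleRange {m n l : ℕ} (h : l + 1 = m + n) (i j : Fin m)
    (hi : (i : ℕ) = 0) :
    Equiv.Perm.sign (permComp h i (Fin.cycleRange j).symm 1) = (-1) ^ (n * (j : ℕ)) := by
  have : NeZero m := ⟨by have := j.2; omega⟩
  obtain rfl : i = 0 := Fin.ext hi
  have hj := j.2
  by_cases hz : n + (j : ℕ) = 0
  · obtain rfl : n = 0 := by omega
    obtain rfl : j = 0 := Fin.ext (by simp; omega)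
    simp [permComp_one, ← Equiv.Perm.inv_def]
  · have hc : permComp h 0 (Fin.cycleRange j).symm 1 =
        Fin.cycleRange (⟨n + j - 1, by omega⟩ : Fin l) ^ (j : ℕ) := by
      have h0 : (Fin.cycleRange j).symm 0 = j := by
        rw [Equiv.symm_apply_eq, Fin.cycleRange_self]
      refine DFunLike.coe_injective (perm_ext_inputEquiv h 0 (fun x => ?_) fun y => ?_)
      · rw [permComp_inl h 0 _ _ x h0 rfl]
        apply Fin.ext
        rw [cycleRange_pow_val _ _ (by simp only []; omega), inputEquiv_inl_val,
          inputEquiv_inl_val]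
        simp only []
        obtain ⟨x, hx⟩ := x
        have hx0 : (x : ℕ) ≠ 0 := fun e => hx (Fin.ext e)
        obtain ⟨y, rfl⟩ := (Fin.cycleRange j).surjective x
        rw [Equiv.symm_apply_apply]
        simp only [Fin.val_zero, not_lt_zero, if_false]
        rcases lt_trichotomy y j with hlt | heq | hgt
        · rw [Fin.coe_cycleRange_of_lt hlt]
          rw [Fin.lt_def] at hlt
          rw [if_pos hlt]
          split_ifs <;> omega
        · exact absurd (Fin.cycleRange_of_eq heq) hx
        · rw [Fin.cycleRange_of_gt hgt] at hx0 ⊢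
          rw [Fin.lt_def] at hgt
          split_ifs <;> omega
      · rw [permComp_inr h 0 _ _ y h0]
        apply Fin.ext
        rw [cycleRange_pow_val _ _ (by simp only []; omega), inputEquiv_inr_val,
          inputEquiv_inr_val]
        have := y.2
        simp only [Fin.val_zero, Equiv.Perm.one_apply, zero_add]
        rw [if_pos (by omega), if_pos (by omega), add_comm]
    rw [hc, map_pow, Fin.sign_cycleRange, ← pow_mul]
    obtain ⟨j, hj⟩ := j
    simp only [] at hz ⊢
    have : (n + j - 1) * j + j = n * j + j * j := by
      obtain ⟨e, he⟩ : ∃ e, n + j = e + 1 := ⟨n + j - 1, by omega⟩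
      rw [he, Nat.add_sub_cancel, ← Nat.succ_mul, ← add_mul, he]
    rcases Nat.even_or_odd j with hev | hod
    · rw [Even.neg_one_pow (hev.mul_left _), Even.neg_one_pow (hev.mul_left _)]
    · have h2 : ((-1 : ℤˣ)) ^ ((n + j - 1) * j + j) = (-1) ^ (n * j + j * j) := by rw [this]
      rw [pow_add, pow_add, hod.neg_one_pow, (hod.mul hod).neg_one_pow] at h2
      exact mul_right_cancel h2

/-- The sign of a block permutation. As `σ` is a permutation that fixes `σ i`, after the inverse of
a cycle, it suffices to treat these two cases. -/
theorem sign_permComp {m n l : ℕ} (h : l + 1 = m + n) (i : Fin m) (hi : (i : ℕ) = 0)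
    (σ : Equiv.Perm (Fin m)) (τ : Equiv.Perm (Fin n)) :
    Equiv.Perm.sign (permComp h i σ τ) =
      Equiv.Perm.sign σ * Equiv.Perm.sign τ * (-1) ^ ((n + 1) * (σ i : ℕ)) := by
  have : NeZero m := ⟨by have := i.2; omega⟩
  have hi0 : i = 0 := Fin.ext hi
  have h0 : (Fin.cycleRange (σ i)).symm i = σ i := by
    rw [Equiv.symm_apply_eq, Fin.cycleRange_self, hi0]
  have h1 : permComp h i σ τ = permComp h (σ i) (σ * Fin.cycleRange (σ i)) τ *
      permComp h i (Fin.cycleRange (σ i)).symm 1 := by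
    have h2 := permComp_mul h i (σ * Fin.cycleRange (σ i)) (Fin.cycleRange (σ i)).symm τ 1
    rw [h0] at h2
    rw [← h2, mul_one, mul_assoc, ← Equiv.Perm.inv_def, mul_inv_cancel, mul_one]
  rw [h1, Equiv.Perm.sign_mul, sign_permComp_cycleRange h i _ hi, sign_permComp_of_fixed,
    Equiv.Perm.sign_mul, Fin.sign_cycleRange, add_mul, pow_add, one_mul]
  · ac_rfl
  · rw [Equiv.Perm.mul_apply, Fin.cycleRange_self, ← hi0]

/-! ### Symmetric operads: equivariance and summation over the symmetric group -/

/-- The equivariance axiom of the partial compositions of a symmetric operad. -/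
def SymOperadData.IsEquivariant (T : SymOperadData k) : Prop :=
  ∀ {m n l : ℕ} (h : l + 1 = m + n) (i : Fin m) (σ : Equiv.Perm (Fin m)) (τ : Equiv.Perm (Fin n))
    (p : T.obj m) (q : T.obj n),
    T.comp h i (T.act σ p) (T.act τ q) = T.act (permComp h i σ τ) (T.comp h (σ i) p q)

theorem SymOperadData.sSum_sAct (T : SymOperadData k) {n : ℕ} (σ : Equiv.Perm (Fin n))
    (x : T.obj n) : T.sSum n (T.sAct σ x) = T.sSum n x := by
  simp only [SymOperadData.sSum, LinearMap.sum_apply]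
  refine Fintype.sum_equiv (Equiv.mulLeft σ) _ _ fun τ => ?_
  simp only [SymOperadData.sAct, LinearMap.smul_apply, map_smul, Equiv.coe_mulLeft, T.act_mul,
    smul_smul, Equiv.Perm.sign_mul, Units.val_mul, Int.cast_mul]

theorem card_perm_apply_eq {m : ℕ} (i j : Fin m) :
    (Finset.univ.filter fun σ : Equiv.Perm (Fin m) => σ i = j).card = (m - 1).factorial := by
  have h1 : ∀ j', (Finset.univ.filter fun σ : Equiv.Perm (Fin m) => σ i = j').card =
      (Finset.univ.filter fun σ : Equiv.Perm (Fin m) => σ i = j).card := fun j' => by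
    refine Finset.card_equiv (Equiv.mulLeft (Equiv.swap j' j)) fun σ => ?_
    simp only [Finset.mem_filter, Finset.mem_univ, true_and, Equiv.coe_mulLeft,
      Equiv.Perm.mul_apply]
    rw [Equiv.swap_apply_eq_iff, Equiv.swap_apply_right]
  have h2 := Finset.card_eq_sum_card_fiberwise (f := fun σ : Equiv.Perm (Fin m) => σ i)
    (s := Finset.univ) (t := Finset.univ) (fun _ _ => Finset.mem_coe.2 (Finset.mem_univ _))
  rw [Finset.sum_congr rfl fun j' _ => h1 j', Finset.sum_const, Finset.card_univ, Finset.card_univ,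
    Fintype.card_perm, Fintype.card_fin, smul_eq_mul] at h2
  have hm : 0 < m := i.pos
  rw [← Nat.mul_factorial_pred hm.ne'] at h2
  exact (Nat.eq_of_mul_eq_mul_left hm h2).symm

/-- Summation over the symmetric groups turns the signed sum of partial compositions into the
product on invariants: the permutations of the inputs of the two factors account for the
factorials, and the sign of a block permutation for the signs. -/
theorem SymOperadData.star_sSum [CharZero k] (T : SymOperadData k) (hT : T.IsEquivariant)
    {m n l : ℕ} (h : l + 1 = m + n) (hm : 0 < m) (x : T.obj m) (y : T.obj n) :
    T.star h hm (T.sSum m x) (T.sSum n y) = T.sSum l (T.circ h x y) := by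
  have key : ∀ (σ : Equiv.Perm (Fin m)) (τ : Equiv.Perm (Fin n)),
      T.sSum l (T.comp h ⟨0, hm⟩ (T.sAct σ x) (T.sAct τ y)) =
        (-1 : k) ^ ((n + 1) * (σ ⟨0, hm⟩ : ℕ)) • T.sSum l (T.comp h (σ ⟨0, hm⟩) x y) := by
    intro σ τ
    rw [← T.sSum_sAct (permComp h ⟨0, hm⟩ σ τ) (T.comp h (σ ⟨0, hm⟩) x y)]
    simp only [SymOperadData.sAct, LinearMap.smul_apply, map_smul, smul_smul]
    rw [hT h ⟨0, hm⟩ σ τ x y]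
    congr 1
    rw [sign_permComp h ⟨0, hm⟩ rfl]
    simp only [Units.val_mul, Int.cast_mul, Units.val_pow_eq_pow_val, Units.val_neg, Units.val_one,
      Int.cast_pow, Int.cast_neg, Int.cast_one]
    have hs : ((-1 : k) ^ ((n + 1) * (σ ⟨0, hm⟩ : ℕ))) *
        (-1) ^ ((n + 1) * (σ ⟨0, hm⟩ : ℕ)) = 1 := by
      rw [← mul_pow]; simp
    linear_combination (-(((Equiv.Perm.sign τ : ℤˣ) : ℤ) : k) *
      (((Equiv.Perm.sign σ : ℤˣ) : ℤ) : k)) * hs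
  have h1 : T.sSum l (T.comp h ⟨0, hm⟩ (T.sSum m x) (T.sSum n y)) =
      ((n.factorial : k) * ((m - 1).factorial : k)) • T.sSum l (T.circ h x y) := by
    conv_lhs => rw [SymOperadData.sSum.eq_1 T m, SymOperadData.sSum.eq_1 T n]
    simp only [LinearMap.sum_apply, map_sum, key, OperadData.circ, LinearMap.smul_apply, map_smul]
    rw [Finset.sum_const, Finset.card_univ, Fintype.card_perm, Fintype.card_fin,
      ← Nat.cast_smul_eq_nsmul k, mul_smul]
    congr 1
    -- for each `j` there are `(m - 1)!` permutations that send the first input to `j`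
    rw [← Finset.sum_fiberwise Finset.univ (fun σ : Equiv.Perm (Fin m) => σ ⟨0, hm⟩),
      Finset.smul_sum]
    refine Finset.sum_congr rfl fun j _ => ?_
    rw [Finset.sum_congr rfl (g := fun _ => (-1 : k) ^ ((n + 1) * (j : ℕ)) •
      T.sSum l (T.comp h j x y)), Finset.sum_const, card_perm_apply_eq, ← Nat.cast_smul_eq_nsmul k]
    intro σ hσ
    rw [(Finset.mem_filter.1 hσ).2]
  have h2 : ((n.factorial : k) * ((m - 1).factorial : k)) ≠ 0 :=
    mul_ne_zero (Nat.cast_ne_zero.2 (Nat.factorial_ne_zero _))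
      (Nat.cast_ne_zero.2 (Nat.factorial_ne_zero _))
  rw [SymOperadData.star, LinearMap.smul_apply, LinearMap.smul_apply, LinearMap.compr₂_apply, h1,
    smul_smul, inv_mul_cancel₀ h2, one_smul]

theorem OperadData.symmetrization_comp_single (P : OperadData k) {m n l : ℕ} (h : l + 1 = m + n)
    (i : Fin m) (σ : Equiv.Perm (Fin m)) (τ : Equiv.Perm (Fin n)) (p : P.obj m) (q : P.obj n) :
    P.symmetrization.comp h i (Finsupp.single σ p) (Finsupp.single τ q) =
      Finsupp.single (permComp h i σ τ) (P.comp h (σ i) p q) := by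
  unfold OperadData.symmetrization
  dsimp only
  rw [Finsupp.lsum_single, LinearMap.flip_apply, Finsupp.lsum_single]
  rfl

theorem OperadData.symmetrization_act_single (P : OperadData k) {n : ℕ}
    (σ τ : Equiv.Perm (Fin n)) (p : P.obj n) :
    P.symmetrization.act τ (Finsupp.single σ p) = Finsupp.single (σ * τ) p :=
  Finsupp.mapDomain_single

theorem OperadData.symmetrization_induction (P : OperadData k) {n : ℕ}
    {p : P.symmetrization.obj n → Prop} (x : P.symmetrization.obj n) (zero : p 0)
    (add : ∀ x y, p x → p y → p (x + y)) (single : ∀ σ a, p (Finsupp.single σ a)) : p x :=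
  Finsupp.induction_linear x zero add single

theorem OperadData.symmetrization_isEquivariant (P : OperadData k) :
    P.symmetrization.IsEquivariant := by
  intro m n l h i σ τ p q
  induction p using OperadData.symmetrization_induction with
  | zero => simp
  | add x y hx hy => simp only [map_add, LinearMap.add_apply, hx, hy]
  | single ρ a =>
  induction q using OperadData.symmetrization_induction with
  | zero => simp
  | add x y hx hy => simp only [map_add, hx, hy]
  | single π b =>
  rw [P.symmetrization_act_single, P.symmetrization_act_single, P.symmetrization_comp_single,
    P.symmetrization_comp_single, P.symmetrization_act_single, permComp_mul]
  rfl

theorem SymOperadData.IsEquivariant.quotient {P : SymOperadData k} (hP : P.IsEquivariant)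
    (J : ∀ n, Submodule k (P.obj n)) (hJ : P.IsIdeal J) : (P.quotient J hJ).IsEquivariant := by
  intro m n l h i σ τ p q
  obtain ⟨p, rfl⟩ := (J m).mkQ_surjective p
  obtain ⟨q, rfl⟩ := (J n).mkQ_surjective q
  exact congrArg (J l).mkQ (hP h i σ τ p q)

/-- The pure tensor of two operations, as an operation of the tensor product of operads. -/
def SymOperadData.tmul (P Q : SymOperadData k) (n : ℕ) :
    P.obj n →ₗ[k] Q.obj n →ₗ[k] (P.tensor Q).obj n :=
  TensorProduct.mk k (P.obj n) (Q.obj n)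

theorem SymOperadData.tensor_induction {P Q : SymOperadData k} {n : ℕ}
    {p : (P.tensor Q).obj n → Prop} (x : (P.tensor Q).obj n) (zero : p 0)
    (add : ∀ x y, p x → p y → p (x + y)) (tmul : ∀ a b, p (P.tmul Q n a b)) : p x :=
  TensorProduct.induction_on x zero tmul add

theorem SymOperadData.IsEquivariant.tensor {P Q : SymOperadData k} (hP : P.IsEquivariant)
    (hQ : Q.IsEquivariant) : (P.tensor Q).IsEquivariant := by
  intro m n l h i σ τ p q
  induction p using SymOperadData.tensor_induction with
  | zero => simp
  | add x y hx hy => simp only [map_add, LinearMap.add_apply, hx, hy]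
  | tmul a a' =>
  induction q using SymOperadData.tensor_induction with
  | zero => simp
  | add x y hx hy => simp only [map_add, hx, hy]
  | tmul b b' =>
  exact congrArg₂ (fun x y => P.tmul Q _ x y) (hP h i σ τ a b) (hQ h i σ τ a' b')

/-- The value of an operation of the endomorphism operad on given arguments. -/
def endApply {A : Type u} [AddCommGroup A] [Module k A] {n : ℕ} (a : Fin n → A) :
    (endOperad k A).obj n →ₗ[k] A where
  toFun f := MultilinearMap.toFun f a
  map_add' _ _ := rfl
  map_smul' _ _ := rfl

section Endo

variable {A : Type u} [AddCommGroup A] [Module k A]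

theorem endOperad_ext {n : ℕ} {f g : (endOperad k A).obj n}
    (h : ∀ a, endApply a f = endApply a g) : f = g :=
  MultilinearMap.ext h

theorem endApply_comp {m n l : ℕ} (h : l + 1 = m + n) (i : Fin m) (f : (endOperad k A).obj m)
    (g : (endOperad k A).obj n) (a : Fin l → A) :
    endApply a ((endOperad k A).comp h i f g) = endApply (endArgs A h i g a) f := rfl

theorem endApply_act {n : ℕ} (σ : Equiv.Perm (Fin n)) (f : (endOperad k A).obj n)
    (a : Fin n → A) : endApply a ((endOperad k A).act σ f) = endApply (fun x => a (σ⁻¹ x)) f := rfl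

theorem endArgs_eq {m n l : ℕ} (h : l + 1 = m + n) (i : Fin m) (g : (endOperad k A).obj n)
    (a : Fin l → A) (x : Fin m) : endArgs A h i g a x =
      if hx : x = i then endApply (fun y => a (inputEquiv h i (Sum.inr y))) g
      else a (inputEquiv h i (Sum.inl ⟨x, hx⟩)) := rfl

variable (k A) in
theorem endOperad_isEquivariant : (endOperad k A).IsEquivariant := by
  intro m n l h i σ τ f g
  refine endOperad_ext fun a => ?_
  rw [endApply_comp, endApply_act, endApply_act, endApply_comp]
  refine congrArg (fun b => endApply b f) ?_
  funext x
  obtain ⟨x, rfl⟩ := σ.surjective x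
  rw [Equiv.Perm.inv_def, Equiv.symm_apply_apply, endArgs_eq, endArgs_eq]
  by_cases hx : x = i
  · subst hx
    rw [dif_pos rfl, dif_pos rfl, endApply_act]
    refine congrArg (fun b => endApply b g) ?_
    funext y
    congr 1
    obtain ⟨y, rfl⟩ := τ.surjective y
    rw [Equiv.Perm.inv_def, Equiv.symm_apply_apply, Equiv.Perm.eq_inv_iff_eq,
      permComp_inr h x _ _ y rfl]
  · rw [dif_neg hx, dif_neg fun e => hx (σ.injective e)]
    congr 1
    rw [Equiv.Perm.eq_inv_iff_eq, permComp_inl h i _ _ ⟨x, hx⟩ rfl rfl]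

end Endo

/-! ### The pre-Lie identity and the square of the differential -/

/-- Partial composition at a place given by a natural number; zero beyond the arity. -/
def OperadData.compN (T : OperadData k) {m n l : ℕ} (h : l + 1 = m + n) (i : ℕ) (p : T.obj m)
    (q : T.obj n) : T.obj l :=
  if hi : i < m then T.comp h ⟨i, hi⟩ p q else 0

theorem OperadData.compN_of_lt (T : OperadData k) {m n l : ℕ} (h : l + 1 = m + n) {i : ℕ}
    (hi : i < m) (p : T.obj m) (q : T.obj n) : T.compN h i p q = T.comp h ⟨i, hi⟩ p q :=
  dif_pos hi

theorem OperadData.circ_eq_sum_range (T : OperadData k) {m n l : ℕ} (h : l + 1 = m + n)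
    (p : T.obj m) (q : T.obj n) :
    T.circ h p q = ∑ i ∈ Finset.range m, (-1 : k) ^ ((n + 1) * i) • T.compN h i p q := by
  rw [← Fin.sum_univ_eq_sum_range (fun i => (-1 : k) ^ ((n + 1) * i) • T.compN h i p q)]
  simp only [OperadData.circ, LinearMap.sum_apply, LinearMap.smul_apply]
  exact Finset.sum_congr rfl fun i _ => by rw [T.compN_of_lt h i.2]

/-- The signed sum of the composites of `f` with `g` and with `x` at two different inputs, the
input of `x` preceding the input of `g`. -/
def OperadData.parSum (T : OperadData k) {m n r s w : ℕ} (h₁ : s + 1 = m + n) (h₂ : w + 1 = s + r)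
    (f : T.obj m) (g : T.obj n) (x : T.obj r) : T.obj w :=
  ∑ i ∈ Finset.range m, ∑ j ∈ Finset.range i,
    (-1 : k) ^ ((n + 1) * i + (r + 1) * j) • T.compN h₂ j (T.compN h₁ i f g) x

/-- The associator of `∘` consists of the composites at two different inputs of `f`; this makes it
graded symmetric in the last two arguments (the graded pre-Lie identity). -/
theorem NSOperad.circ_circ (T : NSOperad k) {m n r s t u w : ℕ} (h₁ : s + 1 = m + n)
    (h₂ : w + 1 = s + r) (h₃ : t + 1 = n + r) (h₄ : w + 1 = m + t) (h₅ : u + 1 = m + r)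
    (h₆ : w + 1 = u + n) (f : T.obj m) (g : T.obj n) (x : T.obj r) :
    T.circ h₂ (T.circ h₁ f g) x = T.parSum h₁ h₂ f g x + T.circ h₄ f (T.circ h₃ g x) +
      (-1 : k) ^ ((n + 1) * (r + 1)) • T.parSum h₅ h₆ f x g := by
  have hpar : T.parSum h₅ h₆ f x g = ∑ i ∈ Finset.range m, ∑ j ∈ Finset.Ico (i + 1) m,
      (-1 : k) ^ ((r + 1) * j + (n + 1) * i) • T.compN h₆ i (T.compN h₅ j f x) g :=
    Finset.sum_comm' fun j i => by simp only [Finset.mem_range, Finset.mem_Ico]; omega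
  have hL : T.circ h₂ (T.circ h₁ f g) x = ∑ i ∈ Finset.range m, (-1 : k) ^ ((n + 1) * i) •
      T.circ h₂ (T.compN h₁ i f g) x := by
    rw [T.circ_eq_sum_range h₁]
    simp only [map_sum, map_smul, LinearMap.sum_apply, LinearMap.smul_apply]
  have hR : T.circ h₄ f (T.circ h₃ g x) = ∑ i ∈ Finset.range m, ∑ j ∈ Finset.range n,
      (-1 : k) ^ ((t + 1) * i + (r + 1) * j) • T.compN h₄ i f (T.compN h₃ j g x) := by
    rw [T.circ_eq_sum_range h₄]
    refine Finset.sum_congr rfl fun i hi => ?_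
    have hi' := Finset.mem_range.1 hi
    rw [T.compN_of_lt h₄ hi', T.circ_eq_sum_range h₃, map_sum, Finset.smul_sum]
    refine Finset.sum_congr rfl fun j _ => ?_
    rw [map_smul, smul_smul, pow_add, T.compN_of_lt h₄ hi']
  rw [hL, hR, hpar, OperadData.parSum, Finset.smul_sum, ← Finset.sum_add_distrib,
    ← Finset.sum_add_distrib]
  refine Finset.sum_congr rfl fun i hi => ?_
  have hi' := Finset.mem_range.1 hi
  have hs : s = i + n + (m - (i + 1)) := by omega
  rw [T.circ_eq_sum_range h₂, Finset.sum_Ico_eq_sum_range]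
  have hs' : Finset.range s = Finset.range (i + n + (m - (i + 1))) := congrArg Finset.range hs
  rw [hs', Finset.sum_range_add, Finset.sum_range_add, smul_add, smul_add]
  simp only [Finset.smul_sum, smul_smul, ← pow_add]
  congr 1
  · congr 1
    refine Finset.sum_congr rfl fun j hj => ?_
    have hj' := Finset.mem_range.1 hj
    have hjs : i + j < s := by omega
    rw [T.compN_of_lt h₂ hjs, T.compN_of_lt h₁ hi', T.compN_of_lt h₄ hi', T.compN_of_lt h₃ hj',
      T.assoc_seq h₁ h₂ h₃ h₄ ⟨i, hi'⟩ ⟨j, hj'⟩ ⟨i + j, hjs⟩ rfl]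
    congr 1
    have ht : t + 1 = n + r := h₃
    rw [ht, neg_one_pow_eq_pow_mod_two, neg_one_pow_eq_pow_mod_two (n := (n + r) * i + _)]
    congr 1
    have : (n + 1) * i + (r + 1) * (i + j) = (n + r) * i + (r + 1) * j + 2 * i := by ring
    omega
  · refine Finset.sum_congr rfl fun d hd => ?_
    have hd' := Finset.mem_range.1 hd
    have hjs : i + n + d < s := by omega
    have hjm : i + 1 + d < m := by omega
    have hiu : i < u := by omega
    rw [T.compN_of_lt h₂ hjs, T.compN_of_lt h₁ hi', T.compN_of_lt h₆ hiu, T.compN_of_lt h₅ hjm,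
      T.assoc_par h₁ h₂ h₅ h₆ ⟨i, hi'⟩ ⟨i + 1 + d, hjm⟩ (by simp only [Fin.lt_def]; omega)
        ⟨i + n + d, hjs⟩ (by simp only []; omega) ⟨i, hiu⟩ rfl]
    congr 1
    rw [neg_one_pow_eq_pow_mod_two, neg_one_pow_eq_pow_mod_two (n := (n + 1) * (r + 1) + _)]
    congr 1
    have : (n + 1) * (r + 1) + ((r + 1) * (i + 1 + d) + (n + 1) * i) =
      (n + 1) * i + (r + 1) * (i + n + d) + 2 * (r + 1) := by ring
    omega

/-- Bracketing twice with an element `ω` of arity two with `ω ∘ ω = 0` gives zero. -/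
theorem NSOperad.delta_delta (T : NSOperad k) (ω : T.obj 2)
    (hω : T.circ (m := 2) (n := 2) (l := 3) rfl ω ω = 0) (m : ℕ) (t : T.obj (m + 1)) :
    T.delta ω (m + 1) (T.delta ω m t) = 0 := by
  have e1 := T.circ_circ (m := m + 1) (n := 2) (r := 2) (s := m + 2) (t := 3) (u := m + 2)
    (w := m + 3) rfl rfl rfl rfl rfl rfl t ω ω
  have e2 := T.circ_circ (m := 2) (n := m + 1) (r := 2) (s := m + 2) (t := m + 2) (u := 3)
    (w := m + 3) (by omega) rfl rfl (by omega) rfl (by omega) ω t ω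
  have e3 := T.circ_circ (m := 2) (n := 2) (r := m + 1) (s := 3) (t := m + 2) (u := m + 2)
    (w := m + 3) rfl (by omega) (by omega) (by omega) (by omega) rfl ω ω t
  rw [hω, map_zero, LinearMap.zero_apply] at e3
  rw [hω, map_zero] at e1
  simp only [OperadData.delta, OperadData.bracket, LinearMap.flip_apply, LinearMap.sub_apply,
    LinearMap.smul_apply, map_sub, map_smul]
  rw [e1, e2]
  obtain ⟨ε, h1, h2, h3, h4, h5⟩ : ∃ ε : k, ε * ε = 1 ∧ (-1 : k) ^ ((m + 1 + 1) * (2 + 1)) = ε ∧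
      (-1 : k) ^ ((m + 1 + 1 + 1) * (2 + 1)) = -ε ∧ (-1 : k) ^ ((2 + 1) * (m + 1 + 1)) = ε ∧
      (-1 : k) ^ ((2 + 1) * (2 + 1)) = -1 := by
    refine ⟨(-1) ^ ((m + 1 + 1) * (2 + 1)), ?_, rfl, ?_, by rw [mul_comm], by norm_num⟩
    · rw [← mul_pow]; simp
    · rw [Nat.succ_mul, pow_add]; norm_num
  rw [h4] at e3
  rw [h2, h3, h5]
  -- the terms with two copies of `ω` are matched by the identity for `(ω ∘ ω) ∘ t`
  rcases mul_self_eq_one_iff.1 h1 with rfl | rfl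
  · linear_combination (norm := module) e3
  · linear_combination (norm := module) e3

/-! ### The canonical element squares to zero -/

/-- For a family `b` with dual data `v`: if `v` kills the functionals that vanish on the kernel of
`u`, then so does the image of the canonical element. -/
theorem sum_tmul_eq_zero_of_forall_dual {E X Y I : Type*} [AddCommGroup E] [Module k E]
    [AddCommGroup X] [Module k X] [AddCommGroup Y] [Module k Y] [Fintype I] (b : I → E)
    (u : E →ₗ[k] X) (v : I → Y)
    (H : ∀ f : Module.Dual k E, LinearMap.ker u ≤ LinearMap.ker f → ∑ j, f (b j) • v j = 0) :
    ∑ j, u (b j) ⊗ₜ[k] v j = 0 := by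
  classical
  let B := Module.Basis.ofVectorSpace k X
  refine (TensorProduct.equivFinsuppOfBasisLeft B).injective ?_
  ext t
  rw [map_zero, map_sum, Finsupp.finsetSum_apply]
  simp only [TensorProduct.equivFinsuppOfBasisLeft_apply_tmul_apply]
  refine H (B.coord t ∘ₗ u) fun x hx => ?_
  simp [LinearMap.mem_ker.1 hx]

/-- The relations of the quadratic dual, in terms of a finite family of pairs of generators. -/
theorem OperadData.nsDual_sum_eq_zero (Q : OperadData k) {I : Type*} (s : Finset I) (c : I → k)
    (j : I → Fin 2) (f g : I → Module.Dual k (Q.obj 2))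
    (H : ∀ x ∈ Q.nsRelations, ∑ i ∈ s, c i * (-1) ^ (j i : ℕ) *
      TensorProduct.dualDistrib k _ _ (f i ⊗ₜ g i) (x (j i)) = 0) :
    ∑ i ∈ s, c i • Q.nsDual.comp (m := 2) (n := 2) (l := 3) rfl (j i) (Q.nsDualGen (f i))
      (Q.nsDualGen (g i)) = 0 := by
  let w : Fin 2 × Module.Dual k (Q.obj 2) × Module.Dual k (Q.obj 2) →₀ k :=
    ∑ i ∈ s, Finsupp.single (j i, f i, g i) (c i)
  have hw : ∀ {M : Type u} [AddCommGroup M] [Module k M]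
      (F : Fin 2 × Module.Dual k (Q.obj 2) × Module.Dual k (Q.obj 2) → M),
      (w.sum fun z c => c • F z) = ∑ i ∈ s, c i • F (j i, f i, g i) := by
    intro M _ _ F
    rw [← Finsupp.linearCombination_apply, map_sum]
    exact Finset.sum_congr rfl fun i _ => Finsupp.linearCombination_single k _ _
  have hrel := OperadData.NSDualRel.quadratic (P := Q) w fun x hx => by
    simp only [mul_assoc]
    refine Eq.trans (hw (fun z => (-1) ^ (z.1 : ℕ) *
      TensorProduct.dualDistrib k _ _ (z.2.1 ⊗ₜ z.2.2) (x z.1))) ?_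
    simpa only [smul_eq_mul, mul_assoc] using H x hx
  have hmem := (Submodule.Quotient.mk_eq_zero _).2 (OperadData.subset_ideal _ _ _ hrel)
  rw [hw (fun z => (freeNS k _).comp _ z.1 (freeNSGen k z.2.1) (freeNSGen k z.2.2))] at hmem
  refine Eq.trans ?_ hmem
  refine Eq.trans ?_ (map_sum (Submodule.mkQ _) _ _).symm
  rfl

/-- Pairs of elements of `V ⊗ V` in terms of the basis induced by a basis `e` of `V`. -/
theorem eq_sum_dualDistrib_smul {V ι : Type*} [AddCommGroup V] [Module k V] [Fintype ι]
    (e : Module.Basis ι k V) (x : Fin 2 → V ⊗[k] V) :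
    x = ∑ z : Fin 2 × ι × ι, TensorProduct.dualDistrib k V V
      (e.coord z.2.1 ⊗ₜ[k] e.coord z.2.2) (x z.1) • Pi.single z.1 (e z.2.1 ⊗ₜ[k] e z.2.2) := by
  have h2 : ∀ y : V ⊗[k] V, y = ∑ a, ∑ c,
      TensorProduct.dualDistrib k V V (e.coord a ⊗ₜ[k] e.coord c) y • (e a ⊗ₜ[k] e c) := by
    intro y
    induction y using TensorProduct.induction_on with
    | zero => simp
    | add y z hy hz =>
      simp only [map_add, add_smul, Finset.sum_add_distrib]
      rw [← hy, ← hz]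
    | tmul y z =>
      conv_lhs => rw [← e.sum_repr y, ← e.sum_repr z]
      simp only [TensorProduct.sum_tmul, TensorProduct.tmul_sum, TensorProduct.smul_tmul_smul,
        TensorProduct.dualDistrib_apply, Module.Basis.coord_apply]
      exact Finset.sum_comm
  funext j
  conv_lhs => rw [h2 (x j)]
  simp only [Fintype.sum_prod_type, Finset.sum_apply, Pi.smul_apply]
  rw [Finset.sum_eq_single j]
  · simp only [Pi.single_eq_same]
  · intro i _ hi
    simp only [Pi.single_eq_of_ne hi.symm, smul_zero, Finset.sum_const_zero]
  · exact fun h => absurd (Finset.mem_univ _) h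

/-- The composition map with kernel `Q.nsRelations`. -/
def OperadData.pairComp (Q : OperadData k) : (Fin 2 → Q.obj 2 ⊗[k] Q.obj 2) →ₗ[k] Q.obj 3 :=
  ∑ j : Fin 2, TensorProduct.lift (Q.comp (m := 2) (n := 2) (l := 3) rfl j) ∘ₗ LinearMap.proj j

theorem OperadData.mem_nsRelations (Q : OperadData k) (x : Fin 2 → Q.obj 2 ⊗[k] Q.obj 2) :
    x ∈ Q.nsRelations ↔ Q.pairComp x = 0 := Iff.rfl

theorem OperadData.pairComp_single (Q : OperadData k) (j : Fin 2) (p q : Q.obj 2) :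
    Q.pairComp (Pi.single j (p ⊗ₜ[k] q)) = Q.comp (m := 2) (n := 2) (l := 3) rfl j p q := by
  simp only [OperadData.pairComp, LinearMap.sum_apply, LinearMap.comp_apply, LinearMap.proj_apply]
  rw [Finset.sum_eq_single j (fun i _ hi => by rw [Pi.single_eq_of_ne hi, map_zero])
    (fun h => absurd (Finset.mem_univ _) h), Pi.single_eq_same, TensorProduct.lift.tmul]

/-- For a family `v` that satisfies the relations of the quadratic dual, the signed sum of the
composites of pairs of basis elements of `Q(2)`, tensored with the dual members of `v`, vanishes. -/
theorem OperadData.sum_pairComp_tmul (Q : OperadData k) {ι Y : Type*} [Fintype ι] [AddCommGroup Y]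
    [Module k Y] (e : Module.Basis ι k (Q.obj 2)) (v : Fin 2 × ι × ι → Y)
    (H : ∀ c : Fin 2 × ι × ι → k, (∀ x ∈ Q.nsRelations, ∑ z, c z * (-1) ^ (z.1 : ℕ) *
      TensorProduct.dualDistrib k _ _ (e.coord z.2.1 ⊗ₜ e.coord z.2.2) (x z.1) = 0) →
        ∑ z, c z • v z = 0) :
    ∑ z : Fin 2 × ι × ι, Q.pairComp (Pi.single z.1 (e z.2.1 ⊗ₜ[k] e z.2.2)) ⊗ₜ[k]
      ((-1 : k) ^ (z.1 : ℕ) • v z) = 0 := by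
  refine sum_tmul_eq_zero_of_forall_dual
    (fun z : Fin 2 × ι × ι => Pi.single z.1 (e z.2.1 ⊗ₜ[k] e z.2.2)) Q.pairComp
    (fun z => (-1 : k) ^ (z.1 : ℕ) • v z) fun f hf => ?_
  simp only [smul_smul]
  refine H (fun z => f (Pi.single z.1 (e z.2.1 ⊗ₜ[k] e z.2.2)) * (-1) ^ (z.1 : ℕ)) fun x hx => ?_
  have hx' : x ∈ LinearMap.ker Q.pairComp := hx
  have hfx : f x = 0 := hf hx'
  rw [eq_sum_dualDistrib_smul e x, map_sum] at hfx
  rw [← hfx]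
  refine Finset.sum_congr rfl fun z _ => ?_
  have hs : ((-1 : k) ^ (z.1 : ℕ)) * (-1) ^ (z.1 : ℕ) = 1 := by rw [← mul_pow]; simp
  rw [map_smul, smul_eq_mul, mul_assoc (f _), hs, mul_one, mul_comm]

/-- The non-symmetric canonical element squares to zero, because the relations of the quadratic
dual are the annihilator of those of `Q`, up to the sign between `∘₁` and `∘₂`. -/
theorem OperadData.nsCanonical_circ (Q : OperadData k) [Module.Finite k (Q.obj 2)] :
    (Q.tensor Q.nsDual).circ (m := 2) (n := 2) (l := 3) rfl Q.nsCanonical Q.nsCanonical = 0 := by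
  let e := Module.Basis.ofVectorSpace k (Q.obj 2)
  have hχ : Q.nsCanonical = ∑ a, Q.tmul Q.nsDual 2 (e a) (Q.nsDualGen (e.coord a)) := by
    rw [OperadData.nsCanonical, coevaluation_apply_one, map_sum]
    rfl
  refine Eq.trans ?_ (Q.sum_pairComp_tmul e (fun z => Q.nsDual.comp (m := 2) (n := 2) (l := 3) rfl
    z.1 (Q.nsDualGen (e.coord z.2.1)) (Q.nsDualGen (e.coord z.2.2))) fun c hc => ?_)
  swap
  · exact Q.nsDual_sum_eq_zero Finset.univ c (fun z => z.1) (fun z => e.coord z.2.1)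
      (fun z => e.coord z.2.2) hc
  rw [hχ, OperadData.circ, LinearMap.sum_apply, LinearMap.sum_apply, Fintype.sum_prod_type]
  refine Finset.sum_congr rfl fun j _ => ?_
  rw [LinearMap.smul_apply, LinearMap.smul_apply, map_sum, Finset.smul_sum,
    Fintype.sum_prod_type_right]
  refine Finset.sum_congr rfl fun c _ => ?_
  rw [map_sum, LinearMap.sum_apply, Finset.smul_sum]
  refine Finset.sum_congr rfl fun a _ => ?_
  rw [OperadData.pairComp_single, OperadData.tensor_comp_tmul]
  have hs : (-1 : k) ^ ((2 + 1) * (j : ℕ)) = (-1) ^ (j : ℕ) := by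
    rw [pow_mul]; norm_num
  rw [hs]
  exact (map_smul (Q.tmul Q.nsDual 3 _) _ _).symm

/-! ### Trees of binary operations on a vector space -/

section TreeOperations

variable {A : Type u} [AddCommGroup A] [Module k A] {S : Type u}

/-- The value of a tree on the arguments `a 0, a 1, …`, if its vertices act by `μ`. -/
def BinTree.evFun (μ : S → A →ₗ[k] A →ₗ[k] A) : BinTree S → (ℕ → A) → A
  | BinTree.leaf, a => a 0
  | BinTree.node c l r, a => μ c (l.evFun μ a) (r.evFun μ fun i => a (i + l.leaves))

theorem BinTree.evFun_congr (μ : S → A →ₗ[k] A →ₗ[k] A) (t : BinTree S) {a b : ℕ → A}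
    (h : ∀ i < t.leaves, a i = b i) : t.evFun μ a = t.evFun μ b := by
  induction t generalizing a b with
  | leaf => exact h 0 one_pos
  | node c l r ihl ihr =>
    simp only [leaves] at h
    simp only [evFun]
    rw [ihl fun i hi => h i (by omega), ihr fun i hi => h (i + l.leaves) (by omega)]

theorem BinTree.evFun_update_node (μ : S → A →ₗ[k] A →ₗ[k] A) (c : S) (l r : BinTree S) (a : ℕ → A)
    (i : ℕ) (x : A) : (BinTree.node c l r).evFun μ (Function.update a i x) =
      if i < l.leaves then
        μ c (l.evFun μ (Function.update a i x)) (r.evFun μ fun j => a (j + l.leaves))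
      else μ c (l.evFun μ a)
        (r.evFun μ (Function.update (fun j => a (j + l.leaves)) (i - l.leaves) x)) := by
  simp only [evFun]
  split_ifs with h
  · congr 2
    funext j
    rw [Function.update_of_ne (by omega)]
  · congr 2
    · exact l.evFun_congr μ fun j hj => Function.update_of_ne (by omega) _ _
    · funext j
      by_cases hj : j = i - l.leaves
      · subst hj
        rw [Nat.sub_add_cancel (by omega), Function.update_self, Function.update_self]
      · rw [Function.update_of_ne hj, Function.update_of_ne (by omega)]

theorem BinTree.evFun_update_add (μ : S → A →ₗ[k] A →ₗ[k] A) (t : BinTree S) (a : ℕ → A) (i : ℕ)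
    (hi : i < t.leaves) (x y : A) : t.evFun μ (Function.update a i (x + y)) =
      t.evFun μ (Function.update a i x) + t.evFun μ (Function.update a i y) := by
  induction t generalizing a i with
  | leaf =>
    obtain rfl : i = 0 := by simpa [leaves] using hi
    simp [evFun]
  | node c l r ihl ihr =>
    simp only [leaves] at hi
    simp only [evFun_update_node]
    split_ifs with h
    · rw [ihl _ _ h, map_add, LinearMap.add_apply]
    · rw [ihr _ _ (by omega), map_add]

theorem BinTree.evFun_update_smul (μ : S → A →ₗ[k] A →ₗ[k] A) (t : BinTree S) (a : ℕ → A) (i : ℕ)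
    (hi : i < t.leaves) (z : k) (x : A) : t.evFun μ (Function.update a i (z • x)) =
      z • t.evFun μ (Function.update a i x) := by
  induction t generalizing a i with
  | leaf =>
    obtain rfl : i = 0 := by simpa [leaves] using hi
    simp [evFun]
  | node c l r ihl ihr =>
    simp only [leaves] at hi
    simp only [evFun_update_node]
    split_ifs with h
    · rw [ihl _ _ h, map_smul, LinearMap.smul_apply]
    · rw [ihr _ _ (by omega), map_smul]

/-- Grafting at the leaf `i` substitutes the value of the grafted tree for the argument `i`. -/
theorem BinTree.evFun_graft (μ : S → A →ₗ[k] A →ₗ[k] A) (t s : BinTree S) (a : ℕ → A) (i : ℕ)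
    (hi : i < t.leaves) : (t.graft i s).evFun μ a = t.evFun μ fun x =>
      if x < i then a x else if x = i then s.evFun μ (fun j => a (i + j)) else
        a (x + s.leaves - 1) := by
  have hs := s.leaves_pos
  induction t generalizing a i with
  | leaf =>
    obtain rfl : i = 0 := by simpa [leaves] using hi
    simp [evFun, graft]
  | node c l r ihl ihr =>
    simp only [leaves] at hi
    simp only [graft]
    split_ifs with h
    · have hl := l.leaves_graft s i h
      simp only [evFun]
      rw [ihl _ _ h]
      congr 2
      funext j
      rw [if_neg (by omega), if_neg (by omega)]
      congr 1
      omega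
    · simp only [evFun]
      rw [ihr _ _ (by omega)]
      congr 2
      · exact l.evFun_congr μ fun j hj => (if_pos (by omega)).symm
      · funext j
        by_cases h1 : j < i - l.leaves
        · rw [if_pos h1, if_pos (by omega)]
        · rw [if_neg h1, if_neg (by omega : ¬ j + l.leaves < i)]
          by_cases h2 : j = i - l.leaves
          · rw [if_pos h2, if_pos (by omega)]
            congr 1
            funext x
            congr 1
            omega
          · rw [if_neg h2, if_neg (by omega)]
            congr 1
            omega

theorem BinTree.evFun_map {S' : Type u} (μ : S' → A →ₗ[k] A →ₗ[k] A) (f : S → S') (t : BinTree S)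
    (a : ℕ → A) : (t.map f).evFun μ a = t.evFun (fun c => μ (f c)) a := by
  induction t generalizing a with
  | leaf => rfl
  | node c l r ihl ihr => simp only [map, evFun, ihl, ihr, leaves_map]

/-- A finite sequence, extended by zero. -/
def extendZero {n : ℕ} (a : Fin n → A) (j : ℕ) : A := if h : j < n then a ⟨j, h⟩ else 0

theorem extendZero_of_lt {n : ℕ} (a : Fin n → A) {j : ℕ} (h : j < n) :
    extendZero a j = a ⟨j, h⟩ := dif_pos h

theorem extendZero_update {n : ℕ} (a : Fin n → A) (i : Fin n) (x : A) :
    extendZero (Function.update a i x) = Function.update (extendZero a) i x := by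
  funext j
  by_cases hj : j < n
  · rw [extendZero_of_lt _ hj]
    by_cases hij : j = i
    · subst hij
      simp
    · rw [Function.update_of_ne hij, Function.update_of_ne (fun e => hij (congrArg Fin.val e)),
        extendZero_of_lt _ hj]
  · rw [Function.update_of_ne (by omega)]
    simp [extendZero, hj]

/-- The multilinear operation given by a tree with `n` leaves. -/
def BinTree.evOp (μ : S → A →ₗ[k] A →ₗ[k] A) (n : ℕ) (t : BinTree S) (h : t.leaves = n) :
    (endOperad k A).obj n :=
  MultilinearMap.mk' (fun a => t.evFun μ (extendZero a))
    (fun a i x y => by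
      simp only [extendZero_update]
      exact t.evFun_update_add μ _ _ (by omega) _ _)
    (fun a i z x => by
      simp only [extendZero_update]
      exact t.evFun_update_smul μ _ _ (by omega) _ _)

/-- The morphism of operads from the free operad on `S` to the endomorphism operad of `A` that is
given by binary operations `μ`. -/
def treeEval (μ : S → A →ₗ[k] A →ₗ[k] A) (n : ℕ) : (freeNS k S).obj n →ₗ[k] (endOperad k A).obj n :=
  Finsupp.linearCombination k fun t : {t : BinTree S // t.leaves = n} => t.1.evOp μ n t.2

theorem endApply_treeEval (μ : S → A →ₗ[k] A →ₗ[k] A) (n : ℕ) (t : BinTree S) (h : t.leaves = n)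
    (a : Fin n → A) :
    endApply a (treeEval μ n (treeElt k n t h)) = t.evFun μ (extendZero a) := by
  have : treeEval μ n (treeElt k n t h) = t.evOp μ n h :=
    (Finsupp.linearCombination_single k _ _).trans (one_smul k _)
  rw [this]
  rfl

theorem treeEval_one (μ : S → A →ₗ[k] A →ₗ[k] A) :
    treeEval μ 1 (freeNS k S).one = (endOperad k A).one := by
  refine endOperad_ext fun a => ?_
  exact endApply_treeEval μ 1 BinTree.leaf rfl a

theorem treeEval_comp (μ : S → A →ₗ[k] A →ₗ[k] A) {m n l : ℕ} (h : l + 1 = m + n) (i : Fin m)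
    (x : (freeNS k S).obj m) (y : (freeNS k S).obj n) :
    treeEval μ l ((freeNS k S).comp h i x y) =
      (endOperad k A).comp h i (treeEval μ m x) (treeEval μ n y) := by
  induction x using freeNS_induction with
  | zero => simp
  | add x y hx hy => simp only [map_add, LinearMap.add_apply, hx, hy]
  | smul c x hx => simp only [map_smul, LinearMap.smul_apply, hx]
  | tree t ht =>
  induction y using freeNS_induction with
  | zero => simp
  | add x y hx hy => simp only [map_add, hx, hy]
  | smul c x hx => simp only [map_smul, hx]
  | tree s hs =>
  refine endOperad_ext fun a => ?_
  rw [freeNS_comp_treeElt, endApply_treeEval, endApply_comp, endApply_treeEval,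
    t.evFun_graft μ s _ i (by omega)]
  refine t.evFun_congr μ fun x hx => ?_
  have hi := i.2
  rw [extendZero_of_lt _ (by omega : x < m), endArgs_eq]
  rcases lt_trichotomy x i with h1 | h1 | h1
  · rw [if_pos h1, dif_neg (fun e => h1.ne (congrArg Fin.val e)), extendZero_of_lt _ (by omega)]
    congr 1
    apply Fin.ext
    rw [inputEquiv_inl_val, if_pos h1]
  · subst h1
    rw [if_neg (lt_irrefl _), if_pos rfl, dif_pos rfl, endApply_treeEval]
    refine s.evFun_congr μ fun j hj => ?_
    rw [extendZero_of_lt _ (by omega), extendZero_of_lt _ (by omega)]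
    rfl
  · rw [if_neg (by omega), if_neg (by omega), dif_neg (fun e => h1.ne' (congrArg Fin.val e)),
      extendZero_of_lt _ (by omega)]
    congr 1
    apply Fin.ext
    rw [inputEquiv_inl_val, if_neg (by simp only []; omega)]
    simp only [hs]

end TreeOperations

/-! ### Extension of morphisms to symmetrizations -/

section SymExtend

variable {P : OperadData k} {T : SymOperadData k} (β : ∀ n, P.obj n →ₗ[k] T.obj n)

/-- The equivariant extension of maps `P(n) → T(n)` to the symmetrization of `P`. -/
def symExtend (n : ℕ) : P.symmetrization.obj n →ₗ[k] T.obj n :=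
  Finsupp.lsum k fun σ : Equiv.Perm (Fin n) => T.act σ ∘ₗ β n

theorem symExtend_single {n : ℕ} (σ : Equiv.Perm (Fin n)) (p : P.obj n) :
    symExtend β n (Finsupp.single σ p) = T.act σ (β n p) :=
  Finsupp.lsum_single _ _ _ _

theorem symExtend_act {n : ℕ} (σ : Equiv.Perm (Fin n)) (x : P.symmetrization.obj n) :
    symExtend β n (P.symmetrization.act σ x) = T.act σ (symExtend β n x) := by
  induction x using OperadData.symmetrization_induction with
  | zero => simp
  | add x y hx hy => simp only [map_add, hx, hy]
  | single τ a =>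
    rw [P.symmetrization_act_single, symExtend_single, symExtend_single, T.act_mul]

theorem symExtend_comp (hT : T.IsEquivariant)
    (hβ : ∀ {m n l : ℕ} (h : l + 1 = m + n) (i : Fin m) (p : P.obj m) (q : P.obj n),
      β l (P.comp h i p q) = T.comp h i (β m p) (β n q))
    {m n l : ℕ} (h : l + 1 = m + n) (i : Fin m) (x : P.symmetrization.obj m)
    (y : P.symmetrization.obj n) :
    symExtend β l (P.symmetrization.comp h i x y) =
      T.comp h i (symExtend β m x) (symExtend β n y) := by
  induction x using OperadData.symmetrization_induction with
  | zero => simp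
  | add x y hx hy => simp only [map_add, LinearMap.add_apply, hx, hy]
  | single σ a =>
  induction y using OperadData.symmetrization_induction with
  | zero => simp
  | add x y hx hy => simp only [map_add, hx, hy]
  | single τ b =>
  rw [P.symmetrization_comp_single, symExtend_single, symExtend_single, symExtend_single, hβ, hT]

end SymExtend

/-! ### The free algebra on countably many generators -/

section FreeAlgebra

/-- The underlying space of the free algebra on generators `x₀, x₁, …`: the direct sum, over words
`w` in the generators, of the operations with `w.length` inputs. -/
abbrev WordAlgebra (T : OperadData k) : Type u :=
  DirectSum (List ℕ) fun w => T.obj w.length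

variable (T : OperadData k)

/-- The operation `q` applied to the letters of the word `w`. -/
def wordElt (w : List ℕ) {n : ℕ} (h : w.length = n) : T.obj n →ₗ[k] WordAlgebra T :=
  h ▸ DirectSum.lof k (List ℕ) (fun w => T.obj w.length) w

theorem wordElt_rfl (w : List ℕ) :
    wordElt T w rfl = DirectSum.lof k (List ℕ) (fun w => T.obj w.length) w := rfl

theorem wordElt_congr {w w' : List ℕ} (e : w = w') {n : ℕ} (h : w.length = n) (h' : w'.length = n)
    (q : T.obj n) : wordElt T w h q = wordElt T w' h' q := by
  subst e; rfl

/-- The coefficient of a word of length `n`. -/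
def wordCoeff (w : List ℕ) {n : ℕ} (h : w.length = n) : WordAlgebra T →ₗ[k] T.obj n :=
  h ▸ DirectSum.component k (List ℕ) (fun w => T.obj w.length) w

theorem wordCoeff_wordElt_self (w : List ℕ) {n : ℕ} (h : w.length = n) (q : T.obj n) :
    wordCoeff T w h (wordElt T w h q) = q := by
  subst h
  exact DirectSum.component.lof_self (M := fun w => T.obj w.length) k w q

theorem wordCoeff_wordElt_of_ne {w w' : List ℕ} (e : w' ≠ w) {n n' : ℕ} (h : w.length = n)
    (h' : w'.length = n') (q : T.obj n') : wordCoeff T w h (wordElt T w' h' q) = 0 := by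
  subst h h'
  exact (DirectSum.component.of (M := fun w => T.obj w.length) k w w' q).trans (dif_neg e)

/-- The binary operation `c(a, b) = (c ∘₂ b) ∘₁ a` of the free algebra, on the components of two
words. -/
def wordMulAux (c : T.obj 2) (w v : List ℕ) :
    T.obj v.length →ₗ[k] T.obj w.length →ₗ[k] WordAlgebra T :=
  (T.comp (m := 1 + v.length) (n := w.length) (l := (w ++ v).length)
    (by rw [List.length_append]; omega) ⟨0, by omega⟩ ∘ₗ
      T.comp (m := 2) (n := v.length) (l := 1 + v.length) (by omega) 1 c).compr₂
    (wordElt T (w ++ v) rfl)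

/-- The binary operation of the free algebra given by `c`. -/
def wordMul (c : T.obj 2) : WordAlgebra T →ₗ[k] WordAlgebra T →ₗ[k] WordAlgebra T :=
  DirectSum.toModule k _ _ fun w =>
    (DirectSum.toModule k _ _ fun v => wordMulAux T c w v).flip

theorem wordMul_wordElt (c : T.obj 2) (w v : List ℕ) {a b r l : ℕ} (hw : w.length = a)
    (hv : v.length = b) (h₁ : r + 1 = 2 + b) (h₂ : l + 1 = r + a) (h : (w ++ v).length = l)
    (i : Fin r) (hi : (i : ℕ) = 0) (p : T.obj a) (q : T.obj b) :
    wordMul T c (wordElt T w hw p) (wordElt T v hv q) =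
      wordElt T (w ++ v) h (T.comp h₂ i (T.comp h₁ 1 c q) p) := by
  subst hw hv h
  obtain rfl : r = 1 + v.length := by omega
  have hi' : i = ⟨0, by omega⟩ := Fin.ext hi
  rw [hi', wordMul, wordElt_rfl, wordElt_rfl, DirectSum.toModule_lof, LinearMap.flip_apply,
    DirectSum.toModule_lof]
  rfl

theorem wordAlgebra_bilin_ext {M : Type*} [AddCommGroup M] [Module k M]
    {f g : WordAlgebra T →ₗ[k] WordAlgebra T →ₗ[k] M}
    (H : ∀ w p v q, f (wordElt T w rfl p) (wordElt T v rfl q) =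
      g (wordElt T w rfl p) (wordElt T v rfl q)) : f = g :=
  DirectSum.linearMap_ext k fun w => LinearMap.ext fun p =>
    DirectSum.linearMap_ext k fun v => LinearMap.ext fun q => H w p v q

theorem wordMul_add (c d : T.obj 2) : wordMul T (c + d) = wordMul T c + wordMul T d := by
  refine wordAlgebra_bilin_ext T fun w p v q => ?_
  rw [LinearMap.add_apply, LinearMap.add_apply]
  rw [wordMul_wordElt T _ w v rfl rfl (r := 1 + v.length) (l := (w ++ v).length) (by omega)
      (by rw [List.length_append]; omega) rfl ⟨0, by omega⟩ rfl,
    wordMul_wordElt T c w v rfl rfl (r := 1 + v.length) (l := (w ++ v).length) (by omega)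
      (by rw [List.length_append]; omega) rfl ⟨0, by omega⟩ rfl,
    wordMul_wordElt T d w v rfl rfl (r := 1 + v.length) (l := (w ++ v).length) (by omega)
      (by rw [List.length_append]; omega) rfl ⟨0, by omega⟩ rfl]
  simp only [map_add, LinearMap.add_apply]

theorem wordMul_smul (z : k) (c : T.obj 2) : wordMul T (z • c) = z • wordMul T c := by
  refine wordAlgebra_bilin_ext T fun w p v q => ?_
  rw [LinearMap.smul_apply, LinearMap.smul_apply]
  rw [wordMul_wordElt T _ w v rfl rfl (r := 1 + v.length) (l := (w ++ v).length) (by omega)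
      (by rw [List.length_append]; omega) rfl ⟨0, by omega⟩ rfl,
    wordMul_wordElt T c w v rfl rfl (r := 1 + v.length) (l := (w ++ v).length) (by omega)
      (by rw [List.length_append]; omega) rfl ⟨0, by omega⟩ rfl]
  simp only [map_smul, LinearMap.smul_apply]

/-- The ternary operation `q(a, b, c) = ((q ∘₃ c) ∘₂ b) ∘₁ a` on the components of three words, as
a function of `q`. -/
def wordTri (u v w : List ℕ) (a : T.obj u.length) (b : T.obj v.length) (c : T.obj w.length) :
    T.obj 3 →ₗ[k] WordAlgebra T :=
  wordElt T (u ++ v ++ w) rfl ∘ₗ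
    (T.comp (m := 1 + v.length + w.length) (n := u.length) (l := (u ++ v ++ w).length)
      (by rw [List.length_append, List.length_append]; omega) ⟨0, by omega⟩).flip a ∘ₗ
    (T.comp (m := 2 + w.length) (n := v.length) (l := 1 + v.length + w.length)
      (by omega) ⟨1, by omega⟩).flip b ∘ₗ
    (T.comp (m := 3) (n := w.length) (l := 2 + w.length) (by omega) 2).flip c

variable {T} in
/-- Operations of arity `n` on the free algebra agree if they agree on homogeneous elements. -/
theorem endOperad_wordAlgebra_ext {n : ℕ} {f g : (endOperad k (WordAlgebra T)).obj n}
    (H : ∀ (w : Fin n → List ℕ) (q : ∀ i, T.obj (w i).length),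
      endApply (fun i => wordElt T (w i) rfl (q i)) f =
        endApply (fun i => wordElt T (w i) rfl (q i)) g) : f = g :=
  MultilinearMap.dfinsupp_ext fun w => MultilinearMap.ext fun q => H w q

/-- The generator `xᵢ`. -/
def wordGen (i : ℕ) : WordAlgebra T := wordElt T [i] rfl T.one

end FreeAlgebra

namespace NSOperad

variable (T : NSOperad k)

theorem wordMul_wordMul_left (c d : T.obj 2) (u v w : List ℕ) (p : T.obj u.length)
    (q : T.obj v.length) (r : T.obj w.length) :
    wordMul T.toOperadData c (wordMul T.toOperadData d (wordElt _ u rfl p) (wordElt _ v rfl q))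
      (wordElt _ w rfl r) = wordTri T.toOperadData u v w p q r (T.comp (n := 2) rfl 0 c d) := by
  rw [wordMul_wordElt _ d u v rfl rfl (r := 1 + v.length) (l := (u ++ v).length) (by omega)
      (by rw [List.length_append]; omega) rfl ⟨0, by omega⟩ rfl,
    wordMul_wordElt _ c (u ++ v) w rfl rfl (r := 1 + w.length) (l := (u ++ v ++ w).length)
      (by omega) (by simp only [List.length_append]; omega) rfl ⟨0, by omega⟩ rfl]
  refine congrArg (wordElt _ _ rfl) ?_
  simp only [LinearMap.comp_apply, LinearMap.flip_apply]
  rw [T.assoc_par (m := 2) (n := 2) (r := w.length) (s := 3) (t := 1 + w.length) (w := 2 + w.length)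
      rfl (by omega) (by omega) (by omega) 0 1 (by decide) 2 rfl ⟨0, by omega⟩ rfl c d r,
    T.assoc_seq (m := 1 + w.length) (n := 2) (r := v.length) (s := 2 + w.length)
      (t := 1 + v.length) (w := 1 + v.length + w.length) (by omega) (by omega) (by omega) (by omega)
      ⟨0, by omega⟩ 1 ⟨1, by omega⟩ rfl]
  exact (T.assoc_seq _ _ _ _ ⟨0, by omega⟩ ⟨0, by omega⟩ ⟨0, by omega⟩ rfl _ _ _).symm

theorem wordMul_wordMul_right (c d : T.obj 2) (u v w : List ℕ) (p : T.obj u.length)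
    (q : T.obj v.length) (r : T.obj w.length) :
    wordMul T.toOperadData c (wordElt _ u rfl p) (wordMul T.toOperadData d (wordElt _ v rfl q)
      (wordElt _ w rfl r)) = wordTri T.toOperadData u v w p q r (T.comp (n := 2) rfl 1 c d) := by
  have hl : (u ++ (v ++ w)).length = (u ++ v ++ w).length := by rw [List.append_assoc]
  rw [wordMul_wordElt _ d v w rfl rfl (r := 1 + w.length) (l := (v ++ w).length) (by omega)
      (by rw [List.length_append]; omega) rfl ⟨0, by omega⟩ rfl,
    wordMul_wordElt _ c u (v ++ w) rfl rfl (r := 1 + v.length + w.length)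
      (l := (u ++ v ++ w).length) (by simp only [List.length_append]; omega)
      (by simp only [List.length_append]; omega) hl ⟨0, by omega⟩ rfl,
    wordElt_congr _ (List.append_assoc u v w).symm hl rfl]
  refine congrArg (wordElt _ _ rfl) ?_
  simp only [LinearMap.comp_apply, LinearMap.flip_apply]
  refine congrArg (fun z => T.comp _ _ z p) ?_
  rw [T.assoc_seq (m := 2) (n := 2) (r := w.length) (s := 3) (t := 1 + w.length) (w := 2 + w.length)
      rfl (by omega) (by omega) (by omega) 1 1 2 rfl c d r]
  exact (T.assoc_seq _ _ _ _ 1 ⟨0, by omega⟩ ⟨1, by omega⟩ rfl _ _ _).symm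

/-- A tree evaluated on generators is the composite of the tree, applied to the word formed by
these generators. -/
theorem evFun_wordGen (t : BinTree (T.obj 2)) (f : ℕ → ℕ) {n : ℕ} (ht : t.leaves = n) :
    t.evFun (wordMul T.toOperadData) (fun j => wordGen _ (f j)) =
      wordElt _ ((List.range n).map f) (by simp) (T.evalAt t n ht) := by
  induction t generalizing f n with
  | leaf => subst ht; rfl
  | node c a b iha ihb =>
    have hn : a.leaves + b.leaves = n := ht
    have hb := b.leaves_pos
    have hw : (List.range n).map f = (List.range a.leaves).map f ++
        (List.range b.leaves).map (fun j => f (j + a.leaves)) := by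
      rw [← hn, List.range_add, List.map_append, List.map_map]
      congr 2
      funext j
      simp [add_comm]
    simp only [BinTree.evFun]
    rw [iha f rfl, ihb (fun j => f (j + a.leaves)) rfl,
      wordMul_wordElt _ c _ _ _ _ (r := 1 + b.leaves) (l := n) (by omega) (by omega)
        (by simp; omega) ⟨0, by omega⟩ rfl, wordElt_congr _ hw.symm _ (by simp),
      T.evalAt_node c a b rfl rfl (r := 1 + b.leaves) (by omega) (by omega) ht ⟨0, by omega⟩ rfl]

end NSOperad

/-! ### The free algebra over a quadratic operad -/

namespace BinTree

variable {S : Type u}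

theorem eq_leaf_of_leaves (t : BinTree S) (h : t.leaves = 1) : t = leaf := by
  cases t with
  | leaf => rfl
  | node c a b =>
    have ha := a.leaves_pos
    have hb := b.leaves_pos
    simp only [leaves] at h
    omega

theorem exists_of_leaves_two (t : BinTree S) (h : t.leaves = 2) : ∃ c, t = node c leaf leaf := by
  cases t with
  | leaf => simp [leaves] at h
  | node c a b =>
    have ha := a.leaves_pos
    have hb := b.leaves_pos
    simp only [leaves] at h
    exact ⟨c, by rw [a.eq_leaf_of_leaves (by omega), b.eq_leaf_of_leaves (by omega)]⟩

theorem exists_of_leaves_three (t : BinTree S) (h : t.leaves = 3) :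
    ∃ c d, t = node c (node d leaf leaf) leaf ∨ t = node c leaf (node d leaf leaf) := by
  cases t with
  | leaf => simp [leaves] at h
  | node c a b =>
    have ha := a.leaves_pos
    have hb := b.leaves_pos
    simp only [leaves] at h
    rcases (by omega : a.leaves = 2 ∧ b.leaves = 1 ∨ a.leaves = 1 ∧ b.leaves = 2) with h | h
    · obtain ⟨d, rfl⟩ := a.exists_of_leaves_two h.1
      exact ⟨c, d, Or.inl (by rw [b.eq_leaf_of_leaves h.2])⟩
    · obtain ⟨d, rfl⟩ := b.exists_of_leaves_two h.2
      exact ⟨c, d, Or.inr (by rw [a.eq_leaf_of_leaves h.1])⟩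

end BinTree

/-- A generated ideal is contained in the kernel of a morphism that kills the generators. -/
theorem OperadData.ideal_le_ker (P : OperadData k) {T : OperadData k}
    (φ : ∀ n, P.obj n →ₗ[k] T.obj n)
    (hφ : ∀ {m n l : ℕ} (h : l + 1 = m + n) (i : Fin m) (p : P.obj m) (q : P.obj n),
      φ l (P.comp h i p q) = T.comp h i (φ m p) (φ n q))
    (G : ∀ n, Set (P.obj n)) (hG : ∀ n, ∀ x ∈ G n, φ n x = 0) (n : ℕ) :
    P.ideal G n ≤ LinearMap.ker (φ n) := by
  refine iInf₂_le (fun n => LinearMap.ker (φ n)) ⟨?_, hG⟩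
  rintro m n l h i p q (hp | hq)
  · rw [LinearMap.mem_ker, hφ, LinearMap.mem_ker.1 hp, map_zero, LinearMap.zero_apply]
  · rw [LinearMap.mem_ker, hφ, LinearMap.mem_ker.1 hq, map_zero]

namespace NSOperad

variable (Q : NSOperad k)

theorem evalAt_corolla (c : Q.obj 2) (h : (BinTree.node c BinTree.leaf BinTree.leaf).leaves = 2) :
    Q.evalAt (BinTree.node c BinTree.leaf BinTree.leaf) 2 h = c := by
  have h1 : (BinTree.leaf : BinTree (Q.obj 2)).leaves = 1 := rfl
  rw [Q.evalAt_node c _ _ (r := 2) h1 h1 rfl rfl h 0 rfl, Q.evalAt_leaf]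
  exact (Q.comp_one rfl 0 _).trans (Q.comp_one rfl 1 c)

theorem evalAt_node_left (c d : Q.obj 2)
    (h : (BinTree.node c (BinTree.node d BinTree.leaf BinTree.leaf) BinTree.leaf).leaves = 3) :
    Q.evalAt (BinTree.node c (BinTree.node d BinTree.leaf BinTree.leaf) BinTree.leaf) 3 h =
      Q.comp (n := 2) rfl 0 c d := by
  have h1 : (BinTree.leaf : BinTree (Q.obj 2)).leaves = 1 := rfl
  have h2 : (BinTree.node d BinTree.leaf BinTree.leaf).leaves = 2 := rfl
  rw [Q.evalAt_node c _ _ (r := 2) h2 h1 rfl rfl h 0 rfl, Q.evalAt_leaf,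
    Q.evalAt_corolla]
  exact congrArg (fun z => Q.comp (n := 2) rfl 0 z d) (Q.comp_one rfl 1 c)

theorem evalAt_node_right (c d : Q.obj 2)
    (h : (BinTree.node c BinTree.leaf (BinTree.node d BinTree.leaf BinTree.leaf)).leaves = 3) :
    Q.evalAt (BinTree.node c BinTree.leaf (BinTree.node d BinTree.leaf BinTree.leaf)) 3 h =
      Q.comp (n := 2) rfl 1 c d := by
  have h1 : (BinTree.leaf : BinTree (Q.obj 2)).leaves = 1 := rfl
  have h2 : (BinTree.node d BinTree.leaf BinTree.leaf).leaves = 2 := rfl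
  rw [Q.evalAt_node c _ _ (r := 3) h1 h2 rfl rfl h 0 rfl, Q.evalAt_leaf,
    Q.evalAt_corolla]
  exact Q.comp_one rfl 0 _

theorem endApply_treeEval_wordMul_two (x : (freeNS k (Q.obj 2)).obj 2)
    (a : Fin 2 → WordAlgebra Q.toOperadData) :
    endApply a (treeEval (wordMul Q.toOperadData) 2 x) =
      wordMul Q.toOperadData (Q.eval 2 x) (a 0) (a 1) := by
  induction x using freeNS_induction with
  | zero => simpa using congrArg (fun f => f (a 0) (a 1)) (wordMul_smul Q.toOperadData 0 0).symm
  | add x y hx hy => simp only [map_add, LinearMap.add_apply, hx, hy, wordMul_add]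
  | smul c x hx => simp only [map_smul, LinearMap.smul_apply, hx, wordMul_smul]
  | tree t ht =>
    obtain ⟨c, rfl⟩ := t.exists_of_leaves_two ht
    rw [endApply_treeEval, OperadData.eval_treeElt, Q.evalAt_corolla]
    rfl

theorem endApply_treeEval_wordMul_three (x : (freeNS k (Q.obj 2)).obj 3) (w : Fin 3 → List ℕ)
    (q : ∀ i, Q.obj (w i).length) :
    endApply (fun i => wordElt Q.toOperadData (w i) rfl (q i))
      (treeEval (wordMul Q.toOperadData) 3 x) =
      wordTri Q.toOperadData (w 0) (w 1) (w 2) (q 0) (q 1) (q 2) (Q.eval 3 x) := by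
  induction x using freeNS_induction with
  | zero => simp
  | add x y hx hy => simp only [map_add, hx, hy]
  | smul c x hx => simp only [map_smul, hx]
  | tree t ht =>
    rw [endApply_treeEval, OperadData.eval_treeElt]
    obtain ⟨c, d, rfl | rfl⟩ := t.exists_of_leaves_three ht
    · rw [Q.evalAt_node_left, ← Q.wordMul_wordMul_left]
      rfl
    · rw [Q.evalAt_node_right, ← Q.wordMul_wordMul_right]
      rfl

/-- As the relations of a quadratic operad follow from those of arity at most three, only these
have to be checked in the free algebra. -/
theorem ker_eval_le_ker_treeEval {Q : NSOperad k} (hQ : Q.toOperadData.IsQuadratic) (n : ℕ) :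
    LinearMap.ker (Q.eval n) ≤ LinearMap.ker (treeEval (wordMul Q.toOperadData) n) := by
  refine (hQ n).2.trans (OperadData.ideal_le_ker _
    (T := (endOperad k (WordAlgebra Q.toOperadData)).toOperadData) _ (treeEval_comp _) _ ?_ n)
  rintro m x ⟨rfl | rfl, hx⟩
  · refine endOperad_ext fun a => ?_
    rw [Q.endApply_treeEval_wordMul_two, hx, map_zero]
    simpa using congrArg (fun f => f (a 0) (a 1)) (wordMul_smul Q.toOperadData 0 0)
  · refine endOperad_wordAlgebra_ext fun w q => ?_
    rw [Q.endApply_treeEval_wordMul_three, hx, map_zero, map_zero]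

variable {Q} (hQ : Q.toOperadData.IsQuadratic)

/-- The operations of a quadratic operad on its free algebra. -/
def wordAction (n : ℕ) : Q.obj n →ₗ[k] (endOperad k (WordAlgebra Q.toOperadData)).obj n :=
  (LinearMap.ker (Q.eval n)).liftQ (treeEval (wordMul Q.toOperadData) n)
      (ker_eval_le_ker_treeEval hQ n) ∘ₗ
    ((Q.eval n).quotKerEquivOfSurjective (hQ n).1).symm.toLinearMap

theorem wordAction_eval (n : ℕ) (x : (freeNS k (Q.obj 2)).obj n) :
    wordAction hQ n (Q.eval n x) = treeEval (wordMul Q.toOperadData) n x := by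
  have : ((Q.eval n).quotKerEquivOfSurjective (hQ n).1).symm (Q.eval n x) =
      Submodule.Quotient.mk x := by
    rw [LinearEquiv.symm_apply_eq]
    rfl
  rw [wordAction, LinearMap.comp_apply, LinearEquiv.coe_coe, this, Submodule.liftQ_apply]

theorem wordAction_comp {m n l : ℕ} (h : l + 1 = m + n) (i : Fin m) (p : Q.obj m) (q : Q.obj n) :
    wordAction hQ l (Q.comp h i p q) =
      (endOperad k (WordAlgebra Q.toOperadData)).comp h i (wordAction hQ m p)
        (wordAction hQ n q) := by
  obtain ⟨x, rfl⟩ := (hQ m).1 p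
  obtain ⟨y, rfl⟩ := (hQ n).1 q
  rw [← Q.eval_comp, wordAction_eval, wordAction_eval, wordAction_eval, treeEval_comp]

theorem wordAction_one : wordAction hQ 1 Q.one =
    (endOperad k (WordAlgebra Q.toOperadData)).one := by
  have h : Q.one = Q.eval 1 (freeNS k (Q.obj 2)).one :=
    (Q.eval_treeElt 1 BinTree.leaf rfl).symm
  rw [h, wordAction_eval, treeEval_one]

theorem wordAction_wordGen {n : ℕ} (q : Q.obj n) (f : Fin n → ℕ) :
    endApply (fun i => wordGen _ (f i)) (wordAction hQ n q) =
      wordElt _ (List.ofFn f) (by simp) q := by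
  obtain ⟨x, rfl⟩ := (hQ n).1 q
  rw [wordAction_eval]
  induction x using freeNS_induction with
  | zero => simp
  | add x y hx hy => simp only [map_add, hx, hy]
  | smul c x hx => simp only [map_smul, hx]
  | tree t ht =>
    let g : ℕ → ℕ := fun j => if h : j < n then f ⟨j, h⟩ else 0
    have hg : (List.range n).map g = List.ofFn f := by
      refine List.ext_getElem (by simp) fun j h1 h2 => ?_
      have hj : j < n := by simpa using h2
      simp [g, hj]
    rw [endApply_treeEval, OperadData.eval_treeElt,
      wordElt_congr _ hg.symm _ (by simp), ← Q.evFun_wordGen]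
    refine t.evFun_congr _ fun j hj => ?_
    rw [extendZero_of_lt _ (by omega)]
    simp only [g]
    rw [dif_pos]

/-- The free algebra over (the symmetrization of) a quadratic operad. -/
def wordOperadAlgebra : OperadAlgebra Q.symmetrization where
  carrier := WordAlgebra Q.toOperadData
  α := symExtend (wordAction hQ)
  α_one := by
    refine (symExtend_single _ _ _).trans ?_
    rw [wordAction_one, SymOperadData.act_one]
  α_comp := symExtend_comp _ (endOperad_isEquivariant k _) (wordAction_comp hQ)
  α_act := symExtend_act _

end NSOperad

/-- The coefficient of the word `x₀ ⋯ xₙ₋₁` in the value of an operation on `x₀, …, xₙ₋₁`. -/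
def genericCoeff (T : OperadData k) (n : ℕ) :
    (endOperad k (WordAlgebra T)).obj n →ₗ[k] T.obj n :=
  wordCoeff T (List.ofFn fun i : Fin n => (i : ℕ)) (by simp) ∘ₗ
    endApply fun i : Fin n => wordGen T (i : ℕ)

/-- In the free algebra, an operation `q · σ` with `σ ≠ 1` permutes the generators, so that it does
not contribute to the word `x₀ ⋯ xₙ₋₁`. -/
theorem NSOperad.genericCoeff_α {Q : NSOperad k} (hQ : Q.toOperadData.IsQuadratic) {n : ℕ}
    (σ : Equiv.Perm (Fin n)) (q : Q.obj n) :
    genericCoeff Q.toOperadData n ((NSOperad.wordOperadAlgebra hQ).α n (Finsupp.single σ q)) =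
      if σ = 1 then q else 0 := by
  have h1 : (NSOperad.wordOperadAlgebra hQ).α n (Finsupp.single σ q) =
      (endOperad k (WordAlgebra Q.toOperadData)).act σ (wordAction hQ n q) :=
    symExtend_single _ σ q
  rw [h1, genericCoeff, LinearMap.comp_apply, endApply_act,
    NSOperad.wordAction_wordGen hQ q fun i => ((σ⁻¹ i : Fin n) : ℕ)]
  split_ifs with hσ
  · subst hσ
    exact wordCoeff_wordElt_self _ _ _ q
  · refine wordCoeff_wordElt_of_ne _ (fun e => hσ ?_) _ _ q
    have := List.ofFn_injective e
    rw [← inv_eq_one]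
    exact Equiv.ext fun i => Fin.ext (congrFun this i)

/-! ### Permutations of two and three inputs -/

theorem perm_two_cases (σ : Equiv.Perm (Fin 2)) : σ = 1 ∨ σ = Equiv.swap 0 1 := by
  revert σ; decide

/-- A permutation of the inputs of `p ∘ᵢ q` is determined by its values, for binary `p`, `q`. -/
theorem permComp_eq_of_val (i : Fin 2) (σ τ : Equiv.Perm (Fin 2)) (ρ : Equiv.Perm (Fin 3))
    (hl : ∀ x : Fin 2, x ≠ i → (ρ (if (x : ℕ) < i then 0 else 2) : ℕ) =
      if (σ x : ℕ) < σ i then (σ x : ℕ) else σ x + 1)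
    (hr : ∀ y : Fin 2, (ρ ⟨i + y, by omega⟩ : ℕ) = σ i + τ y) :
    permComp (m := 2) (n := 2) (l := 3) rfl i σ τ = ρ := by
  refine DFunLike.coe_injective (perm_ext_inputEquiv (m := 2) (n := 2) (l := 3) rfl i
    (fun x => ?_) fun y => ?_)
  · rw [permComp_inl (m := 2) (n := 2) (l := 3) rfl i σ τ x rfl rfl]
    apply Fin.ext
    rw [inputEquiv_inl_val]
    have h := hl x.1 x.2
    have h2 : inputEquiv (m := 2) (n := 2) (l := 3) rfl i (Sum.inl x) =
        if (x.1 : ℕ) < i then 0 else 2 := by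
      apply Fin.ext
      rw [inputEquiv_inl_val]
      obtain ⟨x, hx⟩ := x
      have hx' : (x : ℕ) ≠ i := fun e => hx (Fin.ext e)
      have h3 : ((2 : Fin 3) : ℕ) = 2 := rfl
      split_ifs with h1
      · simp only [] at h1 ⊢
        have : ((0 : Fin 3) : ℕ) = 0 := rfl
        omega
      · simp only [] at h1 ⊢
        omega
    rw [h2, h]
    split_ifs <;> simp
  · rw [permComp_inr (m := 2) (n := 2) (l := 3) rfl i σ τ y rfl]
    apply Fin.ext
    rw [inputEquiv_inr_val]
    exact (hr y).symm

theorem permComp_one_swap_one :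
    permComp (m := 2) (n := 2) (l := 3) rfl 1 (Equiv.swap 0 1) 1 = finRotate 3 ^ 2 :=
  permComp_eq_of_val _ _ _ _ (by decide) (by decide)

theorem permComp_zero_swap_one :
    permComp (m := 2) (n := 2) (l := 3) rfl 0 (Equiv.swap 0 1) 1 = finRotate 3 :=
  permComp_eq_of_val _ _ _ _ (by decide) (by decide)

theorem permComp_zero_one_swap :
    permComp (m := 2) (n := 2) (l := 3) rfl 0 1 (Equiv.swap 0 1) = Equiv.swap 0 1 :=
  permComp_eq_of_val _ _ _ _ (by decide) (by decide)

theorem permComp_zero_swap_swap :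
    permComp (m := 2) (n := 2) (l := 3) rfl 0 (Equiv.swap 0 1) (Equiv.swap 0 1) = Equiv.swap 0 2 :=
  permComp_eq_of_val _ _ _ _ (by decide) (by decide)

/-! ### The quadratic dual of a symmetric operad -/

theorem SymOperadData.ideal_le_ker (P : SymOperadData k) {T : SymOperadData k}
    (φ : ∀ n, P.obj n →ₗ[k] T.obj n)
    (hφ : ∀ {m n l : ℕ} (h : l + 1 = m + n) (i : Fin m) (p : P.obj m) (q : P.obj n),
      φ l (P.comp h i p q) = T.comp h i (φ m p) (φ n q))
    (hact : ∀ {n : ℕ} (σ : Equiv.Perm (Fin n)) (p : P.obj n),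
      φ n (P.act σ p) = T.act σ (φ n p))
    (G : ∀ n, Set (P.obj n)) (hG : ∀ n, ∀ x ∈ G n, φ n x = 0) (n : ℕ) :
    P.ideal G n ≤ LinearMap.ker (φ n) := by
  refine iInf₂_le (fun n => LinearMap.ker (φ n)) ⟨⟨?_, ?_⟩, hG⟩
  · rintro m n l h i p q (hp | hq)
    · rw [LinearMap.mem_ker, hφ, LinearMap.mem_ker.1 hp, map_zero, LinearMap.zero_apply]
    · rw [LinearMap.mem_ker, hφ, LinearMap.mem_ker.1 hq, map_zero]
  · intro n σ p hp
    rw [LinearMap.mem_ker, hact, LinearMap.mem_ker.1 hp, map_zero]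

theorem SymOperadData.dual_isEquivariant (P : SymOperadData k) : P.dual.IsEquivariant :=
  SymOperadData.IsEquivariant.quotient (OperadData.symmetrization_isEquivariant _) _ _

theorem SymOperadData.dualGen_dualSwap (P : SymOperadData k) (f : Module.Dual k (P.obj 2)) :
    P.dualGen (P.dualSwap f) = P.dual.act (Equiv.swap 0 1) (P.dualGen f) :=
  (Submodule.Quotient.eq _).2 (SymOperadData.subset_ideal _ _ _ (SymOperadData.DualRel.swap f))

/-- The relations of the quadratic dual, in terms of a finite family of pairs of generators. -/
theorem SymOperadData.dual_sum_eq_zero (P : SymOperadData k) {I : Type*} (s : Finset I) (c : I → k)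
    (j : I → Fin 3) (f g : I → Module.Dual k (P.obj 2))
    (H : ∀ x ∈ P.relations, ∑ i ∈ s, c i *
      TensorProduct.dualDistrib k _ _ (f i ⊗ₜ g i) (x (j i)) = 0) :
    ∑ i ∈ s, c i • P.dual.act (finRotate 3 ^ (j i : ℕ))
      (P.dual.comp (m := 2) (n := 2) (l := 3) rfl 0 (P.dualGen (f i)) (P.dualGen (g i))) = 0 := by
  let w : Fin 3 × Module.Dual k (P.obj 2) × Module.Dual k (P.obj 2) →₀ k :=
    ∑ i ∈ s, Finsupp.single (j i, f i, g i) (c i)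
  have hw : ∀ {M : Type u} [AddCommGroup M] [Module k M]
      (F : Fin 3 × Module.Dual k (P.obj 2) × Module.Dual k (P.obj 2) → M),
      (w.sum fun z c => c • F z) = ∑ i ∈ s, c i • F (j i, f i, g i) := by
    intro M _ _ F
    rw [← Finsupp.linearCombination_apply, map_sum]
    exact Finset.sum_congr rfl fun i _ => Finsupp.linearCombination_single k _ _
  have hrel := SymOperadData.DualRel.quadratic (P := P) w fun x hx =>
    (hw (fun z => TensorProduct.dualDistrib k _ _ (z.2.1 ⊗ₜ z.2.2) (x z.1))).trans (H x hx)
  have hmem := (Submodule.Quotient.mk_eq_zero _).2 (SymOperadData.subset_ideal _ _ _ hrel)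
  rw [hw (fun z => (freeSym k _).act (finRotate 3 ^ (z.1 : ℕ))
    ((freeSym k _).comp _ 0 (freeSymGen k z.2.1) (freeSymGen k z.2.2)))] at hmem
  refine Eq.trans ?_ hmem
  refine Eq.trans ?_ (map_sum (Submodule.mkQ _) _ _).symm
  rfl

namespace OperadData

variable (Q : OperadData k)

/-- The inclusion of the summand `Q(n) · σ` of the symmetrization. -/
def symSingle {n : ℕ} (σ : Equiv.Perm (Fin n)) : Q.obj n →ₗ[k] Q.symmetrization.obj n :=
  Finsupp.lsingle σ

/-- The projection to the summand `Q(n) · σ` of the symmetrization. -/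
def symCoeff {n : ℕ} (σ : Equiv.Perm (Fin n)) : Q.symmetrization.obj n →ₗ[k] Q.obj n :=
  Finsupp.lapply σ

theorem symCoeff_symSingle {n : ℕ} (σ τ : Equiv.Perm (Fin n)) (p : Q.obj n) :
    Q.symCoeff σ (Q.symSingle τ p) = if τ = σ then p else 0 := by
  classical
  refine Eq.trans ?_ (Finsupp.single_apply (a := τ) (a' := σ) (b := p))
  rfl

theorem symSingle_comp {m n l : ℕ} (h : l + 1 = m + n) (i : Fin m) (σ : Equiv.Perm (Fin m))
    (τ : Equiv.Perm (Fin n)) (p : Q.obj m) (q : Q.obj n) :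
    Q.symmetrization.comp h i (Q.symSingle σ p) (Q.symSingle τ q) =
      Q.symSingle (permComp h i σ τ) (Q.comp h (σ i) p q) :=
  Q.symmetrization_comp_single h i σ τ p q

theorem symSingle_act {n : ℕ} (σ τ : Equiv.Perm (Fin n)) (p : Q.obj n) :
    Q.symmetrization.act τ (Q.symSingle σ p) = Q.symSingle (σ * τ) p :=
  Q.symmetrization_act_single σ τ p

/-- Bilinear maps on the symmetrization agree if they agree on the summands. -/
theorem symmetrization_tensor_hom_ext {n : ℕ} {M : Type*} [AddCommGroup M] [Module k M]
    {f g : Q.symmetrization.obj n ⊗[k] Q.symmetrization.obj n →ₗ[k] M}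
    (H : ∀ σ τ p q, f (Q.symSingle σ p ⊗ₜ Q.symSingle τ q) =
      g (Q.symSingle σ p ⊗ₜ Q.symSingle τ q)) : f = g :=
  TensorProduct.ext (Finsupp.lhom_ext fun σ p => Finsupp.lhom_ext fun τ q => H σ τ p q)

/-! ### The morphism from the non-symmetric to the symmetric quadratic dual -/

/-- The restriction of a functional on `Q(2) ⊗ k[Σ₂]` to the summand of `σ`. -/
def dualRestr (σ : Equiv.Perm (Fin 2)) (f : Module.Dual k (Q.symmetrization.obj 2)) :
    Module.Dual k (Q.obj 2) :=
  f ∘ₗ Q.symSingle σ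

theorem dualRestr_dualIncl_one (f : Module.Dual k (Q.obj 2)) :
    Q.dualRestr 1 (Q.dualIncl f) = f := by
  refine LinearMap.ext fun x => ?_
  exact congrArg f (Finsupp.single_eq_same)

theorem dualRestr_dualIncl_swap (f : Module.Dual k (Q.obj 2)) :
    Q.dualRestr (Equiv.swap 0 1) (Q.dualIncl f) = 0 := by
  refine LinearMap.ext fun x => ?_
  exact (congrArg f (Finsupp.single_eq_of_ne (by decide))).trans (map_zero f)

theorem dualRestr_dualSwap (σ : Equiv.Perm (Fin 2)) (f : Module.Dual k (Q.symmetrization.obj 2)) :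
    Q.dualRestr σ (Q.symmetrization.dualSwap f) =
      -Q.dualRestr (σ * Equiv.swap 0 1) f := by
  refine LinearMap.ext fun x => ?_
  exact congrArg (fun y => -f y) (Q.symmetrization_act_single σ (Equiv.swap 0 1) x)

theorem dual_ext {f g : Module.Dual k (Q.symmetrization.obj 2)}
    (h1 : Q.dualRestr 1 f = Q.dualRestr 1 g)
    (h2 : Q.dualRestr (Equiv.swap 0 1) f = Q.dualRestr (Equiv.swap 0 1) g) : f = g :=
  Finsupp.lhom_ext' fun σ => by
    rcases perm_two_cases σ with rfl | rfl
    exacts [h1, h2]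

/-- The morphism from the free non-symmetric operad on `Q(2)^#` whose image is `nsDualInSym`. -/
def freeToDual (n : ℕ) : (freeNS k (Module.Dual k (Q.obj 2))).obj n →ₗ[k]
    Q.symmetrization.dual.obj n :=
  (Q.symmetrization.dualIdeal n).mkQ ∘ₗ
      (Finsupp.lsingle (1 : Equiv.Perm (Fin n)) ∘ₗ freeNSMap k Q.dualIncl n :
        _ →ₗ[k] (freeSym k (Module.Dual k (Q.symmetrization.obj 2))).obj n)

theorem _root_.freeNSMap_treeElt {S S' : Type u} (f : S → S') (n : ℕ) (t : BinTree S)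
    (h : t.leaves = n) :
    freeNSMap k f n (treeElt k n t h) = treeElt k n (t.map f) ((t.leaves_map f).trans h) :=
  Finsupp.mapDomain_single

theorem _root_.freeNSMap_comp {S S' : Type u} (f : S → S') {m n l : ℕ} (h : l + 1 = m + n)
    (i : Fin m) (x : (freeNS k S).obj m) (y : (freeNS k S).obj n) :
    freeNSMap k f l ((freeNS k S).comp h i x y) =
      (freeNS k S').comp h i (freeNSMap k f m x) (freeNSMap k f n y) := by
  induction x using freeNS_induction with
  | zero => simp
  | add x y hx hy => simp only [map_add, LinearMap.add_apply, hx, hy]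
  | smul c x hx => simp only [map_smul, LinearMap.smul_apply, hx]
  | tree t ht =>
  induction y using freeNS_induction with
  | zero => simp
  | add x y hx hy => simp only [map_add, hx, hy]
  | smul c x hx => simp only [map_smul, hx]
  | tree s hs =>
  rw [freeNS_comp_treeElt, freeNSMap_treeElt, freeNSMap_treeElt, freeNSMap_treeElt,
    freeNS_comp_treeElt]
  congr 1
  exact BinTree.map_graft f t s i

theorem freeToDual_comp {m n l : ℕ} (h : l + 1 = m + n) (i : Fin m)
    (x : (freeNS k (Module.Dual k (Q.obj 2))).obj m)
    (y : (freeNS k (Module.Dual k (Q.obj 2))).obj n) :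
    Q.freeToDual l ((freeNS k _).comp h i x y) =
      Q.symmetrization.dual.comp h i (Q.freeToDual m x) (Q.freeToDual n y) := by
  refine congrArg (Q.symmetrization.dualIdeal l).mkQ
    (?_ : Finsupp.single _ (freeNSMap k Q.dualIncl l _) =
    (freeSym k _).comp h i (Finsupp.single 1 (freeNSMap k Q.dualIncl m x))
      (Finsupp.single 1 (freeNSMap k Q.dualIncl n y)))
  rw [freeNSMap_comp]
  refine Eq.trans ?_ (OperadData.symmetrization_comp_single _ h i 1 1 _ _).symm
  rw [permComp_one]
  rfl

theorem freeToDual_gen (f : Module.Dual k (Q.obj 2)) :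
    Q.freeToDual 2 (freeNSGen k f) = Q.symmetrization.dualGen (Q.dualIncl f) := by
  refine congrArg (Q.symmetrization.dualIdeal 2).mkQ
    (congrArg (Finsupp.single (1 : Equiv.Perm (Fin 2))) ?_)
  exact freeNSMap_treeElt _ _ _ _

theorem symCoeff_act_comp (j : Fin 3) (y : Q.symmetrization.obj 2 ⊗[k] Q.symmetrization.obj 2) :
    Q.symCoeff 1 (Q.symmetrization.act (finRotate 3 ^ (j : ℕ)) (TensorProduct.lift
      (Q.symmetrization.comp (m := 2) (n := 2) (l := 3) rfl 0) y)) =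
      ![TensorProduct.lift (Q.comp (m := 2) (n := 2) (l := 3) rfl 0)
          (TensorProduct.map (Q.symCoeff 1) (Q.symCoeff 1) y), 0,
        TensorProduct.lift (Q.comp (m := 2) (n := 2) (l := 3) rfl 1)
          (TensorProduct.map (Q.symCoeff (Equiv.swap 0 1)) (Q.symCoeff 1) y)] j := by
  have h1 : (1 : Equiv.Perm (Fin 2)) ≠ Equiv.swap 0 1 := by decide
  have h2 : (finRotate 3 : Equiv.Perm (Fin 3)) ≠ 1 := by decide
  have h3 : (finRotate 3 : Equiv.Perm (Fin 3)) ^ 2 ≠ 1 := by decide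
  have h4 : (finRotate 3 : Equiv.Perm (Fin 3)) * finRotate 3 ≠ 1 := by decide
  have h5 : (finRotate 3 : Equiv.Perm (Fin 3)) * finRotate 3 ^ 2 = 1 := by decide
  have h6 : (Equiv.swap 0 1 : Equiv.Perm (Fin 3)) ≠ 1 := by decide
  have h7 : (Equiv.swap 0 1 : Equiv.Perm (Fin 3)) * finRotate 3 ≠ 1 := by decide
  have h8 : (Equiv.swap 0 1 : Equiv.Perm (Fin 3)) * finRotate 3 ^ 2 ≠ 1 := by decide
  have h9 : (Equiv.swap 0 2 : Equiv.Perm (Fin 3)) ≠ 1 := by decide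
  have h10 : (Equiv.swap 0 2 : Equiv.Perm (Fin 3)) * finRotate 3 ≠ 1 := by decide
  have h11 : (Equiv.swap 0 2 : Equiv.Perm (Fin 3)) * finRotate 3 ^ 2 ≠ 1 := by decide
  fin_cases j
  · refine LinearMap.congr_fun (f := Q.symCoeff 1 ∘ₗ Q.symmetrization.act (finRotate 3 ^ 0) ∘ₗ
      TensorProduct.lift (Q.symmetrization.comp (m := 2) (n := 2) (l := 3) rfl 0))
      (g := TensorProduct.lift (Q.comp (m := 2) (n := 2) (l := 3) rfl 0) ∘ₗ
        TensorProduct.map (Q.symCoeff 1) (Q.symCoeff 1))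
      (Q.symmetrization_tensor_hom_ext fun σ τ p q => ?_) y
    simp only [LinearMap.comp_apply, TensorProduct.lift.tmul, TensorProduct.map_tmul,
      symSingle_comp, symSingle_act, symCoeff_symSingle]
    rcases perm_two_cases σ with rfl | rfl <;> rcases perm_two_cases τ with rfl | rfl <;>
      simp [permComp_one, permComp_zero_swap_one, permComp_zero_one_swap, permComp_zero_swap_swap,
        h1.symm, h2, h6, h9]
  · refine LinearMap.congr_fun (f := Q.symCoeff 1 ∘ₗ Q.symmetrization.act (finRotate 3 ^ 1) ∘ₗ
      TensorProduct.lift (Q.symmetrization.comp (m := 2) (n := 2) (l := 3) rfl 0))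
      (g := 0) (Q.symmetrization_tensor_hom_ext fun σ τ p q => ?_) y
    simp only [LinearMap.comp_apply, TensorProduct.lift.tmul, symSingle_comp,
      symSingle_act, symCoeff_symSingle]
    rcases perm_two_cases σ with rfl | rfl <;> rcases perm_two_cases τ with rfl | rfl <;>
      simp [permComp_one, permComp_zero_swap_one, permComp_zero_one_swap, permComp_zero_swap_swap,
        h2, h4, h7, h10]
  · refine LinearMap.congr_fun (f := Q.symCoeff 1 ∘ₗ Q.symmetrization.act (finRotate 3 ^ 2) ∘ₗ
      TensorProduct.lift (Q.symmetrization.comp (m := 2) (n := 2) (l := 3) rfl 0))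
      (g := TensorProduct.lift (Q.comp (m := 2) (n := 2) (l := 3) rfl 1) ∘ₗ
        TensorProduct.map (Q.symCoeff (Equiv.swap 0 1)) (Q.symCoeff 1))
      (Q.symmetrization_tensor_hom_ext fun σ τ p q => ?_) y
    simp only [LinearMap.comp_apply, TensorProduct.lift.tmul, TensorProduct.map_tmul,
      symSingle_comp, symSingle_act, symCoeff_symSingle]
    rcases perm_two_cases σ with rfl | rfl <;> rcases perm_two_cases τ with rfl | rfl <;>
      simp [permComp_one, permComp_zero_swap_one, permComp_zero_one_swap, permComp_zero_swap_swap,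
        h1, h1.symm, h3, h5, h8, h11]

/-- The component at `1 ∈ Σ₃` of a relation of the symmetrization is a relation of `Q`. -/
theorem relations_component (X : Fin 3 → Q.symmetrization.obj 2 ⊗[k] Q.symmetrization.obj 2)
    (hX : X ∈ Q.symmetrization.relations) :
    ![TensorProduct.map (Q.symCoeff 1) (Q.symCoeff 1) (X 0),
      TensorProduct.map (Q.symCoeff (Equiv.swap 0 1)) (Q.symCoeff 1) (X 2)] ∈
      Q.nsRelations := by
  have h1 := congrArg (Q.symCoeff 1) (LinearMap.mem_ker.1 hX)
  rw [LinearMap.sum_apply, map_sum, map_zero] at h1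
  simp only [LinearMap.comp_apply, LinearMap.proj_apply, symCoeff_act_comp] at h1
  rw [mem_nsRelations, OperadData.pairComp]
  rw [Fin.sum_univ_three] at h1
  rw [Fin.sum_univ_two]
  simpa using h1

/-- Composition at the second input of a generator, in terms of composition at the first input:
this is where the sign of the pairing for the non-symmetric dual comes from. -/
theorem dual_comp_gen (j : Fin 2) (f g : Module.Dual k (Q.symmetrization.obj 2)) :
    Q.symmetrization.dual.comp (m := 2) (n := 2) (l := 3) rfl j (Q.symmetrization.dualGen f)
      (Q.symmetrization.dualGen g) =
    Q.symmetrization.dual.act (finRotate 3 ^ ((![0, 2] j : Fin 3) : ℕ))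
      (Q.symmetrization.dual.comp (m := 2) (n := 2) (l := 3) rfl 0
        (Q.symmetrization.dualGen (![f, Q.symmetrization.dualSwap f] j))
        (Q.symmetrization.dualGen g)) := by
  fin_cases j
  · exact (Q.symmetrization.dual.act_one _).symm
  · have hsw : ∀ p : Q.symmetrization.dual.obj 2,
        Q.symmetrization.dual.act (Equiv.swap 0 1) (Q.symmetrization.dual.act (Equiv.swap 0 1) p) =
          p := fun p => by
      rw [← SymOperadData.act_mul, Equiv.swap_mul_self, SymOperadData.act_one]
    have h := Q.symmetrization.dual_isEquivariant (m := 2) (n := 2) (l := 3) rfl 1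
      (Equiv.swap 0 1) 1
      (Q.symmetrization.dualGen (Q.symmetrization.dualSwap f)) (Q.symmetrization.dualGen g)
    rw [SymOperadData.dualGen_dualSwap, hsw, SymOperadData.act_one, permComp_one_swap_one,
      Equiv.swap_apply_right] at h
    refine h.trans ?_
    rw [← SymOperadData.dualGen_dualSwap]
    rfl

theorem dualDistrib_map_symCoeff (f g : Module.Dual k (Q.obj 2)) (σ τ : Equiv.Perm (Fin 2))
    (y : Q.symmetrization.obj 2 ⊗[k] Q.symmetrization.obj 2) :
    TensorProduct.dualDistrib k _ _ (f ⊗ₜ g)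
        (TensorProduct.map (Q.symCoeff σ) (Q.symCoeff τ) y) =
      TensorProduct.dualDistrib k _ _ ((f ∘ₗ Q.symCoeff σ) ⊗ₜ (g ∘ₗ Q.symCoeff τ)) y := by
  induction y using TensorProduct.induction_on with
  | zero => simp
  | add y z hy hz => simp only [map_add, hy, hz]
  | tmul a b => rfl

theorem _root_.dualDistrib_neg_tmul {V W : Type*} [AddCommGroup V] [Module k V] [AddCommGroup W]
    [Module k W] (f : Module.Dual k V) (g : Module.Dual k W) (y : V ⊗[k] W) :
    TensorProduct.dualDistrib k V W ((-f) ⊗ₜ g) y =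
      -TensorProduct.dualDistrib k V W (f ⊗ₜ g) y := by
  induction y using TensorProduct.induction_on with
  | zero => simp
  | add y z hy hz => simp only [map_add, hy, hz, neg_add]
  | tmul a b =>
    rw [TensorProduct.dualDistrib_apply, TensorProduct.dualDistrib_apply, LinearMap.neg_apply,
      neg_mul]

theorem dualSwap_dualIncl (f : Module.Dual k (Q.obj 2)) :
    Q.symmetrization.dualSwap (Q.dualIncl f) = -(f ∘ₗ Q.symCoeff (Equiv.swap 0 1)) := by
  refine Q.dual_ext ?_ ?_
  · rw [dualRestr_dualSwap, one_mul, dualRestr_dualIncl_swap]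
    refine LinearMap.ext fun x => ?_
    have : Q.symCoeff (Equiv.swap 0 1) (Q.symSingle 1 x) = 0 :=
      (Q.symCoeff_symSingle _ _ x).trans (if_neg (by decide))
    simp [dualRestr, this]
  · rw [dualRestr_dualSwap, Equiv.swap_mul_self, dualRestr_dualIncl_one]
    refine LinearMap.ext fun x => ?_
    have : Q.symCoeff (Equiv.swap 0 1) (Q.symSingle (Equiv.swap 0 1) x) = x :=
      (Q.symCoeff_symSingle _ _ x).trans (if_pos rfl)
    simp [dualRestr, this]

/-- The relations of the non-symmetric quadratic dual hold in the quadratic dual of the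
symmetrization. -/
theorem freeToDual_eq_zero_of_nsDualRel {n : ℕ} {x : (freeNS k (Module.Dual k (Q.obj 2))).obj n}
    (hx : Q.NSDualRel n x) : Q.freeToDual n x = 0 := by
  cases hx with
  | add f g =>
    have : Q.dualIncl (f + g) = Q.dualIncl f + Q.dualIncl g := rfl
    rw [map_sub, map_sub, freeToDual_gen, freeToDual_gen, freeToDual_gen, this, map_add]
    abel
  | smul c f =>
    have : Q.dualIncl (c • f) = c • Q.dualIncl f := rfl
    rw [map_sub, map_smul, freeToDual_gen, freeToDual_gen, this, map_smul, sub_self]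
  | quadratic w hw =>
    rw [Finsupp.sum, map_sum]
    simp only [map_smul, freeToDual_comp, freeToDual_gen]
    rw [Finset.sum_congr rfl fun z _ => congrArg (w z • ·) (Q.dual_comp_gen z.1 _ _)]
    refine Q.symmetrization.dual_sum_eq_zero w.support w (fun z => ![0, 2] z.1)
      (fun z => ![Q.dualIncl z.2.1, Q.symmetrization.dualSwap (Q.dualIncl z.2.1)] z.1)
      (fun z => Q.dualIncl z.2.2) fun X hX => ?_
    refine Eq.trans ?_ (hw _ (Q.relations_component X hX))
    refine Finset.sum_congr rfl fun z _ => ?_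
    obtain ⟨j, f, g⟩ := z
    fin_cases j
    · simp only []
      rw [pow_zero, mul_one]
      refine congrArg _ ?_
      exact (Q.dualDistrib_map_symCoeff f g 1 1 (X 0)).symm
    · simp only []
      rw [mul_assoc]
      refine congrArg _ ?_
      refine Eq.trans ?_ (congrArg (fun y => (-1 : k) ^ 1 * y)
        (Q.dualDistrib_map_symCoeff f g (Equiv.swap 0 1) 1 (X 2)).symm)
      change TensorProduct.dualDistrib k _ _ (Q.symmetrization.dualSwap (Q.dualIncl f) ⊗ₜ
        Q.dualIncl g) (X 2) = _
      rw [dualSwap_dualIncl, pow_one, neg_one_mul]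
      exact dualDistrib_neg_tmul _ _ _

/-- The morphism from the non-symmetric quadratic dual of `Q` to the quadratic dual of the
symmetrization of `Q`. -/
def nsDualToDual (n : ℕ) : Q.nsDual.obj n →ₗ[k] Q.symmetrization.dual.obj n :=
  Submodule.liftQ _ (Q.freeToDual n)
    (OperadData.ideal_le_ker _ (T := Q.symmetrization.dual.toOperadData) Q.freeToDual
      Q.freeToDual_comp _ (fun _ _ hx => Q.freeToDual_eq_zero_of_nsDualRel hx) n)

theorem nsDualToDual_gen (f : Module.Dual k (Q.obj 2)) :
    Q.nsDualToDual 2 (Q.nsDualGen f) = Q.symmetrization.dualGen (Q.dualIncl f) :=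
  Q.freeToDual_gen f

theorem nsDualToDual_comp {m n l : ℕ} (h : l + 1 = m + n) (i : Fin m) (p : Q.nsDual.obj m)
    (q : Q.nsDual.obj n) : Q.nsDualToDual l (Q.nsDual.comp h i p q) =
      Q.symmetrization.dual.comp h i (Q.nsDualToDual m p) (Q.nsDualToDual n q) := by
  obtain ⟨p, rfl⟩ := Submodule.mkQ_surjective _ p
  obtain ⟨q, rfl⟩ := Submodule.mkQ_surjective _ q
  exact Q.freeToDual_comp h i p q

theorem range_nsDualToDual (n : ℕ) : LinearMap.range (Q.nsDualToDual n) = Q.nsDualInSym n :=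
  Submodule.range_liftQ _ _ _

/-! ### Injectivity of the morphism between the quadratic duals -/

/-- The binary operations by which the quadratic dual of the symmetrization acts on the free algebra
over the non-symmetric quadratic dual; the sign comes from `P(2)^∨ = P(2)^# ⊗ sgn₂`. -/
def dualMul (f : Module.Dual k (Q.symmetrization.obj 2)) :
    WordAlgebra Q.nsDual →ₗ[k] WordAlgebra Q.nsDual →ₗ[k] WordAlgebra Q.nsDual :=
  wordMul Q.nsDual (Q.nsDualGen (Q.dualRestr 1 f)) -
    (wordMul Q.nsDual (Q.nsDualGen (Q.dualRestr (Equiv.swap 0 1) f))).flip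

theorem dualMul_apply (f : Module.Dual k (Q.symmetrization.obj 2)) (a b : WordAlgebra Q.nsDual) :
    Q.dualMul f a b = wordMul Q.nsDual (Q.nsDualGen (Q.dualRestr 1 f)) a b -
      wordMul Q.nsDual (Q.nsDualGen (Q.dualRestr (Equiv.swap 0 1) f)) b a := rfl

/-- The operations on the free algebra over the non-symmetric quadratic dual that are given by the
free symmetric operad on `P(2)^#`. -/
def dualAction (n : ℕ) : (freeSym k (Module.Dual k (Q.symmetrization.obj 2))).obj n →ₗ[k]
    (endOperad k (WordAlgebra Q.nsDual)).obj n :=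
  symExtend (treeEval Q.dualMul) n

theorem dualAction_act {n : ℕ} (σ : Equiv.Perm (Fin n))
    (x : (freeSym k (Module.Dual k (Q.symmetrization.obj 2))).obj n) :
    Q.dualAction n ((freeSym k _).act σ x) = (endOperad k _).act σ (Q.dualAction n x) :=
  symExtend_act _ σ x

theorem dualAction_comp {m n l : ℕ} (h : l + 1 = m + n) (i : Fin m)
    (x : (freeSym k (Module.Dual k (Q.symmetrization.obj 2))).obj m)
    (y : (freeSym k (Module.Dual k (Q.symmetrization.obj 2))).obj n) :
    Q.dualAction l ((freeSym k _).comp h i x y) =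
      (endOperad k _).comp h i (Q.dualAction m x) (Q.dualAction n y) :=
  symExtend_comp (P := freeNS k _) _ (endOperad_isEquivariant k _) (treeEval_comp _) h i x y

theorem endApply_dualAction_gen (f : Module.Dual k (Q.symmetrization.obj 2))
    (a : Fin 2 → WordAlgebra Q.nsDual) :
    endApply a (Q.dualAction 2 (freeSymGen k f)) = Q.dualMul f (a 0) (a 1) := by
  have h : Q.dualAction 2 (freeSymGen k f) = (endOperad k (WordAlgebra Q.nsDual)).act 1
      (treeEval Q.dualMul 2 (freeNSGen k f)) := symExtend_single _ _ _
  rw [h, SymOperadData.act_one]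
  exact endApply_treeEval Q.dualMul 2 _ rfl a

/-- The composite of two generators, cyclically permuted, on homogeneous elements: one term for each
pair of summands of `P(2) = Q(2) ⊕ Q(2) · (12)`. -/
theorem endApply_dualAction_quadratic (j : Fin 3)
    (f g : Module.Dual k (Q.symmetrization.obj 2)) (w : Fin 3 → List ℕ)
    (q : ∀ i, Q.nsDual.obj (w i).length) :
    endApply (fun i => wordElt Q.nsDual (w i) rfl (q i)) (Q.dualAction 3
      ((freeSym k _).act (finRotate 3 ^ (j : ℕ)) ((freeSym k _).comp (m := 2) (n := 2) (l := 3)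
        rfl 0 (freeSymGen k f) (freeSymGen k g)))) =
      wordTri Q.nsDual (w (-j)) (w (1 - j)) (w (2 - j)) (q _) (q _) (q _)
        (Q.nsDual.comp (n := 2) rfl 0 (Q.nsDualGen (Q.dualRestr 1 f))
          (Q.nsDualGen (Q.dualRestr 1 g)))
      - wordTri Q.nsDual (w (1 - j)) (w (-j)) (w (2 - j)) (q _) (q _) (q _)
        (Q.nsDual.comp (n := 2) rfl 0 (Q.nsDualGen (Q.dualRestr 1 f))
          (Q.nsDualGen (Q.dualRestr (Equiv.swap 0 1) g)))
      - wordTri Q.nsDual (w (2 - j)) (w (-j)) (w (1 - j)) (q _) (q _) (q _)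
        (Q.nsDual.comp (n := 2) rfl 1 (Q.nsDualGen (Q.dualRestr (Equiv.swap 0 1) f))
          (Q.nsDualGen (Q.dualRestr 1 g)))
      + wordTri Q.nsDual (w (2 - j)) (w (1 - j)) (w (-j)) (q _) (q _) (q _)
        (Q.nsDual.comp (n := 2) rfl 1 (Q.nsDualGen (Q.dualRestr (Equiv.swap 0 1) f))
          (Q.nsDualGen (Q.dualRestr (Equiv.swap 0 1) g))) := by
  set a := fun i => wordElt Q.nsDual (w i) rfl (q i) with ha
  have h0 : endApply a (Q.dualAction 3
      ((freeSym k _).act (finRotate 3 ^ (j : ℕ)) ((freeSym k _).comp (m := 2) (n := 2) (l := 3)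
        rfl 0 (freeSymGen k f) (freeSymGen k g)))) =
      Q.dualMul f (Q.dualMul g (a (-j)) (a (1 - j))) (a (2 - j)) := by
    rw [dualAction_act, dualAction_comp, endApply_act, endApply_comp, endApply_dualAction_gen,
      endArgs_eq, endArgs_eq, dif_pos rfl, dif_neg (by decide), endApply_dualAction_gen]
    have e0 : (inputEquiv (m := 2) (n := 2) (l := 3) rfl 0 (Sum.inr 0)) = 0 := rfl
    have e1 : (inputEquiv (m := 2) (n := 2) (l := 3) rfl 0 (Sum.inr 1)) = 1 := rfl
    have e2 : (inputEquiv (m := 2) (n := 2) (l := 3) rfl 0 (Sum.inl ⟨1, by decide⟩)) = 2 := rfl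
    rw [e0, e1, e2]
    have hr : ∀ x : Fin 3, (finRotate 3 ^ (j : ℕ))⁻¹ x = x - j := by
      revert j; decide
    rw [hr, hr, hr, zero_sub]
  rw [h0]
  simp only [dualMul_apply, map_sub, LinearMap.sub_apply, ha]
  have hl : ∀ (c d : Q.nsDual.obj 2) (u v w : List ℕ) (p : Q.nsDual.obj u.length)
      (q : Q.nsDual.obj v.length) (r : Q.nsDual.obj w.length),
      wordMul Q.nsDual c (wordMul Q.nsDual d (wordElt _ u rfl p) (wordElt _ v rfl q))
        (wordElt _ w rfl r) = wordTri Q.nsDual u v w p q r (Q.nsDual.comp (n := 2) rfl 0 c d) :=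
    Q.nsDualOperad.wordMul_wordMul_left
  have hr : ∀ (c d : Q.nsDual.obj 2) (u v w : List ℕ) (p : Q.nsDual.obj u.length)
      (q : Q.nsDual.obj v.length) (r : Q.nsDual.obj w.length),
      wordMul Q.nsDual c (wordElt _ u rfl p) (wordMul Q.nsDual d (wordElt _ v rfl q)
        (wordElt _ w rfl r)) = wordTri Q.nsDual u v w p q r (Q.nsDual.comp (n := 2) rfl 1 c d) :=
    Q.nsDualOperad.wordMul_wordMul_right
  rw [hl, hl, hr, hr]
  abel

theorem dualDistrib_map_symSingle (f g : Module.Dual k (Q.symmetrization.obj 2))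
    (σ τ : Equiv.Perm (Fin 2)) (y : Q.obj 2 ⊗[k] Q.obj 2) :
    TensorProduct.dualDistrib k _ _ (f ⊗ₜ g)
        (TensorProduct.map (Q.symSingle σ) (Q.symSingle τ) y) =
      TensorProduct.dualDistrib k _ _ (Q.dualRestr σ f ⊗ₜ Q.dualRestr τ g) y := by
  induction y using TensorProduct.induction_on with
  | zero => simp
  | add y z hy hz => simp only [map_add, hy, hz]
  | tmul a b => rfl

theorem act_lift_comp_map_symSingle (σ τ : Equiv.Perm (Fin 2)) (ρ : Equiv.Perm (Fin 3))
    (y : Q.obj 2 ⊗[k] Q.obj 2) :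
    Q.symmetrization.act ρ (TensorProduct.lift
      (Q.symmetrization.comp (m := 2) (n := 2) (l := 3) rfl 0)
        (TensorProduct.map (Q.symSingle σ) (Q.symSingle τ) y)) =
      Q.symSingle (permComp (m := 2) (n := 2) (l := 3) rfl 0 σ τ * ρ)
        (TensorProduct.lift (Q.comp (m := 2) (n := 2) (l := 3) rfl (σ 0)) y) := by
  induction y using TensorProduct.induction_on with
  | zero => simp
  | add y z hy hz => simp only [map_add, hy, hz]
  | tmul a b =>
    rw [TensorProduct.map_tmul, TensorProduct.lift.tmul, TensorProduct.lift.tmul, symSingle_comp,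
      symSingle_act]

/-- A relation of `Q` gives a relation of its symmetrization for each ordering of the three
inputs. -/
theorem relation_mem_relations (τ : Equiv.Perm (Fin 2)) (j₁ j₂ : Fin 3)
    (h : permComp (m := 2) (n := 2) (l := 3) rfl 0 1 τ * finRotate 3 ^ (j₁ : ℕ) =
      permComp (m := 2) (n := 2) (l := 3) rfl 0 (Equiv.swap 0 1) τ * finRotate 3 ^ (j₂ : ℕ))
    (x : Fin 2 → Q.obj 2 ⊗[k] Q.obj 2) (hx : x ∈ Q.nsRelations) :
    Pi.single j₁ (TensorProduct.map (Q.symSingle 1) (Q.symSingle τ) (x 0)) +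
      Pi.single j₂ (TensorProduct.map (Q.symSingle (Equiv.swap 0 1)) (Q.symSingle τ) (x 1)) ∈
      Q.symmetrization.relations := by
  have hs : ∀ (j : Fin 3) (z : Q.symmetrization.obj 2 ⊗[k] Q.symmetrization.obj 2),
      (∑ i : Fin 3, Q.symmetrization.act (finRotate 3 ^ (i : ℕ)) ∘ₗ
        TensorProduct.lift (Q.symmetrization.comp (m := 2) (n := 2) (l := 3) rfl 0) ∘ₗ
          LinearMap.proj i) (Pi.single j z : Fin 3 → _) =
      Q.symmetrization.act (finRotate 3 ^ (j : ℕ))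
        (TensorProduct.lift (Q.symmetrization.comp (m := 2) (n := 2) (l := 3) rfl 0) z) := by
    intro j z
    rw [LinearMap.sum_apply, Finset.sum_eq_single j]
    · simp only [LinearMap.comp_apply, LinearMap.proj_apply, Pi.single_eq_same]
    · intro i _ hi
      simp only [LinearMap.comp_apply, LinearMap.proj_apply, Pi.single_eq_of_ne hi, map_zero]
    · exact fun h => absurd (Finset.mem_univ _) h
  have hx' : TensorProduct.lift (Q.comp (m := 2) (n := 2) (l := 3) rfl 0) (x 0) +
      TensorProduct.lift (Q.comp (m := 2) (n := 2) (l := 3) rfl 1) (x 1) = 0 := by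
    have := (Q.mem_nsRelations x).1 hx
    rwa [OperadData.pairComp, Fin.sum_univ_two] at this
  refine LinearMap.mem_ker.2 ?_
  rw [map_add, hs, hs, act_lift_comp_map_symSingle, act_lift_comp_map_symSingle, h, ← map_add,
    Equiv.swap_apply_left, Equiv.Perm.one_apply, hx', map_zero]

/-- A quadratic relation among the generators of the quadratic dual of the symmetrization has, for
each ordering of the inputs, a component in which the inputs are in this order; it is a relation of
the non-symmetric quadratic dual. -/
theorem nsDual_component_eq (w : Fin 3 × Module.Dual k (Q.symmetrization.obj 2) ×
      Module.Dual k (Q.symmetrization.obj 2) →₀ k)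
    (hw : ∀ x ∈ Q.symmetrization.relations, (w.sum fun z c =>
        c * TensorProduct.dualDistrib k _ _ (z.2.1 ⊗ₜ z.2.2) (x z.1)) = 0)
    (τ : Equiv.Perm (Fin 2)) (j₁ j₂ : Fin 3)
    (h : permComp (m := 2) (n := 2) (l := 3) rfl 0 1 τ * finRotate 3 ^ (j₁ : ℕ) =
      permComp (m := 2) (n := 2) (l := 3) rfl 0 (Equiv.swap 0 1) τ * finRotate 3 ^ (j₂ : ℕ)) :
    ∑ z ∈ w.support, (if z.1 = j₁ then w z else 0) • Q.nsDual.comp (m := 2) (n := 2) (l := 3) rfl 0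
        (Q.nsDualGen (Q.dualRestr 1 z.2.1)) (Q.nsDualGen (Q.dualRestr τ z.2.2)) =
      ∑ z ∈ w.support, (if z.1 = j₂ then w z else 0) •
        Q.nsDual.comp (m := 2) (n := 2) (l := 3) rfl 1
          (Q.nsDualGen (Q.dualRestr (Equiv.swap 0 1) z.2.1))
          (Q.nsDualGen (Q.dualRestr τ z.2.2)) := by
  have key := Q.nsDual_sum_eq_zero ((Finset.univ : Finset (Fin 2)) ×ˢ w.support)
    (fun i => (-1) ^ (i.1 : ℕ) * if i.2.1 = ![j₁, j₂] i.1 then w i.2 else 0) (fun i => i.1)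
    (fun i => Q.dualRestr (![1, Equiv.swap 0 1] i.1) i.2.2.1) (fun i => Q.dualRestr τ i.2.2.2)
    fun x hx => by
      refine Eq.trans ?_ (hw _ (Q.relation_mem_relations τ j₁ j₂ h x hx))
      rw [Finset.sum_product_right, Finsupp.sum]
      refine Finset.sum_congr rfl fun z _ => ?_
      have hterm : ∀ (j : Fin 3) (σ : Equiv.Perm (Fin 2)) (y : Q.obj 2 ⊗[k] Q.obj 2),
          w z * TensorProduct.dualDistrib k _ _ (z.2.1 ⊗ₜ z.2.2)
            ((Pi.single j (TensorProduct.map (Q.symSingle σ) (Q.symSingle τ) y) : Fin 3 → _) z.1) =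
          (if z.1 = j then w z else 0) * TensorProduct.dualDistrib k _ _
            (Q.dualRestr σ z.2.1 ⊗ₜ Q.dualRestr τ z.2.2) y := by
        intro j σ y
        by_cases hj : z.1 = j
        · subst hj
          rw [Pi.single_eq_same, if_pos rfl, dualDistrib_map_symSingle]
        · rw [Pi.single_eq_of_ne hj, if_neg hj, map_zero, mul_zero, zero_mul]
      rw [Fin.sum_univ_two, Pi.add_apply, map_add, mul_add, hterm, hterm]
      simp only [Fin.val_zero, Fin.val_one, pow_zero, pow_one, one_mul, mul_one, mul_neg, neg_mul,
        neg_neg, Matrix.cons_val_zero, Matrix.cons_val_one]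
      rfl
  rw [Finset.sum_product, Fin.sum_univ_two] at key
  simp only [Fin.val_zero, Fin.val_one, pow_zero, pow_one, one_mul, neg_one_mul, neg_smul,
    Finset.sum_neg_distrib, Matrix.cons_val_zero, Matrix.cons_val_one] at key
  exact add_neg_eq_zero.1 key

theorem dualRestr_add (σ : Equiv.Perm (Fin 2)) (f g : Module.Dual k (Q.symmetrization.obj 2)) :
    Q.dualRestr σ (f + g) = Q.dualRestr σ f + Q.dualRestr σ g := rfl

theorem dualRestr_smul (σ : Equiv.Perm (Fin 2)) (c : k)
    (f : Module.Dual k (Q.symmetrization.obj 2)) :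
    Q.dualRestr σ (c • f) = c • Q.dualRestr σ f := rfl

/-- The quadratic relations of the quadratic dual of the symmetrization hold in the free algebra
over the non-symmetric quadratic dual. -/
theorem dualAction_quadratic (w : Fin 3 × Module.Dual k (Q.symmetrization.obj 2) ×
      Module.Dual k (Q.symmetrization.obj 2) →₀ k)
    (hw : ∀ x ∈ Q.symmetrization.relations, (w.sum fun z c =>
        c * TensorProduct.dualDistrib k _ _ (z.2.1 ⊗ₜ z.2.2) (x z.1)) = 0) :
    Q.dualAction 3 (w.sum fun z c =>
      c • (freeSym k (Module.Dual k (Q.symmetrization.obj 2))).act (finRotate 3 ^ (z.1 : ℕ))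
        ((freeSym k (Module.Dual k (Q.symmetrization.obj 2))).comp (m := 2) (n := 2) (l := 3) rfl 0
          (freeSymGen k z.2.1) (freeSymGen k z.2.2))) = 0 := by
  refine endOperad_wordAlgebra_ext fun v q => ?_
  obtain ⟨F, hF⟩ : ∃ F : Fin 3 → Fin 3 → Fin 3 → Q.nsDual.obj 3 →ₗ[k] WordAlgebra Q.nsDual,
      ∀ a b c, F a b c = wordTri Q.nsDual (v a) (v b) (v c) (q a) (q b) (q c) :=
    ⟨_, fun _ _ _ => rfl⟩
  let A (τ : Equiv.Perm (Fin 2)) (j : Fin 3) : Q.nsDual.obj 3 :=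
    ∑ z ∈ w.support, (if z.1 = j then w z else 0) • Q.nsDual.comp (m := 2) (n := 2) (l := 3) rfl 0
        (Q.nsDualGen (Q.dualRestr 1 z.2.1)) (Q.nsDualGen (Q.dualRestr τ z.2.2))
  let B (τ : Equiv.Perm (Fin 2)) (j : Fin 3) : Q.nsDual.obj 3 :=
    ∑ z ∈ w.support, (if z.1 = j then w z else 0) • Q.nsDual.comp (m := 2) (n := 2) (l := 3) rfl 1
        (Q.nsDualGen (Q.dualRestr (Equiv.swap 0 1) z.2.1)) (Q.nsDualGen (Q.dualRestr τ z.2.2))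
  -- `A τ j` and `B τ j` collect the terms of `w` at `j`, restricted at the root to `Q(2)` and to
  -- `Q(2) · (12)`; the shifts of `j` give the three inputs the same order on both sides
  have h1 : ∀ j, A 1 j = B 1 (j + 2) := fun j =>
    Q.nsDual_component_eq w hw 1 j (j + 2) (by
      rw [permComp_one, permComp_zero_swap_one]; revert j; decide)
  have h2 : ∀ j, A (Equiv.swap 0 1) j = B (Equiv.swap 0 1) (j + 1) := fun j =>
    Q.nsDual_component_eq w hw (Equiv.swap 0 1) j (j + 1) (by
      rw [permComp_zero_one_swap, permComp_zero_swap_swap]; revert j; decide)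
  have h3 : endApply (fun i => wordElt Q.nsDual (v i) rfl (q i)) (Q.dualAction 3 (w.sum fun z c =>
      c • (freeSym k (Module.Dual k (Q.symmetrization.obj 2))).act (finRotate 3 ^ (z.1 : ℕ))
        ((freeSym k (Module.Dual k (Q.symmetrization.obj 2))).comp (m := 2) (n := 2) (l := 3) rfl 0
          (freeSymGen k z.2.1) (freeSymGen k z.2.2)))) =
      ∑ j : Fin 3, (F (-j) (1 - j) (2 - j) (A 1 j) - F (1 - j) (-j) (2 - j) (A (Equiv.swap 0 1) j)
        - F (2 - j) (-j) (1 - j) (B 1 j) + F (2 - j) (1 - j) (-j) (B (Equiv.swap 0 1) j)) := by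
    simp only [A, B, map_sum, ← Finset.sum_sub_distrib, ← Finset.sum_add_distrib]
    rw [Finset.sum_comm, Finsupp.sum, map_sum, map_sum]
    refine Finset.sum_congr rfl fun z _ => ?_
    rw [Finset.sum_eq_single z.1]
    · simp only [map_smul, if_true, ← smul_sub, ← smul_add, hF]
      exact congrArg (w z • ·) (Q.endApply_dualAction_quadratic z.1 z.2.1 z.2.2 v q)
    · intro j _ hj
      rw [if_neg hj.symm]
      simp only [zero_smul, map_zero, sub_zero, add_zero]
    · exact fun h => absurd (Finset.mem_univ _) h
  rw [h3, map_zero, Fin.sum_univ_three]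
  simp only [h1, h2]
  -- the terms cancel in pairs with the same order of the inputs
  change F 0 1 2 (B 1 2) - F 1 0 2 (B (Equiv.swap 0 1) 1) - F 2 0 1 (B 1 0) +
      F 2 1 0 (B (Equiv.swap 0 1) 0) +
    (F 2 0 1 (B 1 0) - F 0 2 1 (B (Equiv.swap 0 1) 2) - F 1 2 0 (B 1 1) +
      F 1 0 2 (B (Equiv.swap 0 1) 1)) +
    (F 1 2 0 (B 1 1) - F 2 1 0 (B (Equiv.swap 0 1) 0) - F 0 1 2 (B 1 2) +
      F 0 2 1 (B (Equiv.swap 0 1) 2)) = 0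
  abel

theorem dualAction_eq_zero_of_dualRel {n : ℕ}
    {x : (freeSym k (Module.Dual k (Q.symmetrization.obj 2))).obj n}
    (hx : Q.symmetrization.DualRel n x) : Q.dualAction n x = 0 := by
  cases hx with
  | add f g =>
    refine endOperad_ext fun a => ?_
    rw [map_sub, map_sub, map_sub, map_sub, map_zero]
    simp only [endApply_dualAction_gen, dualMul_apply, dualRestr_add, map_add, wordMul_add,
      LinearMap.add_apply]
    abel
  | smul c f =>
    refine endOperad_ext fun a => ?_
    rw [map_sub, map_sub, map_smul, map_smul, map_zero]
    simp only [endApply_dualAction_gen, dualMul_apply, dualRestr_smul, map_smul, wordMul_smul,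
      LinearMap.smul_apply, smul_sub, sub_self]
  | swap f =>
    have hneg : ∀ c : Q.nsDual.obj 2, wordMul Q.nsDual (-c) = -wordMul Q.nsDual c := fun c => by
      rw [← neg_one_smul k c, wordMul_smul, neg_one_smul k (wordMul Q.nsDual c)]
    refine endOperad_ext fun a => ?_
    rw [map_sub, map_sub, dualAction_act, endApply_act, endApply_dualAction_gen,
      endApply_dualAction_gen, (endApply a).map_zero]
    have e0 : (Equiv.swap (0 : Fin 2) 1)⁻¹ 0 = 1 := by decide
    have e1 : (Equiv.swap (0 : Fin 2) 1)⁻¹ 1 = 0 := by decide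
    simp only [dualMul_apply, dualRestr_dualSwap, one_mul, Equiv.swap_mul_self, map_neg, hneg,
      LinearMap.neg_apply, e0, e1]
    abel
  | quadratic w hw => exact Q.dualAction_quadratic w hw

theorem dualIdeal_le_ker_dualAction (n : ℕ) :
    Q.symmetrization.dualIdeal n ≤ LinearMap.ker (Q.dualAction n) :=
  SymOperadData.ideal_le_ker _ Q.dualAction Q.dualAction_comp Q.dualAction_act _
    (fun _ _ hx => Q.dualAction_eq_zero_of_dualRel hx) n

theorem dualMul_dualIncl (f : Module.Dual k (Q.obj 2)) :
    Q.dualMul (Q.dualIncl f) = wordMul Q.nsDual (Q.nsDualGen f) := by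
  have h0 : wordMul Q.nsDual (0 : Q.nsDual.obj 2) = 0 := by
    simpa using wordMul_smul Q.nsDual 0 0
  refine LinearMap.ext fun a => LinearMap.ext fun b => ?_
  rw [dualMul_apply, dualRestr_dualIncl_one, dualRestr_dualIncl_swap, map_zero, h0,
    LinearMap.zero_apply, LinearMap.zero_apply, sub_zero]

/-- The projection of the free operad on `Q(2)^#` to the quadratic dual. -/
def nsDualMk (n : ℕ) : (freeNS k (Module.Dual k (Q.obj 2))).obj n →ₗ[k] Q.nsDual.obj n :=
  Submodule.mkQ _

theorem nsDualMk_surjective (n : ℕ) : Function.Surjective (Q.nsDualMk n) :=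
  Submodule.mkQ_surjective _

/-- The free operad on `Q(2)^#`, acting through its image in `P^!`, sends the generators to the word
with coefficient the class in `Q^!`. -/
theorem endApply_treeEval_dualMul_wordGen {n : ℕ}
    (x : (freeNS k (Module.Dual k (Q.obj 2))).obj n) :
    endApply (fun i : Fin n => wordGen Q.nsDual (i : ℕ))
      (treeEval Q.dualMul n (freeNSMap k Q.dualIncl n x)) =
      wordElt Q.nsDual (List.range n) List.length_range (Q.nsDualMk n x) := by
  induction x using freeNS_induction with
  | zero => simp
  | add x y hx hy => simp only [map_add, hx, hy]
  | smul c x hx => simp only [map_smul, hx]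
  | tree t ht =>
    have h1 : (t.map Q.nsDualGen).leaves = n := by rw [BinTree.leaves_map, ht]
    have h2 : t.evFun (fun f => wordMul Q.nsDual (Q.nsDualGen f)) (fun j => wordGen Q.nsDual j) =
        wordElt Q.nsDual ((List.range n).map id) (by simp)
          (Q.nsDualOperad.evalAt (t.map Q.nsDualGen) n h1) :=
      (BinTree.evFun_map _ _ t _).symm.trans
        (Q.nsDualOperad.evFun_wordGen (t.map Q.nsDualGen) id h1)
    rw [freeNSMap_treeElt, endApply_treeEval, BinTree.evFun_map]
    simp only [dualMul_dualIncl]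
    refine (t.evFun_congr _ fun j hj => ?_).trans (h2.trans ?_)
    · rw [extendZero_of_lt _ (by omega)]
    · exact (wordElt_congr _ (List.map_id _) _ _ _).trans
        (congrArg _ (Q.nsDual_evalAt_map t ht h1))

/-- The quadratic dual of `Q` embeds in the quadratic dual of its symmetrization: an element of the
former is recovered from its action on the generators of a free algebra. -/
theorem nsDualToDual_injective (n : ℕ) : Function.Injective (Q.nsDualToDual n) := by
  refine (injective_iff_map_eq_zero _).2 fun y hy => ?_
  obtain ⟨x, rfl⟩ := Q.nsDualMk_surjective n y
  have h1 : (Finsupp.single 1 (freeNSMap k Q.dualIncl n x) :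
      (freeSym k (Module.Dual k (Q.symmetrization.obj 2))).obj n) ∈
      Q.symmetrization.dualIdeal n := (Submodule.Quotient.mk_eq_zero _).1 hy
  have h2 : treeEval Q.dualMul n (freeNSMap k Q.dualIncl n x) = 0 := by
    have : Q.dualAction n (Finsupp.single 1 (freeNSMap k Q.dualIncl n x)) = 0 :=
      Q.dualIdeal_le_ker_dualAction n h1
    exact (SymOperadData.act_one _ _).symm.trans ((symExtend_single _ _ _).symm.trans this)
  have h3 := Q.endApply_treeEval_dualMul_wordGen x
  rw [h2, map_zero] at h3
  rw [← wordCoeff_wordElt_self Q.nsDual (List.range n) List.length_range (Q.nsDualMk n x), ← h3,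
    map_zero]

end OperadData

/-! ### The canonical elements -/

/-- Naturality of the coevaluation. -/
theorem map_coevaluation {V W : Type u} [AddCommGroup V] [Module k V] [Module.Finite k V]
    [AddCommGroup W] [Module k W] [Module.Finite k W] (f : V →ₗ[k] W) :
    TensorProduct.map f LinearMap.id (coevaluation k V 1) =
      TensorProduct.map LinearMap.id f.dualMap (coevaluation k W 1) := by
  let b := Module.Basis.ofVectorSpace k V
  let c := Module.Basis.ofVectorSpace k W
  have h1 : ∀ i, f (b i) = ∑ j, c.coord j (f (b i)) • c j := fun i => (c.sum_repr _).symm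
  have h2 : ∀ j, f.dualMap (c.coord j) = ∑ i, c.coord j (f (b i)) • b.coord i := fun j => by
    refine b.ext fun i => ?_
    rw [LinearMap.dualMap_apply, LinearMap.sum_apply, Finset.sum_eq_single i]
    · rw [LinearMap.smul_apply, b.coord_apply, b.repr_self, Finsupp.single_eq_same, smul_eq_mul,
        mul_one]
    · intro i' _ hi
      rw [LinearMap.smul_apply, b.coord_apply, b.repr_self, Finsupp.single_eq_of_ne hi, smul_zero]
    · exact fun h => absurd (Finset.mem_univ _) h
  rw [coevaluation_apply_one, coevaluation_apply_one]
  simp only [map_sum, TensorProduct.map_tmul, LinearMap.id_apply]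
  change ∑ i, f (b i) ⊗ₜ[k] b.coord i = ∑ j, c j ⊗ₜ[k] f.dualMap (c.coord j)
  rw [Finset.sum_congr rfl fun i _ => congrArg (· ⊗ₜ[k] b.coord i) (h1 i),
    Finset.sum_congr rfl fun j _ => congrArg (c j ⊗ₜ[k] ·) (h2 j)]
  simp only [TensorProduct.sum_tmul, TensorProduct.tmul_sum, TensorProduct.smul_tmul]
  exact Finset.sum_comm

/-- Maps that commute with the actions of the symmetric groups commute with summation over the
action on the suspensions. -/
theorem SymOperadData.map_sSum {T T' : SymOperadData k} {n : ℕ} (φ : T.obj n →ₗ[k] T'.obj n)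
    (hφ : ∀ (σ : Equiv.Perm (Fin n)) x, φ (T.act σ x) = T'.act σ (φ x)) (x : T.obj n) :
    φ (T.sSum n x) = T'.sSum n (φ x) := by
  simp only [SymOperadData.sSum, LinearMap.sum_apply, map_sum, SymOperadData.sAct,
    LinearMap.smul_apply, map_smul, hφ]

namespace OperadData

variable (Q : OperadData k)

/-- The map `Q ⊗ Q^! → P ⊗ P^!` for `P` the symmetrization of `Q`. -/
def symTensorMap (n : ℕ) : (Q.tensor Q.nsDual).obj n →ₗ[k]
    (Q.symmetrization.tensor Q.symmetrization.dual).obj n :=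
  TensorProduct.map (Q.symSingle 1) (Q.nsDualToDual n)

theorem symTensorMap_tmul (n : ℕ) (a : Q.obj n) (b : Q.nsDual.obj n) :
    Q.symTensorMap n (Q.tmul Q.nsDual n a b) =
      Q.symmetrization.tmul Q.symmetrization.dual n (Q.symSingle 1 a) (Q.nsDualToDual n b) := rfl

theorem symTensorMap_comp {m n l : ℕ} (h : l + 1 = m + n) (i : Fin m)
    (x : (Q.tensor Q.nsDual).obj m) (y : (Q.tensor Q.nsDual).obj n) :
    Q.symTensorMap l ((Q.tensor Q.nsDual).comp h i x y) =
      (Q.symmetrization.tensor Q.symmetrization.dual).comp h i (Q.symTensorMap m x)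
        (Q.symTensorMap n y) := by
  induction x using OperadData.tensor_induction with
  | zero => simp
  | add x y hx hy => simp only [map_add, LinearMap.add_apply, hx, hy]
  | tmul a a' =>
  induction y using OperadData.tensor_induction with
  | zero => simp
  | add x y hx hy => simp only [map_add, hx, hy]
  | tmul b b' =>
  refine congrArg₂ (fun u v => Q.symmetrization.tmul Q.symmetrization.dual l u v) ?_
    (Q.nsDualToDual_comp h i a' b')
  rw [symSingle_comp, permComp_one]
  rfl

/-- For the transposition, the sign of the suspension cancels that of `P(2)^∨ = P(2)^# ⊗ sgn₂`. -/
theorem sAct_symTensorMap_gen (σ : Equiv.Perm (Fin 2)) (a : Q.obj 2)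
    (f : Module.Dual k (Q.obj 2)) :
    (Q.symmetrization.tensor Q.symmetrization.dual).sAct σ
      (Q.symTensorMap 2 (Q.tmul Q.nsDual 2 a (Q.nsDualGen f))) =
      Q.symmetrization.tmul Q.symmetrization.dual 2 (Q.symSingle σ a)
        (Q.symmetrization.dualGen (f ∘ₗ Q.symCoeff σ)) := by
  have h : ∀ (x : Q.symmetrization.obj 2) (y : Q.symmetrization.dual.obj 2),
      (Q.symmetrization.tensor Q.symmetrization.dual).act σ
        (Q.symmetrization.tmul Q.symmetrization.dual 2 x y) =
      Q.symmetrization.tmul Q.symmetrization.dual 2 (Q.symmetrization.act σ x)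
        (Q.symmetrization.dual.act σ y) := fun _ _ => rfl
  rw [symTensorMap_tmul, nsDualToDual_gen, SymOperadData.sAct, LinearMap.smul_apply, h,
    symSingle_act, one_mul]
  rcases perm_two_cases σ with rfl | rfl
  · rw [Equiv.Perm.sign_one, Units.val_one, Int.cast_one, one_smul, SymOperadData.act_one]
    rfl
  · rw [← SymOperadData.dualGen_dualSwap, dualSwap_dualIncl, Equiv.Perm.sign_swap (by decide),
      Units.val_neg, Units.val_one, Int.cast_neg, Int.cast_one, map_neg, map_neg, neg_smul,
      one_smul, neg_neg]

/-- The canonical element of the symmetrization is the sum over `Σ₂` of the non-symmetric canonical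
element. -/
theorem canonical_symmetrization [Module.Finite k (Q.obj 2)] :
    Q.symmetrization.canonical =
      (Q.symmetrization.tensor Q.symmetrization.dual).sSum 2 (Q.symTensorMap 2 Q.nsCanonical) := by
  have hid : (LinearMap.id : Q.symmetrization.obj 2 →ₗ[k] _) =
      ∑ σ : Equiv.Perm (Fin 2), Q.symSingle σ ∘ₗ Q.symCoeff σ := by
    refine LinearMap.ext fun x => ?_
    rw [LinearMap.sum_apply]
    exact (Finsupp.univ_sum_single x).symm
  have h1 : coevaluation k (Q.symmetrization.obj 2) 1 = ∑ σ : Equiv.Perm (Fin 2),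
      TensorProduct.map (Q.symSingle σ) (Q.symCoeff σ).dualMap (coevaluation k (Q.obj 2) 1) := by
    have h : ∀ y : Q.symmetrization.obj 2 ⊗[k] Module.Dual k (Q.symmetrization.obj 2),
        y = ∑ σ : Equiv.Perm (Fin 2), TensorProduct.map (Q.symSingle σ) LinearMap.id
            (TensorProduct.map (Q.symCoeff σ) LinearMap.id y) := fun y => by
      induction y using TensorProduct.induction_on with
      | zero => simp only [map_zero, Finset.sum_const_zero]
      | add x y hx hy =>
        simp only [map_add, Finset.sum_add_distrib]
        exact congrArg₂ (· + ·) hx hy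
      | tmul a f =>
        simp only [TensorProduct.map_tmul, LinearMap.id_apply, ← TensorProduct.sum_tmul]
        refine congrArg (· ⊗ₜ[k] f) ((LinearMap.congr_fun hid a).trans ?_)
        rw [LinearMap.sum_apply]
        rfl
    refine (h _).trans ?_
    refine Finset.sum_congr rfl fun σ _ => ?_
    rw [map_coevaluation, ← LinearMap.comp_apply, ← TensorProduct.map_comp, LinearMap.comp_id,
      LinearMap.id_comp]
  rw [SymOperadData.canonical, h1, map_sum, SymOperadData.sSum, LinearMap.sum_apply]
  refine Finset.sum_congr rfl fun σ _ => ?_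
  have h2 : TensorProduct.map LinearMap.id Q.symmetrization.dualGen ∘ₗ
      TensorProduct.map (Q.symSingle σ) (Q.symCoeff σ).dualMap =
      (Q.symmetrization.tensor Q.symmetrization.dual).sAct σ ∘ₗ Q.symTensorMap 2 ∘ₗ
        (TensorProduct.map LinearMap.id Q.nsDualGen : _ →ₗ[k] (Q.tensor Q.nsDual).obj 2) :=
    TensorProduct.ext' fun a f => (Q.sAct_symTensorMap_gen σ a f).symm
  exact LinearMap.congr_fun h2 _

end OperadData

namespace OperadAlgebra

variable {P : SymOperadData k} (A : OperadAlgebra P)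

/-- The pure tensors in `End_A ⊗ P^!`. -/
def coeffTmul (n : ℕ) : (endOperad k A.carrier).obj n →ₗ[k] P.dual.obj n →ₗ[k] A.coeffs.obj n :=
  TensorProduct.mk k _ _

theorem coeffs_act_coeffTmul {n : ℕ} (σ : Equiv.Perm (Fin n)) (f : (endOperad k A.carrier).obj n)
    (φ : P.dual.obj n) : A.coeffs.act σ (A.coeffTmul n f φ) =
      A.coeffTmul n ((endOperad k A.carrier).act σ f) (P.dual.act σ φ) := rfl

/-- The map `P ⊗ P^! → End_A ⊗ P^!`. -/
def coeffMap (n : ℕ) : (P.tensor P.dual).obj n →ₗ[k] A.coeffs.obj n :=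
  TensorProduct.map (A.α n) LinearMap.id

theorem coeffMap_comp {m n l : ℕ} (h : l + 1 = m + n) (i : Fin m) (x : (P.tensor P.dual).obj m)
    (y : (P.tensor P.dual).obj n) :
    A.coeffMap l ((P.tensor P.dual).comp h i x y) =
      A.coeffs.comp h i (A.coeffMap m x) (A.coeffMap n y) := by
  induction x using SymOperadData.tensor_induction with
  | zero => simp
  | add x y hx hy => simp only [map_add, LinearMap.add_apply, hx, hy]
  | tmul a a' =>
  induction y using SymOperadData.tensor_induction with
  | zero => simp
  | add x y hx hy => simp only [map_add, hx, hy]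
  | tmul b b' =>
  exact congrArg (fun u => A.coeffTmul l u (P.dual.comp h i a' b'))
    (A.α_comp h i a b)

theorem coeffMap_act {n : ℕ} (σ : Equiv.Perm (Fin n)) (x : (P.tensor P.dual).obj n) :
    A.coeffMap n ((P.tensor P.dual).act σ x) = A.coeffs.act σ (A.coeffMap n x) := by
  induction x using SymOperadData.tensor_induction with
  | zero => simp
  | add x y hx hy => simp only [map_add, hx, hy]
  | tmul a a' =>
  exact congrArg (fun u => A.coeffTmul n u (P.dual.act σ a'))
    (A.α_act σ a)

theorem coeffs_isEquivariant : A.coeffs.IsEquivariant :=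
  SymOperadData.IsEquivariant.tensor (endOperad_isEquivariant k A.carrier) P.dual_isEquivariant

end OperadAlgebra

/-! ### The constants given by elements of `Q ⊗ Q^!` -/

section Planar

variable {Q : OperadData k} (A : OperadAlgebra Q.symmetrization)

/-- The map `Q ⊗ Q^! → End_A ⊗ P^!` for an algebra `A` over the symmetrization `P` of `Q`. -/
def OperadAlgebra.planarMap (n : ℕ) : (Q.tensor Q.nsDual).obj n →ₗ[k] A.coeffs.obj n :=
  A.coeffMap n ∘ₗ Q.symTensorMap n

theorem OperadAlgebra.planarMap_tmul (n : ℕ) (q : Q.obj n) (φ : Q.nsDual.obj n) :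
    A.planarMap n (Q.tmul Q.nsDual n q φ) = A.coeffTmul n
      (A.α n (Q.symSingle 1 q)) (Q.nsDualToDual n φ) := rfl

theorem OperadAlgebra.planarMap_circ {m n l : ℕ} (h : l + 1 = m + n)
    (x : (Q.tensor Q.nsDual).obj m) (y : (Q.tensor Q.nsDual).obj n) :
    A.planarMap l ((Q.tensor Q.nsDual).circ h x y) =
      A.coeffs.circ h (A.planarMap m x) (A.planarMap n y) := by
  simp only [OperadData.circ, LinearMap.sum_apply, LinearMap.smul_apply, map_sum, map_smul]
  refine Finset.sum_congr rfl fun i _ => congrArg _ ?_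
  exact (congrArg _ (Q.symTensorMap_comp h i x y)).trans (A.coeffMap_comp h i _ _)

theorem OperadAlgebra.canonical_eq [Module.Finite k (Q.obj 2)] :
    A.canonical = A.coeffs.sSum 2 (A.planarMap 2 Q.nsCanonical) :=
  (congrArg (A.coeffMap 2) Q.canonical_symmetrization).trans
    (SymOperadData.map_sSum (A.coeffMap 2) A.coeffMap_act _)

/-- The cochain given by an element of `Q ⊗ Q^!`: the sum over the symmetric group. -/
def OperadAlgebra.planarCochain (m : ℕ) :
    (Q.tensor Q.nsDual).obj (m + 1) →ₗ[k] A.cochains m :=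
  (A.coeffs.sSum (m + 1) ∘ₗ A.planarMap (m + 1)).codRestrict _ fun _ => A.coeffs.sSum_mem _ _

theorem OperadAlgebra.coe_planarCochain (m : ℕ) (y : (Q.tensor Q.nsDual).obj (m + 1)) :
    (A.planarCochain m y : A.coeffs.obj (m + 1)) = A.coeffs.sSum (m + 1) (A.planarMap (m + 1) y) :=
  rfl

variable (Q) in
/-- The family of cochains given by an element of `Q ⊗ Q^!`. -/
def planarConstant (m : ℕ) : (Q.tensor Q.nsDual).obj (m + 1) →ₗ[k] ConstantFamily Q m :=
  LinearMap.pi fun A => A.planarCochain m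

/-- On planar cochains the differential is the bracket with the non-symmetric canonical element, as
summation over the symmetric groups takes brackets to brackets. -/
theorem OperadAlgebra.d_planarCochain [CharZero k] [Module.Finite k (Q.obj 2)] (m : ℕ)
    (y : (Q.tensor Q.nsDual).obj (m + 1)) :
    A.d m (A.planarCochain m y) =
      A.planarCochain (m + 1) ((Q.tensor Q.nsDual).delta Q.nsCanonical m y) := by
  refine Subtype.ext ?_
  have hsign : (-1 : k) ^ ((m + 1 + 1) * (2 + 1)) = (-1 : k) ^ m := by
    rw [pow_mul', pow_succ, pow_succ]
    norm_num [pow_succ]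
  have h1 : (A.d m (A.planarCochain m y) : A.coeffs.obj (m + 2)) =
      A.coeffs.star (m := m + 1) (n := 2) (l := m + 2) rfl (Nat.succ_pos m)
        (A.coeffs.sSum (m + 1) (A.planarMap (m + 1) y)) A.canonical -
      (-1 : k) ^ m • A.coeffs.star (m := 2) (n := m + 1) (l := m + 2) (by omega) two_pos
        A.canonical (A.coeffs.sSum (m + 1) (A.planarMap (m + 1) y)) := rfl
  have h2 : (Q.tensor Q.nsDual).delta Q.nsCanonical m y =
      (Q.tensor Q.nsDual).circ (m := m + 1) (n := 2) (l := m + 2) rfl y Q.nsCanonical -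
      (-1 : k) ^ ((m + 1 + 1) * (2 + 1)) •
        (Q.tensor Q.nsDual).circ (m := 2) (n := m + 1) (l := m + 2) (by omega) Q.nsCanonical y :=
    rfl
  rw [h1, h2, OperadAlgebra.coe_planarCochain, A.canonical_eq,
    SymOperadData.star_sSum _ A.coeffs_isEquivariant,
    SymOperadData.star_sSum _ A.coeffs_isEquivariant, map_sub, map_smul, map_sub, map_smul,
    A.planarMap_circ, A.planarMap_circ, hsign]

theorem constantDelta_planarConstant [CharZero k] [Module.Finite k (Q.obj 2)] (m : ℕ)
    (y : (Q.tensor Q.nsDual).obj (m + 1)) :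
    constantDelta Q m (planarConstant Q m y) =
      planarConstant Q (m + 1) ((Q.tensor Q.nsDual).delta Q.nsCanonical m y) :=
  funext fun A => A.d_planarCochain m y

end Planar

/-! ### The planar constants are independent -/

/-- An element of `Q ⊗ Q^!` is recovered from the cochain that it defines on the free algebra. -/
theorem NSOperad.planarConstant_injective {Q : NSOperad k} (hQ : Q.toOperadData.IsQuadratic)
    (m : ℕ) : Function.Injective (planarConstant Q.toOperadData m) := by
  let A := NSOperad.wordOperadAlgebra hQ
  -- the coefficient of the word `x₀ ⋯ x_m`, which sees only the summand of `σ = 1` in the sum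
  let G : A.coeffs.obj (m + 1) →ₗ[k]
      Q.obj (m + 1) ⊗[k] Q.toOperadData.symmetrization.dual.obj (m + 1) :=
    TensorProduct.map (genericCoeff Q.toOperadData (m + 1)) LinearMap.id
  have hG : ∀ f φ, G (A.coeffTmul (m + 1) f φ) =
      genericCoeff Q.toOperadData (m + 1) f ⊗ₜ[k] φ := fun _ _ => rfl
  have key : ∀ q φ, G (A.coeffs.sSum (m + 1) (A.planarMap (m + 1)
      (Q.toOperadData.tmul Q.toOperadData.nsDual (m + 1) q φ))) =
      q ⊗ₜ[k] Q.toOperadData.nsDualToDual (m + 1) φ := by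
    intro q φ
    have hα : ∀ σ, genericCoeff Q.toOperadData (m + 1)
        (A.α (m + 1) (Q.toOperadData.symSingle σ q)) = if σ = 1 then q else 0 :=
      fun σ => NSOperad.genericCoeff_α hQ σ q
    rw [A.planarMap_tmul, SymOperadData.sSum, LinearMap.sum_apply,
      map_sum, Finset.sum_eq_single 1]
    · rw [SymOperadData.sAct, LinearMap.smul_apply, SymOperadData.act_one, map_smul, hG, hα,
        if_pos rfl, Equiv.Perm.sign_one, Units.val_one, Int.cast_one, one_smul]
    · intro σ _ hσ
      rw [SymOperadData.sAct, LinearMap.smul_apply, A.coeffs_act_coeffTmul, map_smul, hG, ← A.α_act,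
        OperadData.symSingle_act, one_mul, hα, if_neg hσ, TensorProduct.zero_tmul, smul_zero]
    · exact fun h => absurd (Finset.mem_univ _) h
  -- tensoring over a field preserves the injectivity of `Q^! → P^!`
  have hinj : Function.Injective (G ∘ₗ A.coeffs.sSum (m + 1) ∘ₗ A.planarMap (m + 1)) := by
    have h : G ∘ₗ A.coeffs.sSum (m + 1) ∘ₗ A.planarMap (m + 1) =
        (Q.toOperadData.nsDualToDual (m + 1)).lTensor (Q.obj (m + 1)) := TensorProduct.ext' key
    rw [h]
    exact Module.Flat.lTensor_preserves_injective_linearMap _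
      (Q.toOperadData.nsDualToDual_injective (m + 1))
  intro x y hxy
  exact hinj (congrArg G (congrArg Subtype.val (congrFun hxy A)))

/-! ### The planar constants are the order-preserving natural constants -/

/-- The composite in `Q` of the decorations of a black tree. -/
def BlackTree.composite {Q : OperadData k} : {a : ℕ} → BlackTree Q a → Q.obj a
  | _, BlackTree.trivial => Q.one
  | _, BlackTree.graft t h i p _ => Q.comp h i t.composite p

theorem BlackTree.value_eq {Q : OperadData k} (A : OperadAlgebra Q.symmetrization) {a : ℕ}
    (T : BlackTree Q a) : T.value A = A.α a (Q.symSingle 1 T.composite) := by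
  induction T with
  | trivial => exact A.α_one.symm
  | graft t h i p hn ih =>
    have h1 : (BlackTree.graft t h i p hn).value A =
        (endOperad k A.carrier).comp h i (t.value A) (A.α _ (Q.symSingle 1 p)) := rfl
    rw [h1, ih, ← A.α_comp, OperadData.symSingle_comp, permComp_one]
    rfl

theorem naturalConstant_eq {Q : OperadData k} {m : ℕ} (T : BlackTree Q (m + 1))
    (φ : Q.nsDual.obj (m + 1)) : naturalConstant T (Q.nsDualToDual (m + 1) φ) =
      ((m + 1).factorial : k)⁻¹ • planarConstant Q m (Q.tmul Q.nsDual (m + 1) T.composite φ) := by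
  funext A
  refine Subtype.ext ?_
  have h : T.value A ⊗ₜ[k] Q.nsDualToDual (m + 1) φ =
      A.planarMap (m + 1) (Q.tmul Q.nsDual (m + 1) T.composite φ) :=
    congrArg (· ⊗ₜ[k] Q.nsDualToDual (m + 1) φ) (T.value_eq A)
  exact congrArg (fun x => ((m + 1).factorial : k)⁻¹ • A.coeffs.sSum (m + 1) x) h

namespace NSOperad

variable (Q : NSOperad k)

/-- The composites of black trees are closed under partial composition: black trees are built by
adding vertices to legs, so that one adds the vertices of the second tree to the first. -/
theorem exists_composite_comp {m n l : ℕ} (h : l + 1 = m + n) (i : Fin m)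
    (T : BlackTree Q.toOperadData m) (S : BlackTree Q.toOperadData n) :
    ∃ U : BlackTree Q.toOperadData l, U.composite = Q.comp h i T.composite S.composite := by
  induction S generalizing l with
  | trivial =>
    obtain rfl : l = m := by omega
    exact ⟨T, (Q.comp_one h i _).symm⟩
  | @graft a b c S h' j p hp ih =>
    have hi := i.2
    obtain ⟨U, hU⟩ := ih (l := m + a - 1) (by omega)
    refine ⟨U.graft (by omega) ⟨i + j, by omega⟩ p hp, ?_⟩
    simp only [BlackTree.composite]
    rw [hU]
    exact Q.assoc_seq _ _ _ _ i j ⟨i + j, by omega⟩ rfl _ _ _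

theorem exists_composite_evalAt (t : BinTree (Q.obj 2)) {n : ℕ} (h : t.leaves = n) :
    ∃ T : BlackTree Q.toOperadData n, T.composite = Q.evalAt t n h := by
  induction t generalizing n with
  | leaf =>
    subst h
    exact ⟨BlackTree.trivial, rfl⟩
  | node c a b iha ihb =>
    obtain ⟨A, hA⟩ := iha rfl
    obtain ⟨B, hB⟩ := ihb rfl
    let C : BlackTree Q.toOperadData 2 := BlackTree.trivial.graft rfl 0 c le_rfl
    have hC : C.composite = c := Q.one_comp (n := 2) rfl c
    obtain ⟨D, hD⟩ := Q.exists_composite_comp (l := 1 + b.leaves) (by omega) 1 C B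
    have hn : a.leaves + b.leaves = n := h
    obtain ⟨E, hE⟩ := Q.exists_composite_comp (l := n) (by omega) ⟨0, by omega⟩ D A
    refine ⟨E, ?_⟩
    rw [hE, hD, hC, hA, hB]
    exact (Q.evalAt_node c a b rfl rfl _ _ h ⟨0, by omega⟩ rfl).symm

variable {Q}

/-- A quadratic operad is spanned by the composites of trees. -/
theorem span_range_composite (hQ : Q.toOperadData.IsQuadratic) (n : ℕ) :
    Submodule.span k (Set.range (BlackTree.composite (Q := Q.toOperadData) (a := n))) = ⊤ := by
  refine eq_top_iff.2 fun q _ => ?_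
  obtain ⟨x, rfl⟩ := (hQ n).1 q
  induction x using freeNS_induction with
  | zero => rw [map_zero]; exact Submodule.zero_mem _
  | add x y hx hy => rw [map_add]; exact Submodule.add_mem _ (hx trivial) (hy trivial)
  | smul c x hx => rw [map_smul]; exact Submodule.smul_mem _ _ (hx trivial)
  | tree t ht =>
    rw [OperadData.eval_treeElt]
    exact Submodule.subset_span (Q.exists_composite_evalAt t ht)

theorem range_planarConstant [CharZero k] (hQ : Q.toOperadData.IsQuadratic) (m : ℕ) :
    LinearMap.range (planarConstant Q.toOperadData m) =
      orderPreservingConstants Q.toOperadData m := by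
  refine le_antisymm ?_ (Submodule.span_le.2 ?_)
  · rintro _ ⟨y, rfl⟩
    induction y using OperadData.tensor_induction with
    | zero => rw [map_zero]; exact Submodule.zero_mem _
    | add x y hx hy => rw [map_add]; exact Submodule.add_mem _ hx hy
    | tmul q φ =>
      have hq : q ∈ Submodule.span k
          (Set.range (BlackTree.composite (Q := Q.toOperadData) (a := m + 1))) :=
        span_range_composite hQ (m + 1) ▸ Submodule.mem_top
      induction hq using Submodule.span_induction with
      | mem q hq =>
        obtain ⟨T, rfl⟩ := hq
        have hf : ((m + 1).factorial : k) ≠ 0 := Nat.cast_ne_zero.2 (m + 1).factorial_ne_zero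
        have h := naturalConstant_eq T φ
        rw [eq_inv_smul_iff₀ hf] at h
        rw [← h]
        refine Submodule.smul_mem _ _ (Submodule.subset_span ⟨T, _, ?_, rfl⟩)
        rw [← OperadData.range_nsDualToDual]
        exact ⟨φ, rfl⟩
      | zero =>
        rw [map_zero, LinearMap.zero_apply, map_zero]
        exact Submodule.zero_mem _
      | add x y _ _ hx hy =>
        rw [map_add, LinearMap.add_apply, map_add]
        exact Submodule.add_mem _ hx hy
      | smul c x _ hx =>
        rw [map_smul, LinearMap.smul_apply, map_smul]
        exact Submodule.smul_mem _ _ hx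
  · rintro _ ⟨T, φ, hφ, rfl⟩
    rw [← OperadData.range_nsDualToDual] at hφ
    obtain ⟨φ, rfl⟩ := hφ
    rw [naturalConstant_eq]
    exact Submodule.smul_mem _ _ ⟨_, rfl⟩

/-- A quadratic operad has no operations of arity zero, as a tree has at least one leaf. -/
theorem subsingleton_obj_zero (hQ : Q.toOperadData.IsQuadratic) : Subsingleton (Q.obj 0) := by
  have hzero : ∀ q : Q.obj 0, q = 0 := fun q => by
    obtain ⟨x, rfl⟩ := (hQ 0).1 q
    induction x using freeNS_induction with
    | zero => rw [map_zero]
    | add x y hx hy => rw [map_add, hx, hy, add_zero]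
    | smul c x hx => rw [map_smul, hx, smul_zero]
    | tree t ht => exact absurd ht t.leaves_pos.ne'
  exact ⟨fun x y => (hzero x).trans (hzero y).symm⟩

/-- The isomorphism between the order-preserving natural constants and `Q ⊗ Q^!`. -/
def planarEquiv [CharZero k] (hQ : Q.toOperadData.IsQuadratic) (m : ℕ) :
    (Q.toOperadData.tensor Q.toOperadData.nsDual).obj (m + 1) ≃ₗ[k]
      orderPreservingConstants Q.toOperadData m :=
  (LinearEquiv.ofInjective _ (planarConstant_injective hQ m)).trans
    (LinearEquiv.ofEq _ _ (range_planarConstant hQ m))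

end NSOperad

end

theorem mainTheorem7 {k : Type u} [Field k] [CharZero k] (Q : NSOperad k)
    (hQ : Q.toOperadData.IsQuadratic) [Module.Finite k (Q.obj 2)] :
    -- the order-preserving natural constants form a complex
    ∃ hδ : ∀ (m : ℕ), ∀ U ∈ orderPreservingConstants Q.toOperadData m,
        constantDelta Q.toOperadData m U ∈ orderPreservingConstants Q.toOperadData (m + 1),
    (∀ (m : ℕ), ∀ U ∈ orderPreservingConstants Q.toOperadData m,
      constantDelta Q.toOperadData (m + 1) (constantDelta Q.toOperadData m U) = 0) ∧
    -- the target is a complex, with zero component in arity zero (degree `-1`)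
    (∀ (m : ℕ) (t : (Q.toOperadData.tensor Q.toOperadData.nsDual).obj (m + 1)),
      (Q.toOperadData.tensor Q.toOperadData.nsDual).delta Q.toOperadData.nsCanonical (m + 1)
        ((Q.toOperadData.tensor Q.toOperadData.nsDual).delta Q.toOperadData.nsCanonical m t) =
          0) ∧
    Subsingleton ((Q.toOperadData.tensor Q.toOperadData.nsDual).obj 0) ∧
    -- the two complexes are isomorphic
    ∃ Θ : ∀ m : ℕ, orderPreservingConstants Q.toOperadData m ≃ₗ[k]
        (Q.toOperadData.tensor Q.toOperadData.nsDual).obj (m + 1),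
      ∀ (m : ℕ) (U : orderPreservingConstants Q.toOperadData m),
        Θ (m + 1) ⟨constantDelta Q.toOperadData m U, hδ m U U.2⟩ =
          (Q.toOperadData.tensor Q.toOperadData.nsDual).delta Q.toOperadData.nsCanonical m
            (Θ m U) := by
  have hdd : ∀ (m : ℕ) (t : (Q.toOperadData.tensor Q.toOperadData.nsDual).obj (m + 1)),
      (Q.toOperadData.tensor Q.toOperadData.nsDual).delta Q.toOperadData.nsCanonical (m + 1)
        ((Q.toOperadData.tensor Q.toOperadData.nsDual).delta Q.toOperadData.nsCanonical m t) = 0 :=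
    (Q.tensor Q.toOperadData.nsDualOperad).delta_delta Q.toOperadData.nsCanonical
      Q.toOperadData.nsCanonical_circ
  have hδ : ∀ (m : ℕ), ∀ U ∈ orderPreservingConstants Q.toOperadData m,
      constantDelta Q.toOperadData m U ∈ orderPreservingConstants Q.toOperadData (m + 1) := by
    intro m U hU
    rw [← NSOperad.range_planarConstant hQ] at hU ⊢
    obtain ⟨y, rfl⟩ := hU
    exact ⟨_, (constantDelta_planarConstant m y).symm⟩
  refine ⟨hδ, ?_, hdd, ?_, fun m => (NSOperad.planarEquiv hQ m).symm, ?_⟩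
  · intro m U hU
    rw [← NSOperad.range_planarConstant hQ] at hU
    obtain ⟨y, rfl⟩ := hU
    rw [constantDelta_planarConstant, constantDelta_planarConstant, hdd, map_zero]
  · have := NSOperad.subsingleton_obj_zero hQ
    exact inferInstanceAs (Subsingleton (Q.obj 0 ⊗[k] Q.toOperadData.nsDual.obj 0))
  · intro m U
    obtain ⟨y, rfl⟩ := (NSOperad.planarEquiv hQ m).surjective U
    rw [LinearEquiv.symm_apply_apply, LinearEquiv.symm_apply_eq]
    exact Subtype.ext (constantDelta_planarConstant m y)
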